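/- **Setting.** Manifolds are smooth, Hausdorff and second countable; their connected components may have different dimensions. A singular foliation on $M$ is a subsheaf of modules $\mathcal F_M\subseteq\mathfrak X_M$ that is stable under the Lie bracket and locally finitely generated; $T_m\mathcal F_M\subseteq T_mM$ is the space of values at $m$ of its local sections. For a smooth map $\varphi\colon P\to M$, $\varphi^{-1}(\mathcal F_M)$ is the sheaf of vector fields $Z$ on $P$ such that $T\varphi(Z)$ is locally a $C^\infty(P)$-linear combination of sections $X\circ\varphi$ with $X\in\mathcal F_M$. A bi-submersion $(M,\mathcal F_M)\xleftarrow{p}W\xrightarrow{q}(N,\mathcal F_N)$ is a manifold $W$ with two submersions $p,q$ such that $p^{-1}(\mathcal F_M)=q^{-1}(\mathcal F_N)=\Gamma(\ker Tp)+\Gamma(\ker Tq)=:\mathcal F_W$. A morphism from an open subset $\mathcal U\subseteq W$ to a bi-submersion $W'$ between the same foliated manifolds is a smooth map $\varphi\colon\mathcal U\to W'$ with $p'\circ\varphi=p$ and $q'\circ\varphi=q$. Points $w\in W$ and $w'\in W'$ are *equivalent* if there are open neighborhoods $\mathcal U\ni w$ and $\mathcal U'\ni w'$, a manifold $V$, and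 surjective submersions $\delta\colon V\to\mathcal U$, $\eta\colon V\to\mathcal U'$ with $p\circ\delta=p'\circ\eta$ and $q\circ\delta=q'\circ\eta$, and a point $v\in V$ with $\delta(v)=w$, $\eta(v)=w'$. A *bi-transversal* at $w\in W$ is a submanifold $\Sigma\subseteq W$ through $w$ with $T_\sigma\Sigma+T_\sigma\mathcal F_W=T_\sigma W$ for all $\sigma\in\Sigma$ and $T_w\Sigma\oplus T_w\mathcal F_W=T_wW$. It is *good* if $p|_\Sigma$ and $q|_\Sigma$ are embeddings onto submanifolds $p(\Sigma)\subseteq M$, $q(\Sigma)\subseteq N$ satisfying the analogous conditions with respect to $\mathcal F_M$ at $p(w)$ and $\mathcal F_N$ at $q(w)$. A good bi-transversal induces the diffeomorphism $\underline\Sigma\colon p(\Sigma)\to q(\Sigma)$, $p(\sigma)\mapsto q(\sigma)$. Two bi-transversals, at $w$ and at $w'$, *induce the same germ* if $p(w)=p'(w')$ and they can be shrunk to good open neighborhoods $\Sigma$ of $w$ and $\Sigma'$ of $w'$ in them with $p(\Sigma)=p'(\Sigma')$, $q(\Sigma)=q'(\Sigma')$ and $\underline\Sigma=\underline{\Sigma'}$.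 **Proposition.** Let $(M,\mathcal F_M)\xleftarrow{p}W\xrightarrow{q}(N,\mathcal F_N)$ and $(M,\mathcal F_M)\xleftarrow{p'}W'\xrightarrow{q'}(N,\mathcal F_N)$ be bi-submersions, and let $w\in W$, $w'\in W'$. The following are equivalent: (i) $w$ and $w'$ are equivalent. (ii) There are an open neighborhood $\mathcal U$ of $w$ in $W$ and a morphism of bi-submersions $\varphi\colon\mathcal U\to W'$ with $\varphi(w)=w'$. (iii) There are an open neighborhood $\mathcal U'$ of $w'$ in $W'$ and a morphism of bi-submersions $\varphi'\colon\mathcal U'\to W$ with $\varphi'(w')=w$. (iv) There are bi-transversals through $w$ and $w'$ that induce the same germ of diffeomorphisms of transverse singular foliations. Here the diffeomorphism $\underline\Sigma$ induced by a good bi-transversal $\Sigma$ of a bi-submersion is indeed an isomorphism from the foliation that $\mathcal F_M$ induces on $p(\Sigma)$ to the one that $\mathcal F_N$ induces on $q(\Sigma)$; this is part of the assertion. -/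

import Mathlib

open scoped Manifold ContDiff Topology
open TopologicalSpace

universe u

/-- A smooth manifold without boundary (Hausdorff, second countable) whose connected components are
not required to have the same dimension: `piece n` is the open and closed part of dimension `n`,
which may be empty. -/
structure SmoothMfd where
  piece : ℕ → Type u
  [top : ∀ n, TopologicalSpace (piece n)]
  [charted : ∀ n, ChartedSpace (EuclideanSpace ℝ (Fin n)) (piece n)]
  [smooth : ∀ n, IsManifold (𝓡 n) ∞ (piece n)]
  [t2 : ∀ n, T2Space (piece n)]
  [secondCountable : ∀ n, SecondCountableTopology (piece n)]

attribute [instance] SmoothMfd.top SmoothMfd.charted SmoothMfd.smooth SmoothMfd.t2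
  SmoothMfd.secondCountable

noncomputable section

namespace SmoothMfd

/-- The underlying topological space, the disjoint union of the pieces. -/
abbrev Pt (X : SmoothMfd.{u}) : Type u := Σ n, X.piece n

/-- The tangent space at a point. -/
abbrev T (X : SmoothMfd.{u}) (x : X.Pt) : Type := TangentSpace (𝓡 x.1) x.2

/-- Vector fields (not necessarily smooth). A vector field on an open set `U` is represented by
any vector field on `X`, and only its values on `U` count. -/
abbrev VField (X : SmoothMfd.{u}) : Type u := (x : X.Pt) → X.T x

variable {X Y Z : SmoothMfd.{u}}

/-- Smoothness of a function on an open set. -/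
def SmoothFunOn (f : X.Pt → ℝ) (U : Opens X.Pt) : Prop :=
  ∀ n, ContMDiffOn (𝓡 n) 𝓘(ℝ) ∞ (fun y : X.piece n => f ⟨n, y⟩) {y | (⟨n, y⟩ : X.Pt) ∈ U}

/-- Smoothness of a vector field on an open set. -/
def SmoothVFOn (V : X.VField) (U : Opens X.Pt) : Prop :=
  ∀ n, ContMDiffOn (𝓡 n) (𝓡 n).tangent ∞
    (fun y : X.piece n => (⟨y, V ⟨n, y⟩⟩ : TangentBundle (𝓡 n) (X.piece n)))
    {y | (⟨n, y⟩ : X.Pt) ∈ U}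

/-- The Lie bracket of vector fields. -/
def bracket (V V' : X.VField) : X.VField := fun x =>
  VectorField.mlieBracket (𝓡 x.1) (fun y : X.piece x.1 => V ⟨x.1, y⟩)
    (fun y : X.piece x.1 => V' ⟨x.1, y⟩) x.2

/-- The map between the pieces of `x` and of `f x` given by `f`; where `f` does not take values in
the piece of `f x`, which happens only away from `x` if `f` is continuous at `x`, it is `f x`. -/
def rep (f : X.Pt → Y.Pt) (x : X.Pt) : X.piece x.1 → Y.piece (f x).1 := fun z =>
  if h : (f ⟨x.1, z⟩).1 = (f x).1 then h ▸ (f ⟨x.1, z⟩).2 else (f x).2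

/-- Smoothness of a map at a point. -/
def SmoothMapAt (f : X.Pt → Y.Pt) (x : X.Pt) : Prop :=
  ContinuousAt f x ∧ ContMDiffAt (𝓡 x.1) (𝓡 (f x).1) ∞ (rep f x) x.2

/-- The differential `T_x f : T_x X → T_{f x} Y`. -/
def D (f : X.Pt → Y.Pt) (x : X.Pt) : X.T x →L[ℝ] Y.T (f x) :=
  mfderiv (𝓡 x.1) (𝓡 (f x).1) (rep f x) x.2

/-- Submersions. -/
def IsSubmersion (f : X.Pt → Y.Pt) : Prop :=
  ∀ x, SmoothMapAt f x ∧ Function.Surjective (D f x)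

/-- Smooth embeddings. -/
def IsSmoothEmbedding (f : X.Pt → Y.Pt) : Prop :=
  Topology.IsEmbedding f ∧ ∀ x, SmoothMapAt f x ∧ Function.Injective (D f x)

/-- Families of sets of vector fields, one for each open set: `F U V` says that the restriction
of `V` to `U` belongs to the set attached to `U`. -/
abbrev VFFamily (X : SmoothMfd.{u}) : Type u := Opens X.Pt → X.VField → Prop

/-- The values at `x` of the local vector fields of `F` defined near `x`. (For a sheaf of modules
these values form a subspace, and the span adds nothing.) -/
def tangentAt (F : X.VFFamily) (x : X.Pt) : Submodule ℝ (X.T x) :=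
  Submodule.span ℝ {v | ∃ U V, x ∈ U ∧ F U V ∧ V x = v}

end SmoothMfd

open SmoothMfd

/-- A singular foliation: a subsheaf of modules of the sheaf of smooth vector fields that is
stable under the Lie bracket and locally finitely generated. -/
structure SingularFoliation (X : SmoothMfd.{u}) where
  /-- `Mem U V`: the vector field `V` on `U` is a section over `U`. -/
  Mem : X.VFFamily
  smooth : ∀ U V, Mem U V → SmoothVFOn V U
  congr : ∀ U V V', (∀ x ∈ U, V x = V' x) → Mem U V → Mem U V'
  restrict : ∀ U U' V, U' ≤ U → Mem U V → Mem U' V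
  glue : ∀ U V, (∀ x ∈ U, ∃ U' : Opens X.Pt, x ∈ U' ∧ U' ≤ U ∧ Mem U' V) → Mem U V
  zero_mem : ∀ U, Mem U (fun _ => 0)
  add_mem : ∀ U V V', Mem U V → Mem U V' → Mem U (fun x => V x + V' x)
  smul_mem : ∀ U (f : X.Pt → ℝ) V, SmoothFunOn f U → Mem U V → Mem U (fun x => f x • V x)
  bracket_mem : ∀ U V V', Mem U V → Mem U V' → Mem U (bracket V V')
  locally_fg : ∀ m : X.Pt, ∃ U : Opens X.Pt, m ∈ U ∧ ∃ (r : ℕ) (G : Fin r → X.VField),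
    (∀ i, SmoothVFOn (G i) U) ∧
    ∀ U' : Opens X.Pt, U' ≤ U → ∀ V : X.VField, Mem U' V ↔
      ∃ f : Fin r → X.Pt → ℝ, (∀ i, SmoothFunOn (f i) U') ∧
        ∀ x ∈ U', V x = ∑ i, f i x • G i x

/-- The pullback `φ⁻¹(F)`: the vector fields `V` such that `Tφ(V)` is a section of `φ^*F`, that is,
locally a combination with smooth coefficients of fields `G ∘ φ` with `G` in `F`. -/
def pullback {X Y : SmoothMfd.{u}} (φ : X.Pt → Y.Pt) (F : SingularFoliation Y) : X.VFFamily :=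
  fun U V => SmoothVFOn V U ∧
    ∀ x ∈ U, ∃ (U' : Opens X.Pt) (O : Opens Y.Pt), x ∈ U' ∧ U' ≤ U ∧ (∀ y ∈ U', φ y ∈ O) ∧
      ∃ (r : ℕ) (G : Fin r → Y.VField) (f : Fin r → X.Pt → ℝ),
        (∀ i, F.Mem O (G i)) ∧ (∀ i, SmoothFunOn (f i) U') ∧
        ∀ y ∈ U', D φ y (V y) = ∑ i, f i y • G i (φ y)

/-- `Γ(ker Tφ)`: the smooth vector fields tangent to the fibers of `φ`. -/
def vertical {X Y : SmoothMfd.{u}} (φ : X.Pt → Y.Pt) : X.VFFamily :=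
  fun U V => SmoothVFOn V U ∧ ∀ x ∈ U, D φ x (V x) = 0

/-- A bi-submersion `(M, FM) ← W → (N, FN)`. -/
structure BiSubmersion {M N : SmoothMfd.{u}} (FM : SingularFoliation M)
    (FN : SingularFoliation N) (W : SmoothMfd.{u}) where
  p : W.Pt → M.Pt
  q : W.Pt → N.Pt
  submersion_p : IsSubmersion p
  submersion_q : IsSubmersion q
  /-- `p⁻¹(FM) = q⁻¹(FN)` -/
  pullback_eq : ∀ U V, pullback p FM U V ↔ pullback q FN U V
  /-- `p⁻¹(FM) = Γ(ker Tp) + Γ(ker Tq)` -/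
  pullback_eq_sum : ∀ U V, pullback p FM U V ↔
    ∃ ξ ζ : W.VField, vertical p U ξ ∧ vertical q U ζ ∧ ∀ x ∈ U, V x = ξ x + ζ x

namespace BiSubmersion

variable {M N W W' : SmoothMfd.{u}} {FM : SingularFoliation M} {FN : SingularFoliation N}

/-- `(V, δ, η)` is a relation between (the restrictions of the bi-submersions to) the open sets
`U ⊆ W` and `U' ⊆ W'`: `δ` and `η` are submersions onto `U` and `U'` that commute with the maps to
`M` and `N`. -/
structure IsRelation (B : BiSubmersion FM FN W) (B' : BiSubmersion FM FN W')
    (U : Opens W.Pt) (U' : Opens W'.Pt) (V : SmoothMfd.{u})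
    (δ : V.Pt → W.Pt) (η : V.Pt → W'.Pt) : Prop where
  submersion_left : IsSubmersion δ
  submersion_right : IsSubmersion η
  range_left : Set.range δ = U
  range_right : Set.range η = U'
  comm_p : ∀ v, B.p (δ v) = B'.p (η v)
  comm_q : ∀ v, B.q (δ v) = B'.q (η v)

/-- Equivalent points: points that are related through a relation between open neighborhoods. -/
def EquivPoints (B : BiSubmersion FM FN W) (B' : BiSubmersion FM FN W')
    (w : W.Pt) (w' : W'.Pt) : Prop :=
  ∃ (U : Opens W.Pt) (U' : Opens W'.Pt), w ∈ U ∧ w' ∈ U' ∧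
    ∃ (V : SmoothMfd.{u}) (δ : V.Pt → W.Pt) (η : V.Pt → W'.Pt),
      B.IsRelation B' U U' V δ η ∧ ∃ v, δ v = w ∧ η v = w'

/-- `φ`, restricted to the open set `U ⊆ W`, is a morphism of bi-submersions `U → W'`. -/
structure IsLocalMorphism (B : BiSubmersion FM FN W) (B' : BiSubmersion FM FN W')
    (U : Opens W.Pt) (φ : W.Pt → W'.Pt) : Prop where
  smooth : ∀ x ∈ U, SmoothMapAt φ x
  comm_p : ∀ x ∈ U, B'.p (φ x) = B.p x
  comm_q : ∀ x ∈ U, B'.q (φ x) = B.q x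

/-- The foliation `F_W = p⁻¹(FM) = q⁻¹(FN)`. -/
def FW (B : BiSubmersion FM FN W) : W.VFFamily := pullback B.p FM

/-- A bi-transversal at `w`: a submanifold through `w`, given as the image of an embedding `ι`,
that intersects `F_W` cleanly and whose tangent space at `w` is complementary to that of `F_W`. -/
structure BiTransversal (B : BiSubmersion FM FN W) (w : W.Pt) where
  S : SmoothMfd.{u}
  ι : S.Pt → W.Pt
  base : S.Pt
  ι_base : ι base = w
  embedding : IsSmoothEmbedding ι
  clean : ∀ s, (D ι s).range ⊔ tangentAt B.FW (ι s) = ⊤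
  transverse : IsCompl (D ι base).range (tangentAt B.FW (ι base))

/-- The restriction of `f : S → M` to the open neighborhood `A` of `s₀` is a smooth embedding, and
its image intersects `F` cleanly and is transverse to `F` at `f s₀`. -/
structure IsTransverseEmbeddingOn {S M : SmoothMfd.{u}} (f : S.Pt → M.Pt)
    (F : SingularFoliation M) (s₀ : S.Pt) (A : Opens S.Pt) : Prop where
  base_mem : s₀ ∈ A
  embedding : Topology.IsEmbedding (fun s : A => f s)
  immersion : ∀ s ∈ A, SmoothMapAt f s ∧ Function.Injective (D f s)
  clean : ∀ s ∈ A, (D f s).range ⊔ tangentAt F.Mem (f s) = ⊤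
  transverse : IsCompl (D f s₀).range (tangentAt F.Mem (f s₀))

namespace BiTransversal

variable {B : BiSubmersion FM FN W} {B' : BiSubmersion FM FN W'} {w : W.Pt} {w' : W'.Pt}

/-- The open neighborhood `A` of the base point in the bi-transversal is a good bi-transversal. -/
def GoodOn (S₁ : B.BiTransversal w) (A : Opens S₁.S.Pt) : Prop :=
  IsTransverseEmbeddingOn (B.p ∘ S₁.ι) FM S₁.base A ∧
    IsTransverseEmbeddingOn (B.q ∘ S₁.ι) FN S₁.base A

/-- The graph of the map `p(A) → q(A)`, `p(σ) ↦ q(σ)`, that the part `A` of the bi-transversal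
induces. If `A` is good, this is the graph of a diffeomorphism. -/
def inducedGraph (S₁ : B.BiTransversal w) (A : Opens S₁.S.Pt) : Set (M.Pt × N.Pt) :=
  (fun s => (B.p (S₁.ι s), B.q (S₁.ι s))) '' A

/-- Two bi-transversals induce the same germ of diffeomorphisms: after shrinking to good
neighborhoods of the base points, the induced diffeomorphisms `p(A) → q(A)` and `p'(A') → q'(A')`
coincide, including their domains. -/
def SameGerm (S₁ : B.BiTransversal w) (S₂ : B'.BiTransversal w') : Prop :=
  ∃ (A : Opens S₁.S.Pt) (A' : Opens S₂.S.Pt), S₁.GoodOn A ∧ S₂.GoodOn A' ∧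
    B.p w = B'.p w' ∧ S₁.inducedGraph A = S₂.inducedGraph A'

/-- The diffeomorphism `p(A) → q(A)` is an isomorphism from the foliation that `FM` induces on
`p(A)` to the foliation that `FN` induces on `q(A)`. Both are read on `A` through the
diffeomorphisms `p : A → p(A)` and `q : A → q(A)`, where they are the pullbacks of `FM` and `FN`. -/
def InducesFoliationIso (S₁ : B.BiTransversal w) (A : Opens S₁.S.Pt) : Prop :=
  ∀ (O : Opens S₁.S.Pt) (V : S₁.S.VField), O ≤ A →
    (pullback (B.p ∘ S₁.ι) FM O V ↔ pullback (B.q ∘ S₁.ι) FN O V)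

end BiTransversal

end BiSubmersion

end

/-! Let F_W be the common pullback of the two foliations. Since p and q are submersions, T F_W is
the preimage of T F_M under Tp and of T F_N under Tq (`IsSubmersion.tangentAt_pullback`,
`tangentAt_FW`). A complement of T F_W at a point is therefore mapped injectively, by Tp and by Tq,
onto complements of T F_M and T F_N.

Equivalent points are joined by a morphism: compose η with a local section of δ
(`exists_localMorphism_of_equivPoints`). A morphism φ produces a common germ: take a small
submanifold ι through w complementary to F_W and its push-forward φ ∘ ι. As p' ∘ φ = p and q' ∘ φ =
q, both have the same images and induce the same graph, and `BiTransversal.ofTransverse` shows that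
φ ∘ ι is again a bi-transversal (`exists_sameGerm_of_localMorphism`).

The substance is the way back from a common germ to equivalence. The germ gives maps ι and η from
one manifold to W and W' with equal projections to M × N, each transverse to the foliation
(`equivPoints_of_sameGerm`). They must be enlarged until both are submersions. The missing
directions lie in ker Tp + ker Tq, and each vector of either kernel extends to a vector field that
projects to M and N and has a counterpart on W' with the same projections
(`exists_related_of_D_p_eq_zero`): a p-vertical field, corrected by smooth multiples of p-vertical
lifts, projects to a section of F_N, and every section of F_N has a p'-vertical lift to W'. Flowing
along both fields at the same time preserves equality of the projections, by uniqueness for the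
projected differential equation. So the flow time is one more parameter, and after finitely many
parameters both differentials are onto (`HasRelationGerm.sup_span`, `HasRelationGerm.extend`,
`equivPoints_of_maps`). This needs flows that are jointly smooth in time and initial value; they
come from the inverse function theorem on a space of paths (`exists_flow`).

The induced diffeomorphism respects the foliations because a field along ι whose p-projection is
generated by F_M is a combination of sections of p⁻¹(F_M) = q⁻¹(F_N) restricted to ι
(`pullback_comp_of_pullback_comp`). -/

noncomputable section

/-! ### Maps that are smooth near a point -/

section LocalAnalysis

variable {E F G : Type*} [NormedAddCommGroup E] [NormedSpace ℝ E] [NormedAddCommGroup F]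
  [NormedSpace ℝ F] [NormedAddCommGroup G] [NormedSpace ℝ G]

/-- The map `f` is smooth at all points of a neighborhood of `x`. -/
def SmoothNear (f : E → F) (x : E) : Prop := ∀ᶠ y in 𝓝 x, ContDiffAt ℝ ∞ f y

namespace SmoothNear

variable {f f' : E → F} {g : F → G} {x : E}

theorem contDiffAt (h : SmoothNear f x) : ContDiffAt ℝ ∞ f x := h.self_of_nhds

theorem continuousAt (h : SmoothNear f x) : ContinuousAt f x := h.contDiffAt.continuousAt

theorem differentiableAt (h : SmoothNear f x) : DifferentiableAt ℝ f x :=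
  h.contDiffAt.differentiableAt (by simp)

theorem comp (hg : SmoothNear g (f x)) (hf : SmoothNear f x) : SmoothNear (fun y => g (f y)) x := by
  filter_upwards [hf, hf.continuousAt.eventually hg] with y h1 h2
  exact h2.comp y h1

theorem comp_of_eq {y : F} (hg : SmoothNear g y) (hf : SmoothNear f x) (hy : f x = y) :
    SmoothNear (fun z => g (f z)) x := by
  subst hy
  exact hg.comp hf

theorem congr (hf : SmoothNear f x) (h : f' =ᶠ[𝓝 x] f) : SmoothNear f' x := by
  filter_upwards [hf, eventually_eventually_nhds.2 h] with y h1 h2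
  exact h1.congr_of_eventuallyEq h2

theorem _root_.ContDiff.smoothNear (h : ContDiff ℝ ∞ f) : SmoothNear f x :=
  Filter.Eventually.of_forall fun _ => h.contDiffAt

theorem fderiv (h : SmoothNear f x) : SmoothNear (fun y => _root_.fderiv ℝ f y) x :=
  h.mono fun _ hy => hy.fderiv_right (by simp)

theorem prodMk {g : E → G} (hf : SmoothNear f x) (hg : SmoothNear g x) :
    SmoothNear (fun y => (f y, g y)) x := by
  filter_upwards [hf, hg] with y h1 h2 using h1.prodMk h2

end SmoothNear

/-- The inverse function theorem. -/
theorem exists_local_inverse [CompleteSpace E] {f : E → F} {x : E} (hf : SmoothNear f x)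
    (e : E ≃L[ℝ] F) (he : HasFDerivAt f (e : E →L[ℝ] F) x) :
    ∃ g : F → E, SmoothNear g (f x) ∧ g (f x) = x ∧ (∀ᶠ y in 𝓝 (f x), f (g y) = y) ∧
      ∀ᶠ z in 𝓝 x, g (f z) = z := by
  have hs : HasStrictFDerivAt f (e : E →L[ℝ] F) x :=
    he.fderiv ▸ hf.contDiffAt.hasStrictFDerivAt (by simp)
  set φ := hs.toOpenPartialHomeomorph f
  have hφ : (φ : E → F) = f := hs.toOpenPartialHomeomorph_coe
  have hx : x ∈ φ.source := hs.mem_toOpenPartialHomeomorph_source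
  have hfx : f x ∈ φ.target := hφ ▸ φ.map_source hx
  have hgx : φ.symm (f x) = x := by rw [← hφ]; exact φ.left_inv hx
  refine ⟨φ.symm, ?_, hgx, ?_, ?_⟩
  · have hc : Filter.Tendsto φ.symm (𝓝 (f x)) (𝓝 x) := by
      have := φ.continuousAt_symm hfx
      rwa [ContinuousAt, hgx] at this
    -- Invertibility of the derivative is an open condition, so the inverse is smooth at every point
    -- near `f x`, not only at `f x`.
    have he' : ∀ᶠ z in 𝓝 x, ∃ e' : E ≃L[ℝ] F, (e' : E →L[ℝ] F) = fderiv ℝ f z := by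
      have := e.nhds
      rw [← he.fderiv] at this
      exact hf.fderiv.continuousAt this
    filter_upwards [hc.eventually he', hc.eventually hf, φ.open_target.mem_nhds hfx]
      with y ⟨e', h1⟩ h2 h3
    refine φ.contDiffAt_symm (f₀' := e') h3 ?_ (by rwa [hφ])
    rw [hφ, h1]
    exact (h2.differentiableAt (by simp)).hasFDerivAt
  · filter_upwards [φ.open_target.mem_nhds hfx] with y hy
    rw [← hφ]; exact φ.right_inv hy
  · filter_upwards [φ.open_source.mem_nhds hx] with y hy
    rw [← hφ]; exact φ.left_inv hy

/-- Immersions have local left inverses. -/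
theorem exists_local_leftInverse [FiniteDimensional ℝ E] [FiniteDimensional ℝ F] {f : E → F}
    {x : E} (hf : SmoothNear f x) (hi : Function.Injective (fderiv ℝ f x)) :
    ∃ g : F → E, SmoothNear g (f x) ∧ ∀ᶠ z in 𝓝 x, g (f z) = z := by
  have := FiniteDimensional.complete ℝ E
  obtain ⟨B, hB⟩ := LinearMap.exists_leftInverse_of_injective (fderiv ℝ f x : E →ₗ[ℝ] F)
    (LinearMap.ker_eq_bot.2 hi)
  -- Composing with a linear left inverse of the derivative gives a self-map of `E` with derivative
  -- the identity, to which the inverse function theorem applies.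
  set B' : F →L[ℝ] E := LinearMap.toContinuousLinearMap B
  have h1 : SmoothNear (fun y => B' (f y)) x := B'.contDiff.smoothNear.comp hf
  have h2 : HasFDerivAt (fun y => B' (f y))
      ((ContinuousLinearEquiv.refl ℝ E : E ≃L[ℝ] E) : E →L[ℝ] E) x := by
    have h3 : B'.comp (fderiv ℝ f x) = ((ContinuousLinearEquiv.refl ℝ E : E ≃L[ℝ] E) : E →L[ℝ] E) := by
      ext v
      exact LinearMap.congr_fun hB v
    exact h3 ▸ B'.hasFDerivAt.comp x hf.differentiableAt.hasFDerivAt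
  obtain ⟨g, hg, -, -, hg'⟩ := exists_local_inverse h1 _ h2
  exact ⟨fun y => g (B' y), SmoothNear.comp (f := B') hg B'.contDiff.smoothNear, hg'⟩

/-- Submersions have local sections. -/
theorem exists_local_section [FiniteDimensional ℝ F] {f : E → F}
    {x : E} (hf : SmoothNear f x) (hs : Function.Surjective (fderiv ℝ f x)) :
    ∃ g : F → E, SmoothNear g (f x) ∧ g (f x) = x ∧ ∀ᶠ y in 𝓝 (f x), f (g y) = y := by
  have := FiniteDimensional.complete ℝ F
  obtain ⟨R, hR⟩ := LinearMap.exists_rightInverse_of_surjective (fderiv ℝ f x : E →ₗ[ℝ] F)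
    (LinearMap.range_eq_top.2 hs)
  -- On the slice u ↦ x + R' u the map has derivative the identity at 0; a local inverse on this
  -- slice is the section.
  set R' : F →L[ℝ] E := LinearMap.toContinuousLinearMap R
  have hl : ContDiff ℝ ∞ (fun u : F => x + R' u) := contDiff_const.add R'.contDiff
  have h0 : x + R' 0 = x := by simp
  have hf0 : SmoothNear f (x + R' 0) := by rwa [h0]
  have h1 : SmoothNear (fun u => f (x + R' u)) 0 :=
    SmoothNear.comp (f := fun u => x + R' u) hf0 hl.smoothNear
  have h2 : HasFDerivAt (fun u => f (x + R' u))
      ((ContinuousLinearEquiv.refl ℝ F : F ≃L[ℝ] F) : F →L[ℝ] F) 0 := by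
    have h3 : HasFDerivAt f (fderiv ℝ f x) (x + R' 0) := by
      rw [h0]; exact hf.differentiableAt.hasFDerivAt
    have h4 : HasFDerivAt (fun u : F => x + R' u) R' 0 := R'.hasFDerivAt.const_add x
    have h5 : (fderiv ℝ f x).comp R' =
        ((ContinuousLinearEquiv.refl ℝ F : F ≃L[ℝ] F) : F →L[ℝ] F) := by
      ext v
      exact LinearMap.congr_fun hR v
    exact h5 ▸ h3.comp 0 h4
  obtain ⟨g, hg, hg0, hg', -⟩ := exists_local_inverse h1 _ h2
  simp only [h0] at hg hg0 hg'
  exact ⟨fun y => x + R' (g y), SmoothNear.comp (g := fun u => x + R' u) hl.smoothNear hg,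
    by simp only [hg0, h0], hg'⟩

/-- The differential of a submersion has a smooth family of right inverses. -/
theorem exists_smooth_rightInverse_fderiv [FiniteDimensional ℝ F] {f : E → F}
    {x : E} (hf : SmoothNear f x) (hs : Function.Surjective (fderiv ℝ f x)) :
    ∃ R : E → F →L[ℝ] E, SmoothNear R x ∧ ∀ᶠ y in 𝓝 x, ∀ v, fderiv ℝ f y (R y v) = v := by
  have := FiniteDimensional.complete ℝ F
  obtain ⟨R, hR⟩ := LinearMap.exists_rightInverse_of_surjective (fderiv ℝ f x : E →ₗ[ℝ] F)
    (LinearMap.range_eq_top.2 hs)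
  set R' : F →L[ℝ] E := LinearMap.toContinuousLinearMap R
  have hA : SmoothNear (fun y => (fderiv ℝ f y).comp R') x := by
    filter_upwards [hf.fderiv] with y hy using hy.clm_comp contDiffAt_const
  have hAx : (fderiv ℝ f x).comp R' = ((ContinuousLinearEquiv.refl ℝ F : F ≃L[ℝ] F) : F →L[ℝ] F) := by
    ext v
    exact LinearMap.congr_fun hR v
  have hr : ∀ᶠ y in 𝓝 x, ∃ e : F ≃L[ℝ] F, (e : F →L[ℝ] F) = (fderiv ℝ f y).comp R' := by
    have := (ContinuousLinearEquiv.refl ℝ F).nhds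
    rw [← hAx] at this
    exact hA.continuousAt this
  -- With A_y = f'(y) ∘ R', invertible near x because A_x = id, the operator R' ∘ A_y⁻¹ is a right
  -- inverse of f'(y) and is smooth in y.
  refine ⟨fun y => R'.comp ((fderiv ℝ f y).comp R').inverse, ?_, ?_⟩
  · filter_upwards [hA, hr] with y h1 ⟨e, he⟩
    refine contDiffAt_const.clm_comp (ContDiffAt.comp y (g := ContinuousLinearMap.inverse) ?_ h1)
    simp only [← he]
    exact contDiffAt_map_inverse e
  · filter_upwards [hr] with y ⟨e, he⟩ v
    have h3 : (fderiv ℝ f y).comp R' (((fderiv ℝ f y).comp R').inverse v) = v := by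
      rw [← he]; simp
    exact h3

end LocalAnalysis

/-! ### Smooth dependence of flows on the initial value -/

section Superposition

/-- Pointwise application of a continuous family of operators to continuous maps. -/
def pointwiseApply (K : Type*) [TopologicalSpace K] [CompactSpace K] (E F : Type*)
    [NormedAddCommGroup E] [NormedSpace ℝ E] [NormedAddCommGroup F] [NormedSpace ℝ F] :
    C(K, E →L[ℝ] F) →L[ℝ] C(K, E) →L[ℝ] C(K, F) :=
  LinearMap.mkContinuous₂
    (LinearMap.mk₂ ℝ (fun (L : C(K, E →L[ℝ] F)) (γ : C(K, E)) =>
        (⟨fun s => L s (γ s), L.continuous.clm_apply γ.continuous⟩ : C(K, F)))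
      (fun _ _ _ => by ext; simp) (fun _ _ _ => by ext; simp) (fun _ _ _ => by ext; simp)
      (fun _ _ _ => by ext; simp)) 1
    (fun L γ => by
      rw [one_mul, ContinuousMap.norm_le _ (by positivity)]
      intro s
      exact ((L s).le_opNorm _).trans
        (mul_le_mul (L.norm_coe_le_norm s) (γ.norm_coe_le_norm s) (norm_nonneg _)
          ((norm_nonneg _).trans (L.norm_coe_le_norm s))))

variable {K : Type*} [TopologicalSpace K] [CompactSpace K]

/-- The mean value inequality on the segment from `γ s` to `γ s + h s` bounds the remainder at each
`s`. The bound is uniform in `s` because `η ↦ f' ∘ η` is continuous for the sup norm, `K` being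
compact. -/
theorem hasFDerivAt_superposition {E F : Type*}
    [NormedAddCommGroup E] [NormedSpace ℝ E] [NormedAddCommGroup F] [NormedSpace ℝ F]
    (f : C(E, F)) (f' : C(E, E →L[ℝ] F)) (hf : ∀ x, HasFDerivAt f (f' x) x) (γ : C(K, E)) :
    HasFDerivAt (fun γ : C(K, E) => f.comp γ) (pointwiseApply K E F (f'.comp γ)) γ := by
  rw [hasFDerivAt_iff_isLittleO_nhds_zero, Asymptotics.isLittleO_iff]
  intro c hc
  have hcont : Continuous fun η : C(K, E) => f'.comp η := f'.continuous_postcomp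
  obtain ⟨r, hr, hr'⟩ := (Metric.continuousAt_iff (α := C(K, E)) (β := C(K, E →L[ℝ] F))
    (f := fun η => f'.comp η) (a := γ)).1 hcont.continuousAt c hc
  filter_upwards [Metric.ball_mem_nhds (0 : C(K, E)) hr] with h hh
  rw [mem_ball_zero_iff] at hh
  rw [ContinuousMap.norm_le _ (by positivity)]
  intro s
  have key : ‖f (γ s + h s) - f (γ s) - f' (γ s) (γ s + h s - γ s)‖ ≤ c * ‖γ s + h s - γ s‖ := by
    refine Convex.norm_image_sub_le_of_norm_fderiv_le' (𝕜 := ℝ) (s := segment ℝ (γ s) (γ s + h s))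
      (fun x _ => (hf x).differentiableAt) ?_ (convex_segment _ _) (left_mem_segment ℝ _ _)
      (right_mem_segment ℝ _ _)
    intro x hx
    rw [segment_eq_image'] at hx
    obtain ⟨θ, ⟨h0, h1⟩, rfl⟩ := hx
    have h2 : dist (γ + θ • h) γ < r := by
      rw [dist_eq_norm, add_sub_cancel_left, norm_smul, Real.norm_of_nonneg h0]
      exact (mul_le_of_le_one_left (norm_nonneg _) h1).trans_lt hh
    have h3 := ((ContinuousMap.dist_apply_le_dist s).trans_lt (hr' h2)).le
    rw [dist_eq_norm] at h3
    rw [(hf _).fderiv]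
    simpa using h3
  rw [add_sub_cancel_left] at key
  exact key.trans (mul_le_mul_of_nonneg_left (h.norm_coe_le_norm s) hc.le)

/-- The derivative of superposition by `f` is a fixed continuous linear map applied to superposition
by `f'`, so regularity bootstraps. The target changes from `F` to `E →L[ℝ] F` in the induction,
whence the quantifier over `F` and the common universe. -/
theorem contDiff_superposition_nat {E : Type u} [NormedAddCommGroup E] [NormedSpace ℝ E] (n : ℕ) :
    ∀ {F : Type u} [NormedAddCommGroup F] [NormedSpace ℝ F] (f : C(E, F)), ContDiff ℝ n f →
      ContDiff ℝ n fun γ : C(K, E) => f.comp γ := by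
  induction n with
  | zero =>
    intro F _ _ f _
    exact contDiff_zero.2 f.continuous_postcomp
  | succ n ih =>
    intro F _ _ f hf
    obtain ⟨f', hf', hff'⟩ := contDiff_succ_iff_hasFDerivAt.1 hf
    refine contDiff_succ_iff_hasFDerivAt.2 ⟨_, ?_,
      hasFDerivAt_superposition f ⟨f', hf'.continuous⟩ hff'⟩
    exact (pointwiseApply K E F).contDiff.comp (ih ⟨f', hf'.continuous⟩ hf')

theorem contDiff_superposition {E F : Type u} [NormedAddCommGroup E] [NormedSpace ℝ E]
    [NormedAddCommGroup F] [NormedSpace ℝ F] (f : C(E, F)) (hf : ContDiff ℝ ∞ f) :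
    ContDiff ℝ ∞ fun γ : C(K, E) => f.comp γ :=
  contDiff_infty.2 fun n => contDiff_superposition_nat n f (contDiff_infty.1 hf n)

end Superposition

/-! ### Local flows via the inverse function theorem on path spaces -/

section Flow

open unitInterval

variable {E : Type u} [NormedAddCommGroup E]

theorem continuous_projIcc_path (γ : C(I, E)) :
    Continuous fun τ : ℝ => γ (Set.projIcc 0 1 zero_le_one τ) :=
  γ.continuous.comp continuous_projIcc

variable [NormedSpace ℝ E]

/-- The integral from `0` to `s` of a path. -/
def pathIntegral (γ : C(I, E)) (s : ℝ) : E := ∫ τ in (0 : ℝ)..s, γ (Set.projIcc 0 1 zero_le_one τ)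

theorem hasDerivAt_pathIntegral [CompleteSpace E] (γ : C(I, E)) (s : ℝ) :
    HasDerivAt (pathIntegral γ) (γ (Set.projIcc 0 1 zero_le_one s)) s :=
  (continuous_projIcc_path γ).integral_hasStrictDerivAt 0 s |>.hasDerivAt

theorem continuous_pathIntegral [CompleteSpace E] (γ : C(I, E)) : Continuous (pathIntegral γ) :=
  continuous_iff_continuousAt.2 fun s => (hasDerivAt_pathIntegral γ s).continuousAt

/-- Integration of paths, as an operator. -/
def integrationCLM (E : Type*) [NormedAddCommGroup E] [NormedSpace ℝ E] [CompleteSpace E] :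
    C(I, E) →L[ℝ] C(I, E) :=
  LinearMap.mkContinuous
    { toFun := fun γ => ⟨fun s => pathIntegral γ s,
        (continuous_pathIntegral γ).comp continuous_subtype_val⟩
      map_add' := fun γ η => by
        ext s
        simp only [pathIntegral, ContinuousMap.add_apply, ContinuousMap.coe_mk]
        exact intervalIntegral.integral_add
          ((continuous_projIcc_path γ).intervalIntegrable _ _)
          ((continuous_projIcc_path η).intervalIntegrable _ _)
      map_smul' := fun c γ => by
        ext s
        simp [pathIntegral, intervalIntegral.integral_smul] }
    1
    (fun γ => by
      rw [one_mul, ContinuousMap.norm_le _ (norm_nonneg _)]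
      intro s
      have := intervalIntegral.norm_integral_le_of_norm_le_const (a := 0) (b := (s : ℝ))
        (f := fun τ => γ (Set.projIcc 0 1 zero_le_one τ)) (C := ‖γ‖)
        (fun τ _ => γ.norm_coe_le_norm _)
      refine this.trans ?_
      rw [sub_zero, abs_of_nonneg s.2.1]
      exact mul_le_of_le_one_right (norm_nonneg _) s.2.2)

/-- The inclusion of the constant paths. -/
def constCLM (E : Type*) [NormedAddCommGroup E] [NormedSpace ℝ E] : E →L[ℝ] C(I, E) :=
  LinearMap.mkContinuous
    { toFun := fun x => ContinuousMap.const I x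
      map_add' := fun _ _ => rfl
      map_smul' := fun _ _ => rfl } 1
    (fun x => by
      rw [one_mul, ContinuousMap.norm_le _ (norm_nonneg _)]
      exact fun s => le_rfl)

theorem constCLM_apply (x : E) : constCLM E x = ContinuousMap.const I x := rfl

/-- The integral equation of a smooth vector field has solutions that depend smoothly on the
initial value and on the speed. -/
theorem exists_smooth_integral_solution [CompleteSpace E] {X : E → E} (hX : ContDiff ℝ ∞ X)
    (x₀ : E) :
    ∃ γ : ℝ × E → C(I, E), SmoothNear γ (0, x₀) ∧ γ (0, x₀) = ContinuousMap.const I x₀ ∧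
      ∀ᶠ z in 𝓝 ((0 : ℝ), x₀), γ z = constCLM E z.2 +
        z.1 • integrationCLM E ((⟨X, hX.continuous⟩ : C(E, E)).comp (γ z)) := by
  set N : C(I, E) → C(I, E) := fun γ => (⟨X, hX.continuous⟩ : C(E, E)).comp γ with hN
  have hNs : ContDiff ℝ ∞ N := contDiff_superposition _ hX
  set A : (ℝ × E) × C(I, E) → C(I, E) := fun y => constCLM E y.1.2 + y.1.1 • integrationCLM E (N y.2)
  have hA : ContDiff ℝ ∞ A :=
    ((constCLM E).contDiff.comp (contDiff_snd.comp contDiff_fst)).add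
      ((contDiff_fst.comp contDiff_fst).smul
        ((integrationCLM E).contDiff.comp (hNs.comp contDiff_snd)))
  -- The integral equation γ = x + t ∫ X(γ) says that the second component of `f` vanishes, so
  -- inverting `f` along ((t, x), 0) solves it smoothly in (t, x). Putting the speed t in front
  -- keeps the time interval equal to [0, 1].
  set f : (ℝ × E) × C(I, E) → (ℝ × E) × C(I, E) := fun y => (y.1, y.2 - A y)
  have hf : ContDiff ℝ ∞ f := contDiff_fst.prodMk (contDiff_snd.sub hA)
  set y₀ : (ℝ × E) × C(I, E) := ((0, x₀), ContinuousMap.const I x₀)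
  have hA' : HasFDerivAt A (fderiv ℝ A y₀) y₀ := (hA.differentiable (by simp) y₀).hasFDerivAt
  -- At speed 0 the integral term disappears and `A` no longer depends on the path; hence the
  -- derivative of `f` at `y₀` is a shear, which is invertible.
  have hA0 : ∀ η : C(I, E), fderiv ℝ A y₀ (0, η) = 0 := by
    intro η
    have h1 : HasFDerivAt (fun γ : C(I, E) => A ((0, x₀), γ))
        ((fderiv ℝ A y₀).comp (ContinuousLinearMap.inr ℝ (ℝ × E) C(I, E)))
        (ContinuousMap.const I x₀) :=
      HasFDerivAt.comp (g := A) _ hA' (hasFDerivAt_prodMk_right _ _)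
    have h2 : (fun γ : C(I, E) => A ((0, x₀), γ)) = fun _ => constCLM E x₀ := by
      funext γ
      simp [A]
    rw [h2] at h1
    exact congrArg (fun L => L η) (h1.unique (hasFDerivAt_const _ _))
  set e := (ContinuousLinearEquiv.refl ℝ (ℝ × E)).skewProd (ContinuousLinearEquiv.refl ℝ C(I, E))
    (-(fderiv ℝ A y₀).comp (ContinuousLinearMap.inl ℝ (ℝ × E) C(I, E)))
  have he : HasFDerivAt f (e : (ℝ × E) × C(I, E) →L[ℝ] (ℝ × E) × C(I, E)) y₀ := by
    have h1 : HasFDerivAt f ((ContinuousLinearMap.fst ℝ (ℝ × E) C(I, E)).prod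
        (ContinuousLinearMap.snd ℝ (ℝ × E) C(I, E) - fderiv ℝ A y₀)) y₀ :=
      hasFDerivAt_fst.prodMk (hasFDerivAt_snd.sub hA')
    convert h1 using 1
    refine ContinuousLinearMap.ext fun y => ?_
    have h3 : fderiv ℝ A y₀ y = fderiv ℝ A y₀ (y.1, 0) := by
      have : y = (y.1, 0) + (0, y.2) := by simp
      conv_lhs => rw [this]
      rw [map_add, hA0, add_zero]
    refine Prod.ext rfl ?_
    change y.2 + -(fderiv ℝ A y₀ (y.1, 0)) = y.2 - fderiv ℝ A y₀ y
    rw [h3, sub_eq_add_neg]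
  have hfy : f y₀ = ((0, x₀), 0) := by
    refine Prod.ext rfl ?_
    simp [f, A, y₀, constCLM_apply]
  obtain ⟨g, hg, hg0, hfg, -⟩ := exists_local_inverse (hf.smoothNear (x := y₀)) e he
  rw [hfy] at hg hg0 hfg
  have hin : ContDiff ℝ ∞ fun z : ℝ × E => (z, (0 : C(I, E))) := contDiff_id.prodMk contDiff_const
  refine ⟨fun z => (g (z, 0)).2, ?_, ?_, ?_⟩
  · exact SmoothNear.comp (g := Prod.snd) contDiff_snd.smoothNear
      (SmoothNear.comp (f := fun z : ℝ × E => (z, (0 : C(I, E)))) hg hin.smoothNear)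
  · exact congrArg Prod.snd hg0
  · have hc : Filter.Tendsto (fun z : ℝ × E => (z, (0 : C(I, E)))) (𝓝 (0, x₀)) (𝓝 ((0, x₀), 0)) :=
      hin.continuous.continuousAt
    filter_upwards [hc.eventually hfg] with z hz
    have h1 : (g (z, 0)).1 = z := congrArg Prod.fst hz
    have h2 : (g (z, 0)).2 - A (g (z, 0)) = 0 := congrArg Prod.snd hz
    rw [sub_eq_zero] at h2
    conv_lhs => rw [h2]
    simp only [A, h1, hN]

/-- A vector field that is smooth near a point has a local flow: `γ (t, x)` is the integral curve
through `x` of `t • X`. -/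
theorem exists_flow [FiniteDimensional ℝ E] {X : E → E} {x₀ : E} (hX : SmoothNear X x₀) :
    ∃ γ : ℝ × E → ℝ → E, SmoothNear (fun z => γ z 1) (0, x₀) ∧
      HasDerivAt (fun t => γ (t, x₀) 1) (X x₀) 0 ∧
      (∀ z, γ z 0 = z.2) ∧ (∀ x s, γ (0, x) s = x) ∧
      (∀ U ∈ 𝓝 x₀, ∀ᶠ z in 𝓝 ((0 : ℝ), x₀), ∀ s ∈ Set.Icc (0 : ℝ) 1, γ z s ∈ U) ∧
      ∀ᶠ z in 𝓝 ((0 : ℝ), x₀), ∀ s ∈ Set.Icc (0 : ℝ) 1,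
        HasDerivAt (γ z) (z.1 • X (γ z s)) s := by
  have := FiniteDimensional.complete ℝ E
  obtain ⟨r, hr, hr'⟩ := Metric.eventually_nhds_iff_ball.1 hX
  -- The cutoff makes the field globally smooth, as superposition requires; near `x₀` it changes
  -- nothing.
  let b : ContDiffBump x₀ := ⟨r / 3, r / 2, by positivity, by linarith⟩
  set Y : E → E := fun x => b x • X x with hY
  have hYs : ContDiff ℝ ∞ Y := by
    rw [contDiff_iff_contDiffAt]
    intro x
    by_cases hx : x ∈ Metric.ball x₀ r
    · exact b.contDiff.contDiffAt.smul (hr' x hx)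
    · have h0 : Y =ᶠ[𝓝 x] fun _ => 0 := by
        have : (Metric.closedBall x₀ (r / 2))ᶜ ∈ 𝓝 x := by
          refine Metric.isClosed_closedBall.isOpen_compl.mem_nhds ?_
          simp only [Set.mem_compl_iff, Metric.mem_closedBall, Metric.mem_ball, not_lt] at hx ⊢
          linarith
        filter_upwards [this] with y hy
        simp only [Set.mem_compl_iff, Metric.mem_closedBall, not_le] at hy
        rw [hY]
        simp only [b.zero_of_le_dist hy.le, zero_smul]
      exact contDiffAt_const.congr_of_eventuallyEq h0
  have hYX : ∀ᶠ x in 𝓝 x₀, Y x = X x := by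
    filter_upwards [b.eventuallyEq_one] with x hx
    simp [hY, hx]
  obtain ⟨c, hc, hc0, hce⟩ := exists_smooth_integral_solution hYs x₀
  -- Defining the curve by the integral, and not as `c z`, gives the values at `s = 0` and at `t =
  -- 0` for every point, and two-sided derivatives at the ends of [0, 1].
  set γ : ℝ × E → ℝ → E := fun z s =>
    z.2 + z.1 • pathIntegral ((⟨Y, hYs.continuous⟩ : C(E, E)).comp (c z)) s with hγ
  have hγc : ∀ᶠ z in 𝓝 ((0 : ℝ), x₀), ∀ s : I, γ z s = c z s := by
    filter_upwards [hce] with z hz s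
    conv_rhs => rw [hz]
    rfl
  have hU : ∀ U ∈ 𝓝 x₀, ∀ᶠ z in 𝓝 ((0 : ℝ), x₀), ∀ s ∈ Set.Icc (0 : ℝ) 1, γ z s ∈ U := by
    intro U hU
    obtain ⟨ε, hε, hεU⟩ := Metric.mem_nhds_iff.1 hU
    have h1 := hc.continuousAt (Metric.ball_mem_nhds (c (0, x₀)) hε)
    filter_upwards [h1, hγc] with z hz hzc s hs
    apply hεU
    rw [hzc ⟨s, hs⟩, Metric.mem_ball]
    have h2 := (ContinuousMap.dist_apply_le_dist (f := c z) (g := c (0, x₀)) ⟨s, hs⟩).trans_lt hz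
    rwa [hc0] at h2
  have hone : SmoothNear (fun z => γ z 1) (0, x₀) := by
    refine SmoothNear.congr (f := fun z => ContinuousMap.evalCLM ℝ (1 : I) (c z)) ?_ ?_
    · exact SmoothNear.comp (g := ContinuousMap.evalCLM ℝ (1 : I))
        (ContinuousLinearMap.contDiff _).smoothNear hc
    · filter_upwards [hγc] with z hz
      exact hz 1
  refine ⟨γ, hone, ?_, fun z => ?_, fun x s => ?_, hU, ?_⟩
  -- By construction γ (t, x₀) 1 = x₀ + t d(t), so the difference quotient at 0 is d(t), which tends
  -- to d(0) = X x₀.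
  · set d : ℝ → E := fun t =>
      integrationCLM E ((⟨Y, hYs.continuous⟩ : C(E, E)).comp (c (t, x₀))) 1
    have hd : ContinuousAt d 0 := by
      have h1 : Continuous fun η : C(I, E) =>
          integrationCLM E ((⟨Y, hYs.continuous⟩ : C(E, E)).comp η) 1 :=
        (ContinuousMap.evalCLM ℝ (1 : I)).continuous.comp
          ((integrationCLM E).continuous.comp (ContinuousMap.continuous_postcomp _))
      exact ContinuousAt.comp (g := fun η : C(I, E) =>
          integrationCLM E ((⟨Y, hYs.continuous⟩ : C(E, E)).comp η) 1) h1.continuousAt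
        (ContinuousAt.comp (f := fun t : ℝ => (t, x₀)) (x := (0 : ℝ)) hc.continuousAt
          (by fun_prop))
    have hd0 : d 0 = X x₀ := by
      change pathIntegral ((⟨Y, hYs.continuous⟩ : C(E, E)).comp (c (0, x₀))) (1 : I) = _
      rw [hc0, ← hYX.self_of_nhds]
      simp [pathIntegral]
    rw [hasDerivAt_iff_tendsto_slope, ← hd0]
    refine (hd.tendsto.mono_left nhdsWithin_le_nhds).congr' ?_
    filter_upwards [self_mem_nhdsWithin] with t ht
    have ht' : t ≠ 0 := ht
    simp only [slope, vsub_eq_sub, hγ, sub_zero, zero_smul, add_zero, add_sub_cancel_left]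
    rw [smul_smul, inv_mul_cancel₀ ht', one_smul]
    rfl
  · simp [hγ, pathIntegral]
  · simp [hγ]
  · filter_upwards [hU _ hYX, hγc] with z hz hzc s hs
    have h1 := ((hasDerivAt_pathIntegral
      ((⟨Y, hYs.continuous⟩ : C(E, E)).comp (c z)) s).const_smul z.1).const_add z.2
    have h2 : c z (Set.projIcc 0 1 zero_le_one s) = γ z s := by
      rw [Set.projIcc_of_mem _ hs, hzc ⟨s, hs⟩]
    rw [← hz s hs, ← h2]
    exact h1

end Flow

/-! ### Extending relations by flows of related vector fields -/

section Related

variable {E E' F : Type} [NormedAddCommGroup E] [NormedSpace ℝ E] [FiniteDimensional ℝ E]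
  [NormedAddCommGroup E'] [NormedSpace ℝ E'] [FiniteDimensional ℝ E']
  [NormedAddCommGroup F] [NormedSpace ℝ F]

/-- Flows of vector fields that project to the same vector field project to the same flow. -/
theorem exists_related_flows {π : E → F} {π' : E' → F} {X : E → E} {X' : E' → E'} {G : F → F}
    {x₀ : E} {x₀' : E'} (hπ : SmoothNear π x₀) (hπ' : SmoothNear π' x₀') (h0 : π x₀ = π' x₀')
    (hX : SmoothNear X x₀) (hX' : SmoothNear X' x₀') (hG : SmoothNear G (π x₀))
    (hr : ∀ᶠ x in 𝓝 x₀, fderiv ℝ π x (X x) = G (π x))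
    (hr' : ∀ᶠ x in 𝓝 x₀', fderiv ℝ π' x (X' x) = G (π' x)) :
    ∃ (Φ : ℝ × E → E) (Φ' : ℝ × E' → E'), SmoothNear Φ (0, x₀) ∧ SmoothNear Φ' (0, x₀') ∧
      (∀ x, Φ (0, x) = x) ∧ (∀ x, Φ' (0, x) = x) ∧
      HasDerivAt (fun t => Φ (t, x₀)) (X x₀) 0 ∧ HasDerivAt (fun t => Φ' (t, x₀')) (X' x₀') 0 ∧
      ∀ᶠ y in 𝓝 ((0 : ℝ), x₀, x₀'), π y.2.1 = π' y.2.2 →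
        π (Φ (y.1, y.2.1)) = π' (Φ' (y.1, y.2.2)) := by
  obtain ⟨γ, hγ, hd, h00, h0x, hU, hode⟩ := exists_flow hX
  obtain ⟨γ', hγ', hd', h00', h0x', hU', hode'⟩ := exists_flow hX'
  refine ⟨fun z => γ z 1, fun z => γ' z 1, hγ, hγ', fun x => h0x x 1, fun x => h0x' x 1, hd, hd', ?_⟩
  obtain ⟨K, s, hs, hK⟩ := (hG.contDiffAt.of_le (by simp)).exists_lipschitzOnWith
  have hs' : s ∈ 𝓝 (π' x₀') := h0 ▸ hs
  have c1 : Filter.Tendsto (fun y : ℝ × E × E' => (y.1, y.2.1)) (𝓝 (0, x₀, x₀')) (𝓝 (0, x₀)) :=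
    Continuous.tendsto' (by fun_prop) _ _ rfl
  have c2 : Filter.Tendsto (fun y : ℝ × E × E' => (y.1, y.2.2)) (𝓝 (0, x₀, x₀')) (𝓝 (0, x₀')) :=
    Continuous.tendsto' (by fun_prop) _ _ rfl
  have e1 := hU _ (((hπ.continuousAt.eventually hs).and hr).and hπ)
  have e2 := hU' _ (((hπ'.continuousAt.eventually hs').and hr').and hπ')
  filter_upwards [c1.eventually e1, c2.eventually e2, c1.eventually hode, c2.eventually hode']
    with ⟨t, x, x'⟩ a1 a2 a3 a4 hxx'
  dsimp only at a1 a2 a3 a4 hxx' ⊢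
  have d1 : ∀ τ ∈ Set.Icc (0 : ℝ) 1,
      HasDerivAt (fun τ => π (γ (t, x) τ)) (t • G (π (γ (t, x) τ))) τ := by
    intro τ hτ
    obtain ⟨⟨-, b2⟩, b3⟩ := a1 τ hτ
    have := (b3.differentiableAt (by simp)).hasFDerivAt.comp_hasDerivAt τ (a3 τ hτ)
    rwa [map_smul, b2] at this
  have d2 : ∀ τ ∈ Set.Icc (0 : ℝ) 1,
      HasDerivAt (fun τ => π' (γ' (t, x') τ)) (t • G (π' (γ' (t, x') τ))) τ := by
    intro τ hτ
    obtain ⟨⟨-, b2⟩, b3⟩ := a2 τ hτ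
    have := (b3.differentiableAt (by simp)).hasFDerivAt.comp_hasDerivAt τ (a4 τ hτ)
    rwa [map_smul, b2] at this
  -- Both projected curves solve y' = t G(y) with the same initial value and stay in the set where
  -- `G` is Lipschitz; evaluate at time 1.
  refine ODE_solution_unique_of_mem_Icc_right (v := fun _ y => t • G y) (s := fun _ => s)
    (K := ‖t‖₊ * K) (fun τ _ => ?_) (fun τ hτ => (d1 τ hτ).continuousAt.continuousWithinAt)
    (fun τ hτ => (d1 τ ⟨hτ.1, hτ.2.le⟩).hasDerivWithinAt)
    (fun τ hτ => (a1 τ ⟨hτ.1, hτ.2.le⟩).1.1)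
    (fun τ hτ => (d2 τ hτ).continuousAt.continuousWithinAt)
    (fun τ hτ => (d2 τ ⟨hτ.1, hτ.2.le⟩).hasDerivWithinAt)
    (fun τ hτ => (a2 τ ⟨hτ.1, hτ.2.le⟩).1.1) ?_ (Set.right_mem_Icc.2 zero_le_one)
  · exact (lipschitzWith_smul t).comp_lipschitzOnWith hK
  · simpa only [h00, h00'] using hxx'

/-- `u` and `u'` are the values at `x₀` and `x₀'` of vector fields that project to the same vector
field. -/
def AreRelatedVectors (π : E → F) (π' : E' → F) (x₀ : E) (x₀' : E') (u : E) (u' : E') : Prop :=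
  ∃ (X : E → E) (X' : E' → E') (G : F → F), SmoothNear X x₀ ∧ SmoothNear X' x₀' ∧
    SmoothNear G (π x₀) ∧ (∀ᶠ x in 𝓝 x₀, fderiv ℝ π x (X x) = G (π x)) ∧
    (∀ᶠ x in 𝓝 x₀', fderiv ℝ π' x (X' x) = G (π' x)) ∧ X x₀ = u ∧ X' x₀' = u'

/-- There is a germ of a pair of smooth maps to `E` and `E'`, with equal projections to `F`, whose
differentials attain `S` and `S'`. -/
def HasRelationGerm (π : E → F) (π' : E' → F) (x₀ : E) (x₀' : E') (S : Submodule ℝ E)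
    (S' : Submodule ℝ E') : Prop :=
  ∃ (V : Type) (_ : NormedAddCommGroup V) (_ : NormedSpace ℝ V) (_ : FiniteDimensional ℝ V)
    (δ : V → E) (η : V → E') (v₀ : V), SmoothNear δ v₀ ∧ SmoothNear η v₀ ∧ δ v₀ = x₀ ∧ η v₀ = x₀' ∧
    (∀ᶠ v in 𝓝 v₀, π (δ v) = π' (η v)) ∧
    S ≤ (fderiv ℝ δ v₀ : V →ₗ[ℝ] E).range ∧ S' ≤ (fderiv ℝ η v₀ : V →ₗ[ℝ] E').range

/-- The partial derivative along `V` at time 0 is that of `δ`, since Φ is the identity at time 0;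
the partial derivative in time at `v₀` is `u`. -/
theorem sup_span_le_range_fderiv_flow {V : Type*} [NormedAddCommGroup V] [NormedSpace ℝ V]
    {Φ : ℝ × E → E} {δ : V → E} {v₀ : V} {x₀ u : E} {S : Submodule ℝ E} (hδ : SmoothNear δ v₀)
    (hx : δ v₀ = x₀) (hΦ : SmoothNear Φ (0, x₀)) (hΦ0 : ∀ x, Φ (0, x) = x)
    (hu : HasDerivAt (fun t => Φ (t, x₀)) u 0) (hS : S ≤ (fderiv ℝ δ v₀ : V →ₗ[ℝ] E).range) :
    SmoothNear (fun y : V × ℝ => Φ (y.2, δ y.1)) (v₀, 0) ∧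
      S ⊔ Submodule.span ℝ {u} ≤
        (fderiv ℝ (fun y : V × ℝ => Φ (y.2, δ y.1)) (v₀, 0) : V × ℝ →ₗ[ℝ] E).range := by
  have h1 : SmoothNear (fun y : V × ℝ => δ y.1) (v₀, 0) :=
    SmoothNear.comp (f := Prod.fst) hδ contDiff_fst.smoothNear
  have h2 : SmoothNear (fun y : V × ℝ => (y.2, δ y.1)) (v₀, 0) := contDiff_snd.smoothNear.prodMk h1
  have h3 : SmoothNear (fun y : V × ℝ => Φ (y.2, δ y.1)) (v₀, 0) :=
    SmoothNear.comp_of_eq hΦ h2 (by simp [hx])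
  refine ⟨h3, sup_le ?_ ?_⟩
  · intro a ha
    obtain ⟨b, rfl⟩ := hS ha
    refine ⟨(b, 0), ?_⟩
    have h4 := HasFDerivAt.comp v₀ h3.differentiableAt.hasFDerivAt
      (hasFDerivAt_prodMk_left (𝕜 := ℝ) v₀ (0 : ℝ))
    have h5 : (fun y : V × ℝ => Φ (y.2, δ y.1)) ∘ (fun v => (v, (0 : ℝ))) = δ := by
      funext v
      simp [hΦ0]
    rw [h5] at h4
    exact congrArg (fun L => L b) (h4.unique hδ.differentiableAt.hasFDerivAt)
  · rw [Submodule.span_singleton_le_iff_mem]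
    refine ⟨(0, 1), ?_⟩
    have h4 := HasFDerivAt.comp_hasDerivAt (0 : ℝ) h3.differentiableAt.hasFDerivAt
      ((hasDerivAt_const (0 : ℝ) v₀).prodMk (hasDerivAt_id (0 : ℝ)))
    have h5 : (fun y : V × ℝ => Φ (y.2, δ y.1)) ∘ (fun t : ℝ => (v₀, t)) =
        fun t => Φ (t, x₀) := by
      funext t
      simp [hx]
    exact (h5 ▸ h4).unique hu

/-- The flow time becomes an additional parameter: the new maps are (v, t) ↦ Φ(t, δ v) and (v, t) ↦
Φ'(t, η v). Related flows keep the two projections to `F` equal. -/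
theorem HasRelationGerm.sup_span {π : E → F} {π' : E' → F} {x₀ : E} {x₀' : E'}
    {S : Submodule ℝ E} {S' : Submodule ℝ E'} {u : E} {u' : E'} (hπ : SmoothNear π x₀)
    (hπ' : SmoothNear π' x₀') (h : HasRelationGerm π π' x₀ x₀' S S')
    (hu : AreRelatedVectors π π' x₀ x₀' u u') :
    HasRelationGerm π π' x₀ x₀' (S ⊔ Submodule.span ℝ {u}) (S' ⊔ Submodule.span ℝ {u'}) := by
  obtain ⟨V, _, _, _, δ, η, v₀, hδ, hη, hδ0, hη0, hcomm, hS, hS'⟩ := h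
  obtain ⟨X, X', G, hX, hX', hG, hr, hr', rfl, rfl⟩ := hu
  have h0 : π x₀ = π' x₀' := by
    have := hcomm.self_of_nhds
    rwa [hδ0, hη0] at this
  obtain ⟨Φ, Φ', hΦ, hΦ', hΦ0, hΦ0', hd, hd', hΦΦ'⟩ :=
    exists_related_flows hπ hπ' h0 hX hX' hG hr hr'
  obtain ⟨a1, a2⟩ := sup_span_le_range_fderiv_flow hδ hδ0 hΦ hΦ0 hd hS
  obtain ⟨b1, b2⟩ := sup_span_le_range_fderiv_flow hη hη0 hΦ' hΦ0' hd' hS'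
  refine ⟨V × ℝ, inferInstance, inferInstance, inferInstance, _, _, (v₀, 0), a1, b1, ?_, ?_, ?_,
    a2, b2⟩
  · simp [hΦ0, hδ0]
  · simp [hΦ0', hη0]
  · have c1 : Filter.Tendsto (fun y : V × ℝ => (y.2, δ y.1, η y.1)) (𝓝 (v₀, 0))
        (𝓝 (0, x₀, x₀')) := by
      rw [← hδ0, ← hη0]
      have t1 := hδ.continuousAt.tendsto.comp (continuous_fst.tendsto (v₀, (0 : ℝ)))
      have t2 := hη.continuousAt.tendsto.comp (continuous_fst.tendsto (v₀, (0 : ℝ)))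
      exact (continuous_snd.tendsto (v₀, (0 : ℝ))).prodMk_nhds (t1.prodMk_nhds t2)
    filter_upwards [c1.eventually hΦΦ', (continuous_fst.tendsto (v₀, (0 : ℝ))).eventually hcomm]
      with y hy1 hy2 using hy1 hy2

theorem HasRelationGerm.mono {π : E → F} {π' : E' → F} {x₀ : E} {x₀' : E'}
    {S T : Submodule ℝ E} {S' T' : Submodule ℝ E'} (h : HasRelationGerm π π' x₀ x₀' S S')
    (hT : T ≤ S) (hT' : T' ≤ S') : HasRelationGerm π π' x₀ x₀' T T' := by
  obtain ⟨V, i1, i2, i3, δ, η, v₀, hδ, hη, hδ0, hη0, hcomm, hS, hS'⟩ := h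
  exact ⟨V, i1, i2, i3, δ, η, v₀, hδ, hη, hδ0, hη0, hcomm, hT.trans hS, hT'.trans hS'⟩

/-- If the differentials together with the related vectors span, then the relation extends to one
by submersions. -/
theorem HasRelationGerm.extend {π : E → F} {π' : E' → F} {x₀ : E} {x₀' : E'}
    {S : Submodule ℝ E} {S' : Submodule ℝ E'} (hπ : SmoothNear π x₀) (hπ' : SmoothNear π' x₀')
    (h : HasRelationGerm π π' x₀ x₀' S S')
    (hs : S ⊔ Submodule.span ℝ {u | ∃ u', AreRelatedVectors π π' x₀ x₀' u u'} = ⊤)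
    (hs' : S' ⊔ Submodule.span ℝ {u' | ∃ u, AreRelatedVectors π π' x₀ x₀' u u'} = ⊤) :
    HasRelationGerm π π' x₀ x₀' ⊤ ⊤ := by
  -- A maximal attained subspace of `E` absorbs every related vector, so it is everything. The
  -- second maximization does the same in `E'` while keeping `⊤` on the first side.
  obtain ⟨T, ⟨T', hST, hST', hT⟩, hmax⟩ := WellFounded.has_min (wellFounded_gt (α := Submodule ℝ E))
    {T | ∃ T', S ≤ T ∧ S' ≤ T' ∧ HasRelationGerm π π' x₀ x₀' T T'} ⟨S, S', le_rfl, le_rfl, h⟩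
  have hT1 : T = ⊤ := by
    rw [eq_top_iff, ← hs]
    refine sup_le hST (Submodule.span_le.2 ?_)
    rintro u ⟨u', hu⟩
    have h1 := hmax _ ⟨_, hST.trans le_sup_left, hST'.trans le_sup_left, hT.sup_span hπ hπ' hu⟩
    have h2 : T = T ⊔ Submodule.span ℝ {u} := eq_of_le_of_not_lt le_sup_left h1
    rw [h2]
    exact (le_sup_right : Submodule.span ℝ {u} ≤ _) (Submodule.mem_span_singleton_self u)
  subst hT1
  obtain ⟨U, ⟨hSU, hU⟩, hmax'⟩ := WellFounded.has_min (wellFounded_gt (α := Submodule ℝ E'))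
    {T' | S' ≤ T' ∧ HasRelationGerm π π' x₀ x₀' ⊤ T'} ⟨T', hST', hT⟩
  have hU1 : U = ⊤ := by
    rw [eq_top_iff, ← hs']
    refine sup_le hSU (Submodule.span_le.2 ?_)
    rintro u' ⟨u, hu⟩
    have h1 := hmax' _ ⟨hSU.trans le_sup_left, (hU.sup_span hπ hπ' hu).mono le_sup_left le_rfl⟩
    have h2 : U = U ⊔ Submodule.span ℝ {u'} := eq_of_le_of_not_lt le_sup_left h1
    rw [h2]
    exact (le_sup_right : Submodule.span ℝ {u'} ≤ _) (Submodule.mem_span_singleton_self u')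
  exact hU1 ▸ hU

end Related

/-! ### Charts, vector fields and maps in charts -/

namespace SmoothMfd

variable {X Y Z : SmoothMfd.{u}} {G H : Type*} [NormedAddCommGroup G] [NormedSpace ℝ G]
  [NormedAddCommGroup H] [NormedSpace ℝ H]

/-- The Euclidean space on which `X` is modelled near `x₀`. -/
abbrev Model (x₀ : X.Pt) : Type := EuclideanSpace ℝ (Fin x₀.1)

/-- The preferred chart at `x₀`, extended by junk values. -/
def toModel (x₀ x : X.Pt) : Model x₀ :=
  if h : x.1 = x₀.1 then chartAt (EuclideanSpace ℝ (Fin x₀.1)) x₀.2 (h ▸ x.2) else 0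

/-- The inverse of the preferred chart at `x₀`. -/
def ofModel (x₀ : X.Pt) (e : Model x₀) : X.Pt :=
  ⟨x₀.1, (chartAt (EuclideanSpace ℝ (Fin x₀.1)) x₀.2).symm e⟩

/-- The domain of the preferred chart at `x₀`. -/
def chartDom (x₀ : X.Pt) : Opens X.Pt :=
  ⟨Sigma.mk x₀.1 '' (chartAt (EuclideanSpace ℝ (Fin x₀.1)) x₀.2).source,
    isOpenMap_sigmaMk _ (chartAt (EuclideanSpace ℝ (Fin x₀.1)) x₀.2).open_source⟩

/-- Smoothness of a vector-valued function at a point. -/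
def SmoothFunAt (f : X.Pt → G) (x : X.Pt) : Prop :=
  ContMDiffAt (𝓡 x.1) 𝓘(ℝ, G) ∞ (fun z : X.piece x.1 => f ⟨x.1, z⟩) x.2

/-- The differential of a vector-valued function. -/
def dFun (f : X.Pt → G) (x : X.Pt) : X.T x →L[ℝ] G :=
  mfderiv (𝓡 x.1) 𝓘(ℝ, G) (fun z : X.piece x.1 => f ⟨x.1, z⟩) x.2

/-- Smoothness of a vector field at a point. -/
def SmoothVFAt (V : X.VField) (x : X.Pt) : Prop :=
  ContMDiffAt (𝓡 x.1) (𝓡 x.1).tangent ∞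
    (fun y : X.piece x.1 => (⟨y, V ⟨x.1, y⟩⟩ : TangentBundle (𝓡 x.1) (X.piece x.1))) x.2

theorem mem_chartDom_self (x : X.Pt) : x ∈ chartDom x := ⟨x.2, mem_chart_source _ _, rfl⟩

@[simp]
theorem toModel_mk (x₀ : X.Pt) (y : X.piece x₀.1) :
    toModel x₀ ⟨x₀.1, y⟩ = chartAt (EuclideanSpace ℝ (Fin x₀.1)) x₀.2 y := dif_pos rfl

theorem isOpen_preimage_mk (U : Opens X.Pt) (n : ℕ) : IsOpen {y | (⟨n, y⟩ : X.Pt) ∈ U} :=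
  U.isOpen.preimage continuous_sigmaMk

theorem eventually_mk {P : X.Pt → Prop} {x : X.Pt} :
    (∀ᶠ y in 𝓝 x, P y) ↔ ∀ᶠ z in 𝓝 x.2, P ⟨x.1, z⟩ := by
  rw [Sigma.nhds_eq, Filter.eventually_map]

theorem ofModel_toModel {x₀ x : X.Pt} (hx : x ∈ chartDom x₀) : ofModel x₀ (toModel x₀ x) = x := by
  obtain ⟨y, hy, rfl⟩ := hx
  rw [toModel_mk, ofModel, OpenPartialHomeomorph.left_inv _ hy]

theorem toModel_mem_target {x₀ x : X.Pt} (hx : x ∈ chartDom x₀) :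
    toModel x₀ x ∈ (chartAt (EuclideanSpace ℝ (Fin x₀.1)) x₀.2).target := by
  obtain ⟨y, hy, rfl⟩ := hx
  rw [toModel_mk]
  exact OpenPartialHomeomorph.map_source _ hy

theorem toModel_ofModel {x₀ : X.Pt} {e : Model x₀}
    (he : e ∈ (chartAt (EuclideanSpace ℝ (Fin x₀.1)) x₀.2).target) :
    toModel x₀ (ofModel x₀ e) = e := by
  rw [ofModel, toModel_mk, OpenPartialHomeomorph.right_inv _ he]

theorem ofModel_mem_chartDom {x₀ : X.Pt} {e : Model x₀}
    (he : e ∈ (chartAt (EuclideanSpace ℝ (Fin x₀.1)) x₀.2).target) : ofModel x₀ e ∈ chartDom x₀ :=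
  ⟨_, OpenPartialHomeomorph.map_target _ he, rfl⟩

theorem eventually_mem_chartDom {x₀ x : X.Pt} (hx : x ∈ chartDom x₀) :
    ∀ᶠ y in 𝓝 x, y ∈ chartDom x₀ := (chartDom x₀).isOpen.mem_nhds hx

theorem eventually_mem_target {x₀ x : X.Pt} (hx : x ∈ chartDom x₀) :
    ∀ᶠ e in 𝓝 (toModel x₀ x), e ∈ (chartAt (EuclideanSpace ℝ (Fin x₀.1)) x₀.2).target :=
  (OpenPartialHomeomorph.open_target _).mem_nhds (toModel_mem_target hx)

theorem tendsto_toModel {x₀ x : X.Pt} (hx : x ∈ chartDom x₀) :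
    Filter.Tendsto (toModel x₀) (𝓝 x) (𝓝 (toModel x₀ x)) := by
  obtain ⟨y, hy, rfl⟩ := hx
  rw [Sigma.nhds_mk, Filter.tendsto_map'_iff, toModel_mk]
  refine ((chartAt (EuclideanSpace ℝ (Fin x₀.1)) x₀.2).continuousAt hy).tendsto.congr fun z => ?_
  simp

theorem tendsto_ofModel {x₀ x : X.Pt} (hx : x ∈ chartDom x₀) :
    Filter.Tendsto (ofModel x₀) (𝓝 (toModel x₀ x)) (𝓝 x) := by
  have h1 := ((chartAt (EuclideanSpace ℝ (Fin x₀.1)) x₀.2).continuousAt_symm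
    (toModel_mem_target hx)).tendsto
  have h2 := (continuous_sigmaMk (σ := X.piece) (i := x₀.1)).continuousAt.tendsto.comp h1
  change Filter.Tendsto (ofModel x₀) _ (𝓝 (ofModel x₀ (toModel x₀ x))) at h2
  rwa [ofModel_toModel hx] at h2

theorem smoothFunAt_toModel {x₀ x : X.Pt} (hx : x ∈ chartDom x₀) : SmoothFunAt (toModel x₀) x := by
  obtain ⟨y, hy, rfl⟩ := hx
  simp only [SmoothFunAt, toModel_mk]
  exact (contMDiffOn_chart y hy).contMDiffAt
    ((chartAt (EuclideanSpace ℝ (Fin x₀.1)) x₀.2).open_source.mem_nhds hy)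

theorem dFun_toModel_mk (x₀ : X.Pt) (y : X.piece x₀.1) : dFun (toModel x₀) ⟨x₀.1, y⟩ =
    mfderiv (𝓡 x₀.1) (𝓡 x₀.1) (chartAt (EuclideanSpace ℝ (Fin x₀.1)) x₀.2) y := by
  have h : (fun z : X.piece x₀.1 => toModel x₀ ⟨x₀.1, z⟩) =
    chartAt (EuclideanSpace ℝ (Fin x₀.1)) x₀.2 := funext (toModel_mk x₀)
  change mfderiv (𝓡 x₀.1) (𝓡 x₀.1) (fun z : X.piece x₀.1 => toModel x₀ ⟨x₀.1, z⟩) y = _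
  rw [h]

theorem dFun_toModel_bijective {x₀ x : X.Pt} (hx : x ∈ chartDom x₀) :
    Function.Bijective (dFun (toModel x₀) x) := by
  obtain ⟨y, hy, rfl⟩ := hx
  rw [dFun_toModel_mk]
  exact (mdifferentiable_chart (I := 𝓡 x₀.1) x₀.2).mfderiv_bijective hy

theorem SmoothFunAt.mdifferentiableAt {f : X.Pt → G} {x : X.Pt} (hf : SmoothFunAt f x) :
    MDifferentiableAt (𝓡 x.1) 𝓘(ℝ, G) (fun z : X.piece x.1 => f ⟨x.1, z⟩) x.2 :=
  ContMDiffAt.mdifferentiableAt hf (by simp)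

theorem SmoothFunAt.continuousAt {f : X.Pt → G} {x : X.Pt} (hf : SmoothFunAt f x) :
    ContinuousAt f x := by
  have h : ContinuousAt (fun z : X.piece x.1 => f ⟨x.1, z⟩) x.2 := ContMDiffAt.continuousAt hf
  rwa [ContinuousAt, Sigma.nhds_eq, Filter.tendsto_map'_iff]

theorem SmoothFunAt.congr {f f' : X.Pt → G} {x : X.Pt} (hf : SmoothFunAt f x)
    (h : ∀ᶠ y in 𝓝 x, f' y = f y) : SmoothFunAt f' x :=
  ContMDiffAt.congr_of_eventuallyEq hf (eventually_mk.1 h)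

theorem dFun_congr {f f' : X.Pt → G} {x : X.Pt} (h : ∀ᶠ y in 𝓝 x, f' y = f y) :
    dFun f' x = dFun f x :=
  Filter.EventuallyEq.mfderiv_eq (eventually_mk.1 h)

theorem SmoothFunAt.comp_contDiffAt {f : X.Pt → G} {φ : G → H} {x : X.Pt}
    (hφ : ContDiffAt ℝ ∞ φ (f x)) (hf : SmoothFunAt f x) : SmoothFunAt (fun y => φ (f y)) x :=
  ContMDiffAt.comp x.2 (g := φ) (f := fun z : X.piece x.1 => f ⟨x.1, z⟩) hφ.contMDiffAt hf

theorem dFun_comp_contDiffAt {f : X.Pt → G} {φ : G → H} {x : X.Pt}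
    (hφ : DifferentiableAt ℝ φ (f x)) (hf : SmoothFunAt f x) (v : X.T x) :
    dFun (fun y => φ (f y)) x v = fderiv ℝ φ (f x) (dFun f x v) := by
  have h := mfderiv_comp x.2 (g := φ) (f := fun z : X.piece x.1 => f ⟨x.1, z⟩)
    hφ.mdifferentiableAt hf.mdifferentiableAt
  have h2 := congrArg (fun L => L v) h
  rw [mfderiv_eq_fderiv] at h2
  exact h2

theorem smoothFunAt_iff {f : X.Pt → G} {x₀ x : X.Pt} (hx : x ∈ chartDom x₀) :
    SmoothFunAt f x ↔ ContDiffAt ℝ ∞ (fun e => f (ofModel x₀ e)) (toModel x₀ x) := by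
  constructor
  · intro hf
    have ht := toModel_mem_target hx
    obtain ⟨y, hy, rfl⟩ := hx
    rw [← contMDiffAt_iff_contDiffAt]
    rw [toModel_mk] at ht ⊢
    have h1 : ContMDiffAt (𝓡 x₀.1) (𝓡 x₀.1) ∞ (chartAt (EuclideanSpace ℝ (Fin x₀.1)) x₀.2).symm
        (chartAt (EuclideanSpace ℝ (Fin x₀.1)) x₀.2 y) :=
      (contMDiffOn_chart_symm _ ht).contMDiffAt ((OpenPartialHomeomorph.open_target _).mem_nhds ht)
    have h2 : ContMDiffAt (𝓡 x₀.1) 𝓘(ℝ, G) ∞ (fun z : X.piece x₀.1 => f ⟨x₀.1, z⟩)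
        ((chartAt (EuclideanSpace ℝ (Fin x₀.1)) x₀.2).symm
          (chartAt (EuclideanSpace ℝ (Fin x₀.1)) x₀.2 y)) := by
      rw [OpenPartialHomeomorph.left_inv _ hy]
      exact hf
    exact h2.comp _ h1
  · intro hf
    refine SmoothFunAt.congr (f := fun y => f (ofModel x₀ (toModel x₀ y)))
      (SmoothFunAt.comp_contDiffAt (f := toModel x₀) (φ := fun e => f (ofModel x₀ e)) hf
        (smoothFunAt_toModel hx)) ?_
    filter_upwards [eventually_mem_chartDom hx] with y hy
    rw [ofModel_toModel hy]

theorem dFun_apply_eq {f : X.Pt → G} {x₀ x : X.Pt} (hx : x ∈ chartDom x₀) (hf : SmoothFunAt f x)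
    (v : X.T x) : dFun f x v =
      fderiv ℝ (fun e => f (ofModel x₀ e)) (toModel x₀ x) (dFun (toModel x₀) x v) := by
  have h : DifferentiableAt ℝ (fun e => f (ofModel x₀ e)) (toModel x₀ x) :=
    ((smoothFunAt_iff (f := f) hx).1 hf).differentiableAt (by simp)
  rw [← dFun_comp_contDiffAt (f := toModel x₀) h (smoothFunAt_toModel hx)]
  refine DFunLike.congr_fun (dFun_congr ?_) v
  filter_upwards [eventually_mem_chartDom hx] with y hy
  rw [ofModel_toModel hy]

theorem smoothFunOn_iff {f : X.Pt → ℝ} {U : Opens X.Pt} :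
    SmoothFunOn f U ↔ ∀ x ∈ U, SmoothFunAt f x := by
  constructor
  · rintro h ⟨n, y⟩ hx
    exact (h n y hx).contMDiffAt ((isOpen_preimage_mk U n).mem_nhds hx)
  · intro h n y hy
    exact ContMDiffAt.contMDiffWithinAt (h ⟨n, y⟩ hy)

theorem smoothVFOn_iff {V : X.VField} {U : Opens X.Pt} :
    SmoothVFOn V U ↔ ∀ x ∈ U, SmoothVFAt V x := by
  constructor
  · rintro h ⟨n, y⟩ hx
    exact (h n y hx).contMDiffAt ((isOpen_preimage_mk U n).mem_nhds hx)
  · intro h n y hy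
    exact ContMDiffAt.contMDiffWithinAt (h ⟨n, y⟩ hy)

/-- The trivialization of the tangent bundle over a chart domain is the differential of the chart.
This turns smoothness of sections into smoothness of functions with values in a fixed vector space.
-/
theorem smoothVFAt_iff {V : X.VField} {x₀ x : X.Pt} (hx : x ∈ chartDom x₀) :
    SmoothVFAt V x ↔ SmoothFunAt (fun y => dFun (toModel x₀) y (V y)) x := by
  obtain ⟨y, hy, rfl⟩ := hx
  set e := trivializationAt (EuclideanSpace ℝ (Fin x₀.1))
    (TangentSpace (𝓡 x₀.1) : X.piece x₀.1 → Type) x₀.2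
  have hb : y ∈ e.baseSet := hy
  have h1 := e.contMDiffAt_section_iff (IB := 𝓡 x₀.1) (n := ∞)
    (E := (TangentSpace (𝓡 x₀.1) : X.piece x₀.1 → Type)) (s := fun z => V ⟨x₀.1, z⟩) hb
  refine h1.trans (Filter.EventuallyEq.contMDiffAt_iff ?_)
  filter_upwards [(chartAt (EuclideanSpace ℝ (Fin x₀.1)) x₀.2).open_source.mem_nhds hy] with z hz
  have hbz : z ∈ e.baseSet := hz
  have h2 := TangentBundle.continuousLinearMapAt_trivializationAt (I := 𝓡 x₀.1) (x₀ := x₀.2) hz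
  have h3 := congrArg (fun L => L (V ⟨x₀.1, z⟩)) h2
  have h4 : e.continuousLinearMapAt ℝ z (V ⟨x₀.1, z⟩) = (e ⟨z, V ⟨x₀.1, z⟩⟩).2 :=
    congrFun (e.coe_linearMapAt_of_mem (R := ℝ) hbz) (V ⟨x₀.1, z⟩)
  change _ = dFun (toModel x₀) ⟨x₀.1, z⟩ (V ⟨x₀.1, z⟩)
  rw [dFun_toModel_mk, ← h4]
  exact h3

/-- The vector field given in the preferred chart at `x₀` by the map `v`. -/
def vfOfModel (x₀ : X.Pt) (v : Model x₀ → Model x₀) : X.VField := fun x =>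
  Function.invFun (dFun (toModel x₀) x) (v (toModel x₀ x))

theorem dFun_vfOfModel {x₀ x : X.Pt} (hx : x ∈ chartDom x₀) (v : Model x₀ → Model x₀) :
    dFun (toModel x₀) x (vfOfModel x₀ v x) = v (toModel x₀ x) :=
  Function.rightInverse_invFun (dFun_toModel_bijective hx).2 _

theorem smoothVFAt_vfOfModel {x₀ x : X.Pt} (hx : x ∈ chartDom x₀) {v : Model x₀ → Model x₀}
    (hv : ContDiffAt ℝ ∞ v (toModel x₀ x)) : SmoothVFAt (vfOfModel x₀ v) x := by
  rw [smoothVFAt_iff hx]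
  refine SmoothFunAt.congr (SmoothFunAt.comp_contDiffAt hv (smoothFunAt_toModel hx)) ?_
  filter_upwards [eventually_mem_chartDom hx] with y hy
  exact dFun_vfOfModel hy v

/-- A vector field in the preferred chart at `x₀`. -/
def vfToModel (x₀ : X.Pt) (V : X.VField) : Model x₀ → Model x₀ := fun e =>
  dFun (toModel x₀) (ofModel x₀ e) (V (ofModel x₀ e))

theorem vfToModel_toModel {x₀ x : X.Pt} (hx : x ∈ chartDom x₀) (V : X.VField) :
    vfToModel x₀ V (toModel x₀ x) = dFun (toModel x₀) x (V x) := by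
  rw [vfToModel, ofModel_toModel hx]

theorem contDiffAt_vfToModel {x₀ x : X.Pt} (hx : x ∈ chartDom x₀) {V : X.VField}
    (hV : SmoothVFAt V x) : ContDiffAt ℝ ∞ (vfToModel x₀ V) (toModel x₀ x) :=
  (smoothFunAt_iff hx).1 ((smoothVFAt_iff hx).1 hV)

/-! Maps between manifolds -/

/-- Pieces are open, so by continuity `f` stays near `x` in the piece of `f x` and the default
branch of `rep` does not occur. -/
theorem eventually_mk_rep {f : X.Pt → Y.Pt} {x : X.Pt} (hf : ContinuousAt f x) :
    ∀ᶠ z in 𝓝 x.2, (⟨(f x).1, rep f x z⟩ : Y.Pt) = f ⟨x.1, z⟩ := by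
  have h1 : ∀ᶠ y in 𝓝 (f x), y.1 = (f x).1 := by
    rw [eventually_mk]
    exact Filter.Eventually.of_forall fun _ => rfl
  filter_upwards [eventually_mk.1 (hf.eventually h1)] with z hz
  rw [rep, dif_pos hz]
  generalize f ⟨x.1, z⟩ = a at hz
  obtain ⟨n, a⟩ := a
  generalize f x = b at hz
  obtain ⟨m, b⟩ := b
  dsimp only at hz
  subst hz
  rfl

theorem rep_self (f : X.Pt → Y.Pt) (x : X.Pt) : rep f x x.2 = (f x).2 := by
  rw [rep, dif_pos rfl]

theorem SmoothMapAt.mdifferentiableAt {f : X.Pt → Y.Pt} {x : X.Pt} (hf : SmoothMapAt f x) :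
    MDifferentiableAt (𝓡 x.1) (𝓡 (f x).1) (rep f x) x.2 :=
  hf.2.mdifferentiableAt (by simp)

theorem SmoothFunAt.comp {f : X.Pt → Y.Pt} {g : Y.Pt → G} {x : X.Pt} (hg : SmoothFunAt g (f x))
    (hf : SmoothMapAt f x) : SmoothFunAt (fun y => g (f y)) x := by
  have hg' : ContMDiffAt (𝓡 (f x).1) 𝓘(ℝ, G) ∞ (fun z : Y.piece (f x).1 => g ⟨(f x).1, z⟩)
      (rep f x x.2) := by rw [rep_self]; exact hg
  refine ContMDiffAt.congr_of_eventuallyEq (hg'.comp x.2 hf.2) ?_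
  filter_upwards [eventually_mk_rep hf.1] with z hz
  simp only [Function.comp_apply, hz]

theorem dFun_comp {f : X.Pt → Y.Pt} {g : Y.Pt → G} {x : X.Pt} (hg : SmoothFunAt g (f x))
    (hf : SmoothMapAt f x) (v : X.T x) :
    dFun (fun y => g (f y)) x v = dFun g (f x) (D f x v) := by
  have hg' : MDifferentiableAt (𝓡 (f x).1) 𝓘(ℝ, G) (fun z : Y.piece (f x).1 => g ⟨(f x).1, z⟩)
      (rep f x x.2) := by rw [rep_self]; exact hg.mdifferentiableAt
  have h1 := mfderiv_comp x.2 hg' hf.mdifferentiableAt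
  have h2 : dFun (fun y => g (f y)) x = mfderiv (𝓡 x.1) 𝓘(ℝ, G)
      ((fun z : Y.piece (f x).1 => g ⟨(f x).1, z⟩) ∘ rep f x) x.2 := by
    refine Filter.EventuallyEq.mfderiv_eq ?_
    filter_upwards [eventually_mk_rep hf.1] with z hz
    simp only [Function.comp_apply, hz]
  rw [h2, h1, rep_self]
  rfl

/-- Reduces maps between pieces of varying dimension to continuity and a vector-valued function, for
which no transport between pieces is needed. -/
theorem smoothMapAt_iff {f : X.Pt → Y.Pt} {x : X.Pt} :
    SmoothMapAt f x ↔ ContinuousAt f x ∧ SmoothFunAt (fun y => toModel (f x) (f y)) x := by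
  constructor
  · intro h
    exact ⟨h.1, SmoothFunAt.comp (smoothFunAt_toModel (mem_chartDom_self _)) h⟩
  · rintro ⟨hc, hs⟩
    refine ⟨hc, ?_⟩
    have ht : toModel (f x) (f x) ∈ (chartAt (EuclideanSpace ℝ (Fin (f x).1)) (f x).2).target :=
      toModel_mem_target (mem_chartDom_self _)
    have h1 : ContMDiffAt (𝓡 (f x).1) (𝓡 (f x).1) ∞
        (chartAt (EuclideanSpace ℝ (Fin (f x).1)) (f x).2).symm (toModel (f x) (f x)) :=
      (contMDiffOn_chart_symm _ ht).contMDiffAt ((OpenPartialHomeomorph.open_target _).mem_nhds ht)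
    refine ContMDiffAt.congr_of_eventuallyEq (h1.comp x.2 hs) ?_
    filter_upwards [eventually_mk_rep hc,
      eventually_mk.1 (hc.eventually (eventually_mem_chartDom (mem_chartDom_self (f x))))] with z hz hz'
    rw [← hz] at hz'
    obtain ⟨a, ha, ha'⟩ := hz'
    obtain rfl : a = rep f x z := by simpa using ha'
    simp only [Function.comp_apply, ← hz, toModel_mk]
    rw [OpenPartialHomeomorph.left_inv _ ha]

theorem SmoothMapAt.comp {f : X.Pt → Y.Pt} {g : Y.Pt → Z.Pt} {x : X.Pt} (hg : SmoothMapAt g (f x))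
    (hf : SmoothMapAt f x) : SmoothMapAt (g ∘ f) x :=
  smoothMapAt_iff.2 ⟨hg.1.comp hf.1, SmoothFunAt.comp (g := fun y => toModel (g (f x)) (g y))
    (smoothMapAt_iff.1 hg).2 hf⟩

/-- Tangent vectors are determined by their coordinates. -/
theorem dFun_toModel_injective {x₀ x : X.Pt} (hx : x ∈ chartDom x₀) {v v' : X.T x}
    (h : dFun (toModel x₀) x v = dFun (toModel x₀) x v') : v = v' :=
  (dFun_toModel_bijective hx).1 h

/-- `rep (g ∘ f)` is not literally a composite of representatives, so the chain rule is checked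
after applying the chart at `g (f x)`, where both sides are differentials of one vector-valued
function. -/
theorem D_comp {f : X.Pt → Y.Pt} {g : Y.Pt → Z.Pt} {x : X.Pt} (hg : SmoothMapAt g (f x))
    (hf : SmoothMapAt f x) (v : X.T x) : D (g ∘ f) x v = D g (f x) (D f x v) := by
  refine dFun_toModel_injective (x₀ := g (f x)) (mem_chartDom_self _) ?_
  have hm := smoothFunAt_toModel (mem_chartDom_self (g (f x)))
  have h1 := dFun_comp (f := g ∘ f) (g := toModel (g (f x))) hm (hg.comp hf) v
  have h2 := dFun_comp (g := toModel (g (f x))) hm hg (D f x v)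
  have h3 := dFun_comp (g := fun y => toModel (g (f x)) (g y)) (hm.comp hg) hf v
  exact h1.symm.trans (h3.trans h2)

/-- A map in the preferred charts at `x₀` and `y₀`. -/
def mapToModel (x₀ : X.Pt) (y₀ : Y.Pt) (f : X.Pt → Y.Pt) : Model x₀ → Model y₀ := fun e =>
  toModel y₀ (f (ofModel x₀ e))

theorem contDiffAt_mapToModel {f : X.Pt → Y.Pt} {x₀ x : X.Pt} {y₀ : Y.Pt} (hx : x ∈ chartDom x₀)
    (hy : f x ∈ chartDom y₀) (hf : SmoothMapAt f x) :
    ContDiffAt ℝ ∞ (mapToModel x₀ y₀ f) (toModel x₀ x) :=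
  (smoothFunAt_iff hx).1 (SmoothFunAt.comp (smoothFunAt_toModel hy) hf)

theorem mapToModel_toModel {f : X.Pt → Y.Pt} {x₀ x : X.Pt} {y₀ : Y.Pt} (hx : x ∈ chartDom x₀) :
    mapToModel x₀ y₀ f (toModel x₀ x) = toModel y₀ (f x) := by
  rw [mapToModel, ofModel_toModel hx]

theorem fderiv_mapToModel {f : X.Pt → Y.Pt} {x₀ x : X.Pt} {y₀ : Y.Pt} (hx : x ∈ chartDom x₀)
    (hy : f x ∈ chartDom y₀) (hf : SmoothMapAt f x) (v : X.T x) :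
    fderiv ℝ (mapToModel x₀ y₀ f) (toModel x₀ x) (dFun (toModel x₀) x v) =
      dFun (toModel y₀) (f x) (D f x v) := by
  rw [← dFun_comp (smoothFunAt_toModel hy) hf]
  exact (dFun_apply_eq hx (SmoothFunAt.comp (smoothFunAt_toModel hy) hf) v).symm

theorem smoothNear_mapToModel {f : X.Pt → Y.Pt} {x₀ : X.Pt} {y₀ : Y.Pt}
    (hy : f x₀ ∈ chartDom y₀) (hf : ∀ᶠ x in 𝓝 x₀, SmoothMapAt f x) :
    SmoothNear (mapToModel x₀ y₀ f) (toModel x₀ x₀) := by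
  have h1 := hf.self_of_nhds.1.eventually (eventually_mem_chartDom hy)
  have h0 := mem_chartDom_self x₀
  filter_upwards [(tendsto_ofModel h0).eventually ((hf.and h1).and (eventually_mem_chartDom h0)),
    eventually_mem_target h0] with e ⟨⟨h2, h3⟩, h4⟩ h5
  have := contDiffAt_mapToModel h4 h3 h2
  rwa [toModel_ofModel h5] at this

/-- A map that is smooth in charts is smooth. -/
theorem eventually_smoothMapAt_ofModel {x₀ : X.Pt} {y₀ : Y.Pt} {h : Model x₀ → Model y₀}
    (hs : SmoothNear h (toModel x₀ x₀)) (h0 : h (toModel x₀ x₀) = toModel y₀ y₀) :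
    ∀ᶠ x in 𝓝 x₀, SmoothMapAt (fun x => ofModel y₀ (h (toModel x₀ x))) x := by
  have hd := mem_chartDom_self x₀
  have h1 : ∀ᶠ e in 𝓝 (toModel x₀ x₀),
      h e ∈ (chartAt (EuclideanSpace ℝ (Fin y₀.1)) y₀.2).target := by
    refine hs.continuousAt.eventually ?_
    rw [h0]
    exact eventually_mem_target (mem_chartDom_self y₀)
  filter_upwards [(tendsto_toModel hd).eventually (hs.and h1.eventually_nhds),
    eventually_mem_chartDom hd] with x ⟨h2, h3⟩ h4
  have h5 : ofModel y₀ (h (toModel x₀ x)) ∈ chartDom y₀ := ofModel_mem_chartDom h3.self_of_nhds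
  have h6 : SmoothFunAt (fun x => h (toModel x₀ x)) x :=
    SmoothFunAt.comp_contDiffAt h2 (smoothFunAt_toModel h4)
  rw [smoothMapAt_iff]
  constructor
  · have h7 := tendsto_ofModel h5
    rw [toModel_ofModel h3.self_of_nhds] at h7
    exact Filter.Tendsto.comp (g := ofModel y₀) h7 h6.continuousAt
  · have h8 : SmoothFunAt (toModel (ofModel y₀ (h (toModel x₀ x))))
      (ofModel y₀ (h (toModel x₀ x))) := smoothFunAt_toModel (mem_chartDom_self _)
    have h9 := (smoothFunAt_iff h5).1 h8
    rw [toModel_ofModel h3.self_of_nhds] at h9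
    exact SmoothFunAt.comp_contDiffAt (φ := fun e => toModel (ofModel y₀ (h (toModel x₀ x)))
      (ofModel y₀ e)) h9 h6

end SmoothMfd

open SmoothMfd

/-! ### Sections of foliations and of their pullbacks -/

namespace SmoothMfd

variable {X Y Z : SmoothMfd.{u}} {G : Type*} [NormedAddCommGroup G] [NormedSpace ℝ G]

theorem exists_opens_of_eventually {P : X.Pt → Prop} {x : X.Pt} (h : ∀ᶠ y in 𝓝 x, P y) :
    ∃ U : Opens X.Pt, x ∈ U ∧ ∀ y ∈ U, P y := by
  obtain ⟨s, hs, ho, hx⟩ := eventually_nhds_iff.1 h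
  exact ⟨⟨s, ho⟩, hx, hs⟩

theorem Opens.eventually_mem {U : Opens X.Pt} {x : X.Pt} (hx : x ∈ U) : ∀ᶠ y in 𝓝 x, y ∈ U :=
  U.isOpen.mem_nhds hx

theorem smoothFunAt_const (c : G) (x : X.Pt) : SmoothFunAt (fun _ : X.Pt => c) x :=
  contMDiffAt_const

theorem SmoothFunAt.add {f g : X.Pt → G} {x : X.Pt} (hf : SmoothFunAt f x) (hg : SmoothFunAt g x) :
    SmoothFunAt (fun y => f y + g y) x :=
  ContMDiffAt.add hf hg

theorem SmoothFunAt.mul {f g : X.Pt → ℝ} {x : X.Pt} (hf : SmoothFunAt f x)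
    (hg : SmoothFunAt g x) : SmoothFunAt (fun y => f y * g y) x :=
  ContMDiffAt.smul hf hg

theorem SmoothFunAt.smul {f : X.Pt → ℝ} {g : X.Pt → G} {x : X.Pt} (hf : SmoothFunAt f x)
    (hg : SmoothFunAt g x) : SmoothFunAt (fun y => f y • g y) x :=
  ContMDiffAt.smul hf hg

theorem smoothVFAt_zero (x : X.Pt) : SmoothVFAt (fun y => (0 : X.T y)) x := by
  rw [smoothVFAt_iff (mem_chartDom_self x)]
  simpa using smoothFunAt_const (0 : Model x) x

theorem SmoothVFAt.add {V V' : X.VField} {x : X.Pt} (hV : SmoothVFAt V x) (hV' : SmoothVFAt V' x) :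
    SmoothVFAt (fun y => V y + V' y) x := by
  rw [smoothVFAt_iff (mem_chartDom_self x)] at *
  simpa using hV.add hV'

theorem SmoothVFAt.smul {f : X.Pt → ℝ} {V : X.VField} {x : X.Pt} (hf : SmoothFunAt f x)
    (hV : SmoothVFAt V x) : SmoothVFAt (fun y => f y • V y) x := by
  rw [smoothVFAt_iff (mem_chartDom_self x)] at *
  simpa using hf.smul hV

theorem SmoothVFAt.sum {ι : Type*} {s : Finset ι} {V : ι → X.VField} {x : X.Pt}
    (hV : ∀ i ∈ s, SmoothVFAt (V i) x) : SmoothVFAt (fun y => ∑ i ∈ s, V i y) x := by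
  classical
  induction s using Finset.induction_on with
  | empty => simpa using smoothVFAt_zero x
  | insert a s ha ih =>
    simp only [Finset.sum_insert ha]
    exact (hV a (Finset.mem_insert_self _ _)).add
      (ih fun i hi => hV i (Finset.mem_insert_of_mem hi))

/-- The derivative of a smooth function along a smooth vector field is smooth. -/
theorem SmoothFunAt.dFun_apply {g : X.Pt → G} {V : X.VField} {x : X.Pt}
    (hg : ∀ᶠ y in 𝓝 x, SmoothFunAt g y) (hV : SmoothVFAt V x) :
    SmoothFunAt (fun y => dFun g y (V y)) x := by
  have hx := mem_chartDom_self x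
  rw [smoothVFAt_iff hx] at hV
  have h1 : ContDiffAt ℝ ∞ (fun e => g (ofModel x e)) (toModel x x) :=
    (smoothFunAt_iff hx).1 hg.self_of_nhds
  have h2 : ContDiffAt ℝ ∞ (fun e => fderiv ℝ (fun e => g (ofModel x e)) e) (toModel x x) :=
    h1.fderiv_right (by simp)
  have h3 : SmoothFunAt (fun y => fderiv ℝ (fun e => g (ofModel x e)) (toModel x y)) x :=
    SmoothFunAt.comp_contDiffAt (f := toModel x) h2 (smoothFunAt_toModel hx)
  have h4 : SmoothFunAt (fun y => fderiv ℝ (fun e => g (ofModel x e)) (toModel x y)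
      (dFun (toModel x) y (V y))) x := ContMDiffAt.clm_apply h3 hV
  refine h4.congr ?_
  filter_upwards [hg, eventually_mem_chartDom hx] with y h5 h6
  exact dFun_apply_eq h6 h5 _

end SmoothMfd

namespace SingularFoliation

variable {X : SmoothMfd.{u}} (F : SingularFoliation X)

theorem sum_mem {ι : Type*} {U : Opens X.Pt} {s : Finset ι} {V : ι → X.VField}
    (hV : ∀ i ∈ s, F.Mem U (V i)) : F.Mem U (fun x => ∑ i ∈ s, V i x) := by
  classical
  induction s using Finset.induction_on with
  | empty => simpa using F.zero_mem U
  | insert a s ha ih =>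
    simp only [Finset.sum_insert ha]
    exact F.add_mem _ _ _ (hV a (Finset.mem_insert_self _ _))
      (ih fun i hi => hV i (Finset.mem_insert_of_mem hi))

theorem const_smul_mem {U : Opens X.Pt} {V : X.VField} (c : ℝ) (hV : F.Mem U V) :
    F.Mem U (fun x => c • V x) :=
  F.smul_mem U (fun _ => c) V (smoothFunOn_iff.2 fun x _ => smoothFunAt_const c x) hV

theorem smoothVFAt {U : Opens X.Pt} {V : X.VField} (hV : F.Mem U V) {x : X.Pt} (hx : x ∈ U) :
    SmoothVFAt V x :=
  smoothVFOn_iff.1 (F.smooth U V hV) x hx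

theorem mem_tangentAt_iff {x : X.Pt} {v : X.T x} :
    v ∈ tangentAt F.Mem x ↔ ∃ U V, x ∈ U ∧ F.Mem U V ∧ V x = v := by
  refine ⟨fun h => ?_, fun h => Submodule.subset_span h⟩
  induction h using Submodule.span_induction with
  | mem v h => exact h
  | zero => exact ⟨⊤, fun _ => 0, trivial, F.zero_mem _, rfl⟩
  | add v v' _ _ h h' =>
    obtain ⟨U, V, hx, hV, rfl⟩ := h
    obtain ⟨U', V', hx', hV', rfl⟩ := h'
    exact ⟨U ⊓ U', fun y => V y + V' y, ⟨hx, hx'⟩,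
      F.add_mem _ _ _ (F.restrict _ _ _ inf_le_left hV) (F.restrict _ _ _ inf_le_right hV'), rfl⟩
  | smul c v _ h =>
    obtain ⟨U, V, hx, hV, rfl⟩ := h
    exact ⟨U, fun y => c • V y, hx, F.const_smul_mem c hV, rfl⟩

end SingularFoliation

namespace SmoothMfd

variable {X Y Z : SmoothMfd.{u}}

/-- Near `x`, the vector field `v` along `φ` is a combination of sections of `F` with smooth
coefficients. -/
def GeneratedAt (φ : X.Pt → Y.Pt) (F : SingularFoliation Y) (x : X.Pt)
    (v : ∀ y, Y.T (φ y)) : Prop :=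
  ∃ (O : Opens Y.Pt) (r : ℕ) (G : Fin r → Y.VField) (f : Fin r → X.Pt → ℝ), φ x ∈ O ∧
    (∀ i, F.Mem O (G i)) ∧
    ∀ᶠ y in 𝓝 x, (∀ i, SmoothFunAt (f i) y) ∧ v y = ∑ i, f i y • G i (φ y)

namespace GeneratedAt

variable {φ : X.Pt → Y.Pt} {F : SingularFoliation Y} {x : X.Pt} {v v' : ∀ y, Y.T (φ y)}

theorem congr (h : GeneratedAt φ F x v) (hv : ∀ᶠ y in 𝓝 x, v' y = v y) : GeneratedAt φ F x v' := by
  obtain ⟨O, r, G, f, hx, hG, hf⟩ := h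
  refine ⟨O, r, G, f, hx, hG, ?_⟩
  filter_upwards [hf, hv] with y h1 h2
  exact ⟨h1.1, h2.trans h1.2⟩

theorem of_mem {O : Opens Y.Pt} {V : Y.VField} (hx : φ x ∈ O) (hV : F.Mem O V) :
    GeneratedAt φ F x (fun y => V (φ y)) :=
  ⟨O, 1, fun _ => V, fun _ _ => 1, hx, fun _ => hV,
    Filter.Eventually.of_forall fun y => ⟨fun _ => smoothFunAt_const _ _, by simp⟩⟩

theorem zero : GeneratedAt φ F x (fun _ => 0) :=
  of_mem (V := fun _ => 0) (O := ⊤) trivial (F.zero_mem _)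

theorem add (h : GeneratedAt φ F x v) (h' : GeneratedAt φ F x v') :
    GeneratedAt φ F x (fun y => v y + v' y) := by
  obtain ⟨O, r, G, f, hx, hG, hf⟩ := h
  obtain ⟨O', r', G', f', hx', hG', hf'⟩ := h'
  refine ⟨O ⊓ O', r + r', Fin.append G G', Fin.append f f', ⟨hx, hx'⟩, fun i => ?_, ?_⟩
  · induction i using Fin.addCases with
    | left i => rw [Fin.append_left]; exact F.restrict _ _ _ inf_le_left (hG i)
    | right i => rw [Fin.append_right]; exact F.restrict _ _ _ inf_le_right (hG' i)
  · filter_upwards [hf, hf'] with y h1 h2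
    refine ⟨fun i => ?_, ?_⟩
    · induction i using Fin.addCases with
      | left i => rw [Fin.append_left]; exact h1.1 i
      | right i => rw [Fin.append_right]; exact h2.1 i
    · simp only [Fin.sum_univ_add, Fin.append_left, Fin.append_right, h1.2, h2.2]

theorem smul {g : X.Pt → ℝ} (hg : ∀ᶠ y in 𝓝 x, SmoothFunAt g y) (h : GeneratedAt φ F x v) :
    GeneratedAt φ F x (fun y => g y • v y) := by
  obtain ⟨O, r, G, f, hx, hG, hf⟩ := h
  refine ⟨O, r, G, fun i y => g y * f i y, hx, hG, ?_⟩
  filter_upwards [hf, hg] with y h1 h2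
  exact ⟨fun i => h2.mul (h1.1 i), by rw [h1.2, Finset.smul_sum]; simp only [smul_smul]⟩

theorem sum {ι : Type*} {s : Finset ι} {v : ι → ∀ y, Y.T (φ y)}
    (h : ∀ i ∈ s, GeneratedAt φ F x (v i)) : GeneratedAt φ F x (fun y => ∑ i ∈ s, v i y) := by
  classical
  induction s using Finset.induction_on with
  | empty => simpa using zero
  | insert a s ha ih =>
    simp only [Finset.sum_insert ha]
    exact (h a (Finset.mem_insert_self _ _)).add
      (ih fun i hi => h i (Finset.mem_insert_of_mem hi))

theorem comp {ψ : Z.Pt → X.Pt} {z : Z.Pt} (hψ : ∀ᶠ y in 𝓝 z, SmoothMapAt ψ y)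
    (h : GeneratedAt φ F (ψ z) v) : GeneratedAt (φ ∘ ψ) F z (fun y => v (ψ y)) := by
  obtain ⟨O, r, G, f, hx, hG, hf⟩ := h
  refine ⟨O, r, G, fun i y => f i (ψ y), hx, hG, ?_⟩
  filter_upwards [hψ, hψ.self_of_nhds.1.eventually hf] with y h1 h2
  exact ⟨fun i => (h2.1 i).comp h1, h2.2⟩

end GeneratedAt

/-- Germ form of the pullback: the auxiliary open sets are replaced by neighborhoods filters, which
are easier to combine. -/
theorem pullback_iff {φ : X.Pt → Y.Pt} (hφ : Continuous φ) {F : SingularFoliation Y}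
    {U : Opens X.Pt} {V : X.VField} : pullback φ F U V ↔
      (∀ x ∈ U, SmoothVFAt V x) ∧ ∀ x ∈ U, GeneratedAt φ F x (fun y => D φ y (V y)) := by
  unfold pullback
  rw [smoothVFOn_iff]
  refine and_congr_right fun _ => forall₂_congr fun x hx => ⟨?_, ?_⟩
  · rintro ⟨U', O, hxU', -, hO, r, G, f, hG, hf, h⟩
    refine ⟨O, r, G, f, hO x hxU', hG, ?_⟩
    filter_upwards [Opens.eventually_mem hxU'] with y hy
    exact ⟨fun i => smoothFunOn_iff.1 (hf i) y hy, h y hy⟩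
  · rintro ⟨O, r, G, f, hxO, hG, h⟩
    obtain ⟨U', hxU', hU'⟩ := exists_opens_of_eventually
      ((h.and (Opens.eventually_mem hx)).and (hφ.continuousAt.eventually (Opens.eventually_mem hxO)))
    exact ⟨U', O, hxU', fun y hy => (hU' y hy).1.2, fun y hy => (hU' y hy).2, r, G, f, hG,
      fun i => smoothFunOn_iff.2 fun y hy => (hU' y hy).1.1.1 i, fun y hy => (hU' y hy).1.1.2⟩

theorem vertical_iff {φ : X.Pt → Y.Pt} {U : Opens X.Pt} {V : X.VField} :
    vertical φ U V ↔ ∀ x ∈ U, SmoothVFAt V x ∧ D φ x (V x) = 0 := by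
  rw [vertical, smoothVFOn_iff]
  exact ⟨fun h x hx => ⟨h.1 x hx, h.2 x hx⟩, fun h => ⟨fun x hx => (h x hx).1, fun x hx => (h x hx).2⟩⟩

theorem pullback_of_related {φ : X.Pt → Y.Pt} (hφ : Continuous φ) {F : SingularFoliation Y}
    {U : Opens X.Pt} {V : X.VField} {O : Opens Y.Pt} {G : Y.VField} (hG : F.Mem O G)
    (h : ∀ x ∈ U, φ x ∈ O ∧ SmoothVFAt V x ∧ D φ x (V x) = G (φ x)) : pullback φ F U V := by
  rw [pullback_iff hφ]
  refine ⟨fun x hx => (h x hx).2.1, fun x hx => ?_⟩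
  refine (GeneratedAt.of_mem (h x hx).1 hG).congr ?_
  filter_upwards [Opens.eventually_mem hx] with y hy using (h y hy).2.2

theorem pullback_of_vertical {φ : X.Pt → Y.Pt} (hφ : Continuous φ) {F : SingularFoliation Y}
    {U : Opens X.Pt} {V : X.VField} (h : vertical φ U V) : pullback φ F U V :=
  pullback_of_related hφ (G := fun _ => 0) (F.zero_mem ⊤)
    fun x hx => ⟨trivial, (vertical_iff.1 h x hx).1, (vertical_iff.1 h x hx).2⟩

namespace IsSubmersion

variable {p : X.Pt → Y.Pt}

theorem continuous (hp : IsSubmersion p) : Continuous p := continuous_iff_continuousAt.2 fun x => (hp x).1.1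

theorem surjective_fderiv_mapToModel (hp : IsSubmersion p) (x : X.Pt) {y₀ : Y.Pt} (hy : p x ∈ chartDom y₀) :
    Function.Surjective (fderiv ℝ (mapToModel x y₀ p) (toModel x x)) := by
  intro v
  obtain ⟨a, rfl⟩ := (dFun_toModel_bijective hy).2 v
  obtain ⟨b, rfl⟩ := (hp x).2 a
  exact ⟨_, fderiv_mapToModel (mem_chartDom_self x) hy (hp x).1 b⟩

/-- Locally, a submersion admits lifts of vector fields and a generating family of vertical vector
fields. -/
theorem exists_lifts (hp : IsSubmersion p) {ι : Type*} [Fintype ι]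
    (w : X.Pt) (G : ι → Y.VField)
    (hG : ∀ i, ∀ᶠ y in 𝓝 (p w), SmoothVFAt (G i) y) :
    ∃ (V : ι → X.VField) (ξ : Fin w.1 → X.VField), ∀ᶠ x in 𝓝 w,
      (∀ i, SmoothVFAt (V i) x ∧ D p x (V i x) = G i (p x)) ∧
      (∀ k, SmoothVFAt (ξ k) x ∧ D p x (ξ k x) = 0) ∧
      ∀ (v : X.T x) (c : ι → ℝ), D p x v = ∑ i, c i • G i (p x) →
        v = ∑ i, c i • V i x + ∑ k, dFun (toModel w) x v k • ξ k x := by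
  have hd := mem_chartDom_self w
  have hd' := mem_chartDom_self (p w)
  set f := mapToModel w (p w) p
  have hf : SmoothNear f (toModel w w) :=
    smoothNear_mapToModel hd' (Filter.Eventually.of_forall fun x => (hp x).1)
  obtain ⟨R, hR, hfR⟩ := exists_smooth_rightInverse_fderiv hf
    (surjective_fderiv_mapToModel hp w hd')
  -- With R a smooth right inverse of the differential in charts, R applied to G_i is a lift, and
  -- b_k − R f'(b_k) is the projection of a basis vector to the kernel. The last claim is the
  -- splitting a = R f'(a) + (a − R f'(a)).
  set V : ι → X.VField := fun i => vfOfModel w fun e => R e (vfToModel (p w) (G i) (f e))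
  set b : Fin w.1 → Model w := fun k => EuclideanSpace.single k 1
  set ξ : Fin w.1 → X.VField := fun k => vfOfModel w fun e => b k - R e (fderiv ℝ f e (b k))
  refine ⟨V, ξ, ?_⟩
  have hpd : ∀ᶠ x in 𝓝 w, p x ∈ chartDom (p w) :=
    (hp w).1.1.eventually (eventually_mem_chartDom hd')
  have hGp : ∀ᶠ x in 𝓝 w, ∀ i, SmoothVFAt (G i) (p x) :=
    Filter.eventually_all.2 fun i => (hp w).1.1.eventually (hG i)
  filter_upwards [hpd, hGp, eventually_mem_chartDom hd,
    (tendsto_toModel hd).eventually ((hR.and hfR).and (hf.and hf.fderiv))]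
    with x h1 h2 h3 ⟨⟨h4, h5⟩, h6, h7⟩
  have key : ∀ v : X.T x, fderiv ℝ f (toModel w x) (dFun (toModel w) x v) =
      dFun (toModel (p w)) (p x) (D p x v) := fun v => fderiv_mapToModel h3 h1 (hp x).1 v
  have hfx : f (toModel w x) = toModel (p w) (p x) := mapToModel_toModel h3
  have hGx : ∀ i, vfToModel (p w) (G i) (f (toModel w x)) =
      dFun (toModel (p w)) (p x) (G i (p x)) := fun i => by rw [hfx, vfToModel_toModel h1]
  have hV : ∀ i, dFun (toModel w) x (V i x) =
      R (toModel w x) (dFun (toModel (p w)) (p x) (G i (p x))) := fun i => by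
    rw [dFun_vfOfModel h3, hGx]
  have hξ : ∀ k, dFun (toModel w) x (ξ k x) =
      b k - R (toModel w x) (fderiv ℝ f (toModel w x) (b k)) := fun k => dFun_vfOfModel h3 _
  refine ⟨fun i => ⟨?_, ?_⟩, fun k => ⟨?_, ?_⟩, fun v c hv => ?_⟩
  · refine smoothVFAt_vfOfModel h3 (h4.clm_apply ?_)
    refine ContDiffAt.comp (g := vfToModel (p w) (G i)) _ ?_ h6
    rw [hfx]
    exact contDiffAt_vfToModel h1 (h2 i)
  · refine dFun_toModel_injective h1 ?_
    rw [← key, hV, h5]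
  · exact smoothVFAt_vfOfModel h3
      (contDiffAt_const.sub (h4.clm_apply (h7.clm_apply contDiffAt_const)))
  · refine dFun_toModel_injective h1 ?_
    rw [← key, hξ, map_sub, h5, sub_self, map_zero]
  · refine dFun_toModel_injective h3 ?_
    simp only [map_add, map_sum, map_smul, hV, hξ]
    set a := dFun (toModel w) x v
    have ha : ∑ k, a k • b k = a := by
      ext j
      simp [b, Pi.single_apply]
    have h8 : fderiv ℝ f (toModel w x) a = ∑ i, c i • dFun (toModel (p w)) (p x) (G i (p x)) := by
      rw [key, hv]
      simp only [map_sum, map_smul]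
    have h9 : ∑ i, c i • R (toModel w x) (dFun (toModel (p w)) (p x) (G i (p x))) =
        R (toModel w x) (fderiv ℝ f (toModel w x) a) := by
      rw [h8]
      simp only [map_sum, map_smul]
    have h10 : ∑ k, a k • (b k - R (toModel w x) (fderiv ℝ f (toModel w x) (b k))) =
        a - R (toModel w x) (fderiv ℝ f (toModel w x) a) := by
      conv_rhs => rw [← ha]
      simp only [smul_sub, Finset.sum_sub_distrib, map_sum, map_smul]
    rw [h9, h10]
    abel

theorem exists_lift (hp : IsSubmersion p) (w : X.Pt) {G : Y.VField} (hG : ∀ᶠ y in 𝓝 (p w), SmoothVFAt G y) :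
    ∃ V : X.VField, ∀ᶠ x in 𝓝 w, SmoothVFAt V x ∧ D p x (V x) = G (p x) := by
  obtain ⟨V, _, h⟩ := exists_lifts hp w (fun _ : Unit => G) fun _ => hG
  exact ⟨V (), h.mono fun x hx => hx.1 ()⟩

theorem exists_vertical (hp : IsSubmersion p) (w : X.Pt) {u : X.T w} (hu : D p w u = 0) :
    ∃ ξ : X.VField, (∀ᶠ x in 𝓝 w, SmoothVFAt ξ x ∧ D p x (ξ x) = 0) ∧ ξ w = u := by
  obtain ⟨_, ξ, h⟩ := exists_lifts hp w (fun i : Empty => i.elim) fun i => i.elim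
  refine ⟨fun x => ∑ k, dFun (toModel w) w u k • ξ k x, ?_, ?_⟩
  · filter_upwards [h] with x hx
    refine ⟨SmoothVFAt.sum fun k _ => SmoothVFAt.smul (smoothFunAt_const _ x) (hx.2.1 k).1, ?_⟩
    simp [map_sum, map_smul, (hx.2.1 _).2]
  · simpa using (h.self_of_nhds.2.2 u (fun i => i.elim) (by simpa using hu)).symm

/-- The tangent space of a pullback by a submersion is the preimage of the tangent space. -/
theorem tangentAt_pullback (hp : IsSubmersion p) (F : SingularFoliation Y) (w : X.Pt) :
    tangentAt (pullback p F) w = (tangentAt F.Mem (p w)).comap (D p w : X.T w →ₗ[ℝ] Y.T (p w)) := by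
  apply le_antisymm
  · refine Submodule.span_le.2 ?_
    rintro v ⟨U, V, hw, hV, rfl⟩
    obtain ⟨O, r, G, f, hO, hG, h⟩ := ((pullback_iff (continuous hp)).1 hV).2 w hw
    change D p w (V w) ∈ tangentAt F.Mem (p w)
    have h1 : D p w (V w) = ∑ i, f i w • G i (p w) := h.self_of_nhds.2
    rw [h1]
    exact Submodule.sum_mem _ fun i _ => Submodule.smul_mem _ _
      (Submodule.subset_span ⟨O, G i, hO, hG i, rfl⟩)
  · intro v hv
    obtain ⟨O, G, hO, hG, hGv⟩ := F.mem_tangentAt_iff.1 hv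
    obtain ⟨V, hV⟩ := exists_lift hp w
      ((Opens.eventually_mem hO).mono fun y hy => F.smoothVFAt hG hy)
    -- The lift of a section through Tp(v) differs from `v` by a vertical vector, and vertical
    -- fields also belong to the pullback.
    have h0 : D p w (v - V w) = 0 := by
      rw [map_sub, hV.self_of_nhds.2, hGv]
      exact sub_self _
    obtain ⟨ξ, hξ, hξw⟩ := exists_vertical hp w h0
    obtain ⟨U, hw, hU⟩ := exists_opens_of_eventually
      ((hV.and hξ).and ((hp w).1.1.eventually (Opens.eventually_mem hO)))
    have h1 : V w ∈ tangentAt (pullback p F) w := Submodule.subset_span ⟨U, V, hw,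
      pullback_of_related (continuous hp) hG fun x hx => ⟨(hU x hx).2, (hU x hx).1.1⟩, rfl⟩
    have h2 : ξ w ∈ tangentAt (pullback p F) w := Submodule.subset_span ⟨U, ξ, hw,
      pullback_of_vertical (continuous hp) (vertical_iff.2 fun x hx => (hU x hx).1.2), rfl⟩
    have h3 := Submodule.add_mem _ h1 h2
    rwa [hξw, add_sub_cancel] at h3

end IsSubmersion

end SmoothMfd

/-! ### Transfer between the two foliations and projectable vertical fields -/

namespace BiSubmersion

variable {M N W W' S : SmoothMfd.{u}} {FM : SingularFoliation M} {FN : SingularFoliation N}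

/-- The bi-submersion with source and target exchanged. -/
def swap (B : BiSubmersion FM FN W) : BiSubmersion FN FM W where
  p := B.q
  q := B.p
  submersion_p := B.submersion_q
  submersion_q := B.submersion_p
  pullback_eq U V := (B.pullback_eq U V).symm
  pullback_eq_sum U V := by
    rw [← B.pullback_eq, B.pullback_eq_sum]
    constructor
    · rintro ⟨ξ, ζ, h1, h2, h3⟩
      exact ⟨ζ, ξ, h2, h1, fun x hx => (h3 x hx).trans (add_comm _ _)⟩
    · rintro ⟨ξ, ζ, h1, h2, h3⟩
      exact ⟨ζ, ξ, h2, h1, fun x hx => (h3 x hx).trans (add_comm _ _)⟩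

/-- Along ι, the vector Tι(V) is a combination with smooth coefficients of lifts of sections of F_M
and of p-vertical fields. All of these lie in p⁻¹(F_M) = q⁻¹(F_N), so their images under Tq are
generated by F_N, and these can be restricted to ι. -/
theorem pullback_comp_of_pullback_comp (B : BiSubmersion FM FN W) {ι : S.Pt → W.Pt}
    (hι : ∀ s, SmoothMapAt ι s) {O : Opens S.Pt} {V : S.VField}
    (h : pullback (B.p ∘ ι) FM O V) : pullback (B.q ∘ ι) FN O V := by
  have hιc : Continuous ι := continuous_iff_continuousAt.2 fun s => (hι s).1
  have hpc := IsSubmersion.continuous B.submersion_p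
  have hqc := IsSubmersion.continuous B.submersion_q
  rw [pullback_iff (hpc.comp hιc)] at h
  rw [pullback_iff (hqc.comp hιc)]
  refine ⟨h.1, fun s hs => ?_⟩
  obtain ⟨O', r, G, f, hO', hG, hf⟩ := h.2 s hs
  obtain ⟨X, ξ, hX⟩ := IsSubmersion.exists_lifts B.submersion_p (ι s) G fun i =>
    (Opens.eventually_mem hO').mono fun y hy => FM.smoothVFAt (hG i) hy
  obtain ⟨U, hU, hUX⟩ := exists_opens_of_eventually
    (hX.and (hpc.continuousAt.eventually (Opens.eventually_mem hO')))
  have hgen : ∀ Z : W.VField, pullback B.p FM U Z →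
      GeneratedAt (B.q ∘ ι) FN s (fun y => D B.q (ι y) (Z (ι y))) := fun Z hZ =>
    GeneratedAt.comp (Filter.Eventually.of_forall hι)
      (((pullback_iff hqc).1 ((B.pullback_eq U Z).1 hZ)).2 (ι s) hU)
  have h1 : ∀ i, pullback B.p FM U (X i) := fun i =>
    pullback_of_related hpc (hG i) fun x hx => ⟨(hUX x hx).2, (hUX x hx).1.1 i⟩
  have h2 : ∀ k, pullback B.p FM U (ξ k) := fun k =>
    pullback_of_vertical hpc (vertical_iff.2 fun x hx => (hUX x hx).1.2.1 k)
  -- The coefficients of the vertical fields are the chart coordinates of Tι(V), written as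
  -- derivatives on `S` so that they are visibly smooth.
  set c : Fin (ι s).1 → S.Pt → ℝ := fun k y => dFun (fun z => toModel (ι s) (ι z)) y (V y) k
  have htm : ∀ᶠ y in 𝓝 s, SmoothFunAt (fun z => toModel (ι s) (ι z)) y := by
    filter_upwards [hιc.continuousAt.eventually
      (eventually_mem_chartDom (mem_chartDom_self (ι s)))] with y hy
    exact (smoothFunAt_toModel hy).comp (hι y)
  have hc : ∀ k, ∀ᶠ y in 𝓝 s, SmoothFunAt (c k) y := by
    intro k
    filter_upwards [htm.eventually_nhds, Opens.eventually_mem hs] with y h3 h4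
    exact SmoothFunAt.comp_contDiffAt (φ := EuclideanSpace.proj (𝕜 := ℝ) k)
      (EuclideanSpace.proj (𝕜 := ℝ) k).contDiff.contDiffAt (SmoothFunAt.dFun_apply h3 (h.1 y h4))
  refine (GeneratedAt.add
    (GeneratedAt.sum (s := Finset.univ) fun i _ =>
      (hgen _ (h1 i)).smul (hf.mono fun y hy => hy.1 i))
    (GeneratedAt.sum (s := Finset.univ) fun k _ => (hgen _ (h2 k)).smul (hc k))).congr ?_
  filter_upwards [hf, hιc.continuousAt.eventually (Opens.eventually_mem hU),
    hιc.continuousAt.eventually (eventually_mem_chartDom (mem_chartDom_self (ι s)))] with y h3 h4 h5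
  have h6 : D (B.q ∘ ι) y (V y) = D B.q (ι y) (D ι y (V y)) := D_comp (B.submersion_q _).1 (hι y) _
  have h7 : D (B.p ∘ ι) y (V y) = D B.p (ι y) (D ι y (V y)) := D_comp (B.submersion_p _).1 (hι y) _
  have h8 := (hUX _ h4).1.2.2 (D ι y (V y)) (fun i => f i y) (h7.symm.trans h3.2)
  have h9 : ∀ k, dFun (toModel (ι s)) (ι y) (D ι y (V y)) k = c k y := fun k => by
    simp only [c]
    rw [dFun_comp (smoothFunAt_toModel h5) (hι y)]
  rw [h6, h8]
  simp only [map_add, map_sum, map_smul, h9]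

/-- The diffeomorphism induced by a bi-transversal is an isomorphism of foliations. -/
theorem BiTransversal.inducesFoliationIso {B : BiSubmersion FM FN W} {w : W.Pt}
    (T : B.BiTransversal w) (A : Opens T.S.Pt) : T.InducesFoliationIso A := fun _ _ _ =>
  ⟨B.pullback_comp_of_pullback_comp fun s => (T.embedding.2 s).1,
    B.swap.pullback_comp_of_pullback_comp fun s => (T.embedding.2 s).1⟩

/-- Sections of `FN` lift to vector fields that are tangent to the fibers of `p`. -/
theorem exists_vertical_lift (B : BiSubmersion FM FN W) {w : W.Pt} {O : Opens N.Pt} {H : N.VField}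
    (hO : B.q w ∈ O) (hH : FN.Mem O H) : ∃ X : W.VField, ∀ᶠ x in 𝓝 w,
      SmoothVFAt X x ∧ D B.p x (X x) = 0 ∧ D B.q x (X x) = H (B.q x) := by
  obtain ⟨Z, hZ⟩ := IsSubmersion.exists_lift B.submersion_q w
    ((Opens.eventually_mem hO).mono fun y hy => FN.smoothVFAt hH hy)
  have hqc := IsSubmersion.continuous B.submersion_q
  obtain ⟨U, hw, hU⟩ := exists_opens_of_eventually
    (hZ.and (hqc.continuousAt.eventually (Opens.eventually_mem hO)))
  have h1 : pullback B.q FN U Z :=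
    pullback_of_related hqc hH fun x hx => ⟨(hU x hx).2, (hU x hx).1⟩
  -- Any q-lift of `H` lies in q⁻¹(F_N), hence is p-vertical plus q-vertical; dropping the
  -- q-vertical part does not change its projection to `N`.
  obtain ⟨ξ, ζ, hξ, hζ, hs⟩ := (B.pullback_eq_sum U Z).1 ((B.pullback_eq U Z).2 h1)
  refine ⟨ξ, ?_⟩
  filter_upwards [Opens.eventually_mem hw] with x hx
  have h2 := vertical_iff.1 hξ x hx
  refine ⟨h2.1, h2.2, ?_⟩
  rw [← (hU x hx).1.2, hs x hx, map_add, (vertical_iff.1 hζ x hx).2, add_zero]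

/-- A vector tangent to the fiber of `p` is the value of a vector field tangent to the fibers of `p`
that projects to a section of `FN`; such a section lifts to any other bi-submersion. -/
theorem exists_related_of_D_p_eq_zero (B : BiSubmersion FM FN W) (B' : BiSubmersion FM FN W')
    {w : W.Pt} {w' : W'.Pt} (hq : B.q w = B'.q w') {u : W.T w} (hu : D B.p w u = 0) :
    ∃ (X : W.VField) (X' : W'.VField) (H : N.VField), X w = u ∧
      (∀ᶠ y in 𝓝 (B.q w), SmoothVFAt H y) ∧
      (∀ᶠ x in 𝓝 w, SmoothVFAt X x ∧ D B.p x (X x) = 0 ∧ D B.q x (X x) = H (B.q x)) ∧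
      (∀ᶠ x in 𝓝 w', SmoothVFAt X' x ∧ D B'.p x (X' x) = 0 ∧ D B'.q x (X' x) = H (B'.q x)) := by
  obtain ⟨ξ, hξ, hξw⟩ := IsSubmersion.exists_vertical B.submersion_p w hu
  obtain ⟨U, hw, hU⟩ := exists_opens_of_eventually hξ
  have h1 : pullback B.q FN U ξ := (B.pullback_eq U ξ).1
    (pullback_of_vertical (IsSubmersion.continuous B.submersion_p) (vertical_iff.2 hU))
  obtain ⟨O, r, G, f, hO, hG, hf⟩ :=
    ((pullback_iff (IsSubmersion.continuous B.submersion_q)).1 h1).2 w hw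
  choose Y hY using fun i => B.exists_vertical_lift hO (hG i)
  have hH : FN.Mem O (fun y => ∑ i, f i w • G i y) :=
    FN.sum_mem fun i _ => FN.const_smul_mem (f i w) (hG i)
  obtain ⟨X', hX'⟩ := B'.exists_vertical_lift (hq ▸ hO) hH
  -- Tq(ξ) = Σ f_i G_i ∘ q has coefficients that vary along the fibers of q. The correction freezes
  -- them at their values at `w`, which makes the field projectable; it vanishes at `w` and stays
  -- p-vertical.
  refine ⟨fun x => ξ x + ∑ i, (f i w - f i x) • Y i x, X', _, ?_,
    (Opens.eventually_mem hO).mono fun y hy => FN.smoothVFAt hH hy, ?_, hX'⟩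
  · simp [hξw]
  · filter_upwards [hξ, hf, Filter.eventually_all.2 hY] with x h2 h3 h4
    refine ⟨h2.1.add (SmoothVFAt.sum fun i _ => SmoothVFAt.smul ?_ (h4 i).1), ?_, ?_⟩
    · exact ContMDiffAt.sub (smoothFunAt_const (f i w) x) (h3.1 i)
    · simp [map_sum, h2.2, (h4 _).2.1]
    · simp only [map_add, map_sum, map_smul, (h4 _).2.2]
      rw [h3.2, ← Finset.sum_add_distrib]
      refine Finset.sum_congr rfl fun i _ => ?_
      rw [← add_smul, add_sub_cancel]

end BiSubmersion

/-! ### Local inverses, open submanifolds and Euclidean spaces -/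

namespace SmoothMfd

variable {X Y Z : SmoothMfd.{u}}

/-- The differential only depends on the germ of the map. -/
theorem D_induction {f g : X.Pt → Y.Pt} {x : X.Pt} (h : ∀ᶠ y in 𝓝 x, f y = g y)
    (P : ∀ y : Y.Pt, (X.T x →L[ℝ] Y.T y) → Prop) (hf : P (f x) (D f x)) : P (g x) (D g x) := by
  -- `D f x` and `D g x` live over different points of `Y`, hence the predicate `P`. Separating the
  -- reference point `y` from the map in `R` lets the base point be rewritten first and the germ
  -- second.
  let c : ∀ y : Y.Pt, Y.Pt → Y.piece y.1 := fun y a => if h : a.1 = y.1 then h ▸ a.2 else y.2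
  set R : (X.Pt → Y.Pt) → ∀ y : Y.Pt, X.piece x.1 → Y.piece y.1 := fun f y z => c y (f ⟨x.1, z⟩)
  have h1 : P (g x) (mfderiv (𝓡 x.1) (𝓡 (g x).1) (R f (g x)) x.2) := by
    rw [← h.self_of_nhds]
    exact hf
  have h2 : R f (g x) =ᶠ[𝓝 x.2] R g (g x) := by
    filter_upwards [eventually_mk.1 h] with z hz
    exact congrArg (c (g x)) hz
  rw [h2.mfderiv_eq] at h1
  exact h1

theorem smoothMapAt_ofModel {y₀ : Y.Pt} {g : X.Pt → Model y₀} {x : X.Pt} (hg : SmoothFunAt g x)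
    (ht : g x ∈ (chartAt (EuclideanSpace ℝ (Fin y₀.1)) y₀.2).target) :
    SmoothMapAt (fun x => ofModel y₀ (g x)) x := by
  have h5 : ofModel y₀ (g x) ∈ chartDom y₀ := ofModel_mem_chartDom ht
  rw [smoothMapAt_iff]
  constructor
  · have h7 := tendsto_ofModel h5
    rw [toModel_ofModel ht] at h7
    exact Filter.Tendsto.comp (g := ofModel y₀) h7 hg.continuousAt
  · have h9 := (smoothFunAt_iff h5).1 (smoothFunAt_toModel (mem_chartDom_self (ofModel y₀ (g x))))
    rw [toModel_ofModel ht] at h9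
    exact SmoothFunAt.comp_contDiffAt (φ := fun e => toModel (ofModel y₀ (g x)) (ofModel y₀ e)) h9 hg

theorem dFun_toModel_D_ofModel {y₀ : Y.Pt} {g : X.Pt → Model y₀} {x : X.Pt} (hg : SmoothFunAt g x)
    (ht : g x ∈ (chartAt (EuclideanSpace ℝ (Fin y₀.1)) y₀.2).target) (v : X.T x) :
    dFun (toModel y₀) (ofModel y₀ (g x)) (D (fun x => ofModel y₀ (g x)) x v) = dFun g x v := by
  rw [← dFun_comp (f := fun x => ofModel y₀ (g x)) (smoothFunAt_toModel (ofModel_mem_chartDom ht))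
    (smoothMapAt_ofModel hg ht)]
  refine DFunLike.congr_fun (dFun_congr ?_) v
  filter_upwards [hg.continuousAt.eventually
    ((OpenPartialHomeomorph.open_target _).mem_nhds ht)] with y hy
  exact toModel_ofModel hy

theorem toModel_injOn {x₀ x y : X.Pt} (hx : x ∈ chartDom x₀) (hy : y ∈ chartDom x₀)
    (h : toModel x₀ x = toModel x₀ y) : x = y := by
  rw [← ofModel_toModel hx, h, ofModel_toModel hy]

/-- Submersions have local sections. -/
theorem exists_section {f : X.Pt → Y.Pt} {x : X.Pt} (hf : ∀ᶠ z in 𝓝 x, SmoothMapAt f z)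
    (hs : Function.Surjective (D f x)) :
    ∃ σ : Y.Pt → X.Pt, σ (f x) = x ∧ ∀ᶠ y in 𝓝 (f x), SmoothMapAt σ y ∧ f (σ y) = y := by
  have hx := mem_chartDom_self x
  have hy := mem_chartDom_self (f x)
  have hF := smoothNear_mapToModel hy hf
  have hFs : Function.Surjective (fderiv ℝ (mapToModel x (f x) f) (toModel x x)) := by
    intro v
    obtain ⟨a, rfl⟩ := (dFun_toModel_bijective hy).2 v
    obtain ⟨b, rfl⟩ := hs a
    exact ⟨_, fderiv_mapToModel hx hy hf.self_of_nhds b⟩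
  obtain ⟨g, hg, hg0, hfg⟩ := exists_local_section hF hFs
  rw [mapToModel_toModel hx] at hg hg0 hfg
  have hσ := eventually_smoothMapAt_ofModel hg hg0
  have hσ0 : ofModel x (g (toModel (f x) (f x))) = x := by rw [hg0, ofModel_toModel hx]
  have hc : Filter.Tendsto (fun y => f (ofModel x (g (toModel (f x) y)))) (𝓝 (f x)) (𝓝 (f x)) := by
    have h1 := hσ.self_of_nhds.1.tendsto
    simp only [hσ0] at h1
    exact hf.self_of_nhds.1.tendsto.comp h1
  refine ⟨fun y => ofModel x (g (toModel (f x) y)), hσ0, ?_⟩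
  filter_upwards [hσ, hc.eventually (eventually_mem_chartDom hy), eventually_mem_chartDom hy,
    (tendsto_toModel hy).eventually hfg] with y h1 h2 h3 h4
  exact ⟨h1, toModel_injOn h2 h3 h4⟩

/-- Immersions have local left inverses. -/
theorem exists_leftInverse {f : X.Pt → Y.Pt} {x : X.Pt} (hf : ∀ᶠ z in 𝓝 x, SmoothMapAt f z)
    (hi : Function.Injective (D f x)) :
    ∃ r : Y.Pt → X.Pt, (∀ᶠ y in 𝓝 (f x), SmoothMapAt r y) ∧ ∀ᶠ z in 𝓝 x, r (f z) = z := by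
  have hx := mem_chartDom_self x
  have hy := mem_chartDom_self (f x)
  have hF := smoothNear_mapToModel hy hf
  have hFi : Function.Injective (fderiv ℝ (mapToModel x (f x) f) (toModel x x)) := by
    intro v v' h
    obtain ⟨a, rfl⟩ := (dFun_toModel_bijective hx).2 v
    obtain ⟨b, rfl⟩ := (dFun_toModel_bijective hx).2 v'
    rw [fderiv_mapToModel hx hy hf.self_of_nhds, fderiv_mapToModel hx hy hf.self_of_nhds] at h
    rw [hi (dFun_toModel_injective hy h)]
  obtain ⟨g, hg, hgf⟩ := exists_local_leftInverse hF hFi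
  rw [mapToModel_toModel hx] at hg
  have hg0 : g (toModel (f x) (f x)) = toModel x x := by
    have := hgf.self_of_nhds
    rwa [mapToModel_toModel hx] at this
  refine ⟨fun y => ofModel x (g (toModel (f x) y)), eventually_smoothMapAt_ofModel hg hg0, ?_⟩
  filter_upwards [eventually_mem_chartDom hx, (tendsto_toModel hx).eventually hgf] with z h1 h2
  rw [mapToModel_toModel h1] at h2
  rw [h2, ofModel_toModel h1]

/-- Surjectivity of the differential is an open condition. -/
theorem eventually_surjective_D {f : X.Pt → Y.Pt} {x : X.Pt} (hf : ∀ᶠ z in 𝓝 x, SmoothMapAt f z)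
    (hs : Function.Surjective (D f x)) : ∀ᶠ z in 𝓝 x, Function.Surjective (D f z) := by
  have hx := mem_chartDom_self x
  have hy := mem_chartDom_self (f x)
  have hFs : Function.Surjective (fderiv ℝ (mapToModel x (f x) f) (toModel x x)) := by
    intro v
    obtain ⟨a, rfl⟩ := (dFun_toModel_bijective hy).2 v
    obtain ⟨b, rfl⟩ := hs a
    exact ⟨_, fderiv_mapToModel hx hy hf.self_of_nhds b⟩
  obtain ⟨R, -, hR⟩ := exists_smooth_rightInverse_fderiv (smoothNear_mapToModel hy hf) hFs
  filter_upwards [hf, eventually_mem_chartDom hx, (tendsto_toModel hx).eventually hR,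
    hf.self_of_nhds.1.eventually (eventually_mem_chartDom hy)] with z h1 h2 h3 h4 v
  obtain ⟨b, hb⟩ := (dFun_toModel_bijective h2).2 (R (toModel x z) (dFun (toModel (f x)) (f z) v))
  refine ⟨b, dFun_toModel_injective h4 ?_⟩
  rw [← fderiv_mapToModel h2 h4 h1, hb, h3]

/-- An open submanifold. -/
def restrict (X : SmoothMfd.{u}) (A : Opens X.Pt) : SmoothMfd.{u} where
  piece n := (⟨{y | (⟨n, y⟩ : X.Pt) ∈ A}, isOpen_preimage_mk A n⟩ : Opens (X.piece n))
  smooth _ := inferInstance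

/-- The inclusion of an open submanifold. -/
def incl (A : Opens X.Pt) (s : (X.restrict A).Pt) : X.Pt := ⟨s.1, s.2.1⟩

theorem incl_mem (A : Opens X.Pt) (s : (X.restrict A).Pt) : incl A s ∈ A := s.2.2

/-- A point of an open set as a point of the open submanifold. -/
def restrictMk {A : Opens X.Pt} (x : X.Pt) (hx : x ∈ A) : (X.restrict A).Pt := ⟨x.1, x.2, hx⟩

theorem isOpenEmbedding_incl (A : Opens X.Pt) : Topology.IsOpenEmbedding (incl A) := by
  refine Topology.IsOpenEmbedding.of_continuous_injective_isOpenMap ?_ ?_ ?_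
  · exact continuous_sigma fun n => continuous_sigmaMk.comp continuous_subtype_val
  · rintro ⟨n, y⟩ ⟨m, z⟩ h
    obtain rfl : n = m := congrArg Sigma.fst h
    have h2 : y.1 = z.1 := eq_of_heq (Sigma.mk.inj h).2
    rw [Subtype.ext h2]
  · refine isOpenMap_sigma.2 fun n => ?_
    exact (isOpenMap_sigmaMk (σ := X.piece) (i := n)).comp (Opens.isOpen _).isOpenMap_subtype_val

theorem smoothMapAt_incl (A : Opens X.Pt) (s : (X.restrict A).Pt) : SmoothMapAt (incl A) s := by
  refine ⟨(isOpenEmbedding_incl A).continuous.continuousAt, ?_⟩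
  refine ContMDiffAt.congr_of_eventuallyEq (contMDiff_subtype_val s.2)
    (Filter.Eventually.of_forall fun z => ?_)
  exact dif_pos rfl

/-- In the preferred charts the inclusion is the identity. -/
theorem bijective_D_incl (A : Opens X.Pt) (s : (X.restrict A).Pt) :
    Function.Bijective (D (incl A) s) := by
  have h1 := dFun_toModel_bijective (mem_chartDom_self s)
  have h2 := dFun_toModel_bijective (mem_chartDom_self (incl A s))
  have h3 : dFun (toModel s) s = dFun (fun z => toModel (incl A s) (incl A z)) s := by
    refine Filter.EventuallyEq.mfderiv_eq (Filter.Eventually.of_forall fun z => ?_)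
    exact (toModel_mk s z).trans (toModel_mk (incl A s) z.1).symm
  have h4 : ∀ v, dFun (toModel s) s v = dFun (toModel (incl A s)) (incl A s) (D (incl A) s v) := by
    intro v
    rw [h3]
    exact dFun_comp (smoothFunAt_toModel (mem_chartDom_self _)) (smoothMapAt_incl A s) v
  refine ⟨fun v v' h => h1.1 (by rw [h4, h4, h]), fun v => ?_⟩
  obtain ⟨b, hb⟩ := h1.2 (dFun (toModel (incl A s)) (incl A s) v)
  exact ⟨b, h2.1 (by rw [← h4, hb])⟩

/-- The disjoint union of all Euclidean spaces. -/
def euclideanSpaces : SmoothMfd.{u} where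
  piece n := ULift.{u} (EuclideanSpace ℝ (Fin n))
  charted _ := Homeomorph.ulift.toOpenPartialHomeomorph.singletonChartedSpace rfl
  smooth _ := Homeomorph.ulift.toOpenPartialHomeomorph.isManifold_singleton rfl
  secondCountable _ := Homeomorph.ulift.secondCountableTopology

/-- A point of a Euclidean space. -/
def euclideanPoint {d : ℕ} (e : EuclideanSpace ℝ (Fin d)) : euclideanSpaces.{u}.Pt := ⟨d, ⟨e⟩⟩

theorem toModel_euclideanPoint {d : ℕ} (e e' : EuclideanSpace ℝ (Fin d)) :
    toModel (euclideanPoint.{u} e) (euclideanPoint e') = e' :=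
  toModel_mk (euclideanPoint.{u} e) ⟨e'⟩

end SmoothMfd

/-! ### Equivalence of points of bi-submersions -/

namespace SmoothMfd

variable {X Y Z : SmoothMfd.{u}}

theorem smoothNear_vfToModel {V : X.VField} {x₀ x : X.Pt} (hx : x ∈ chartDom x₀)
    (hV : ∀ᶠ y in 𝓝 x, SmoothVFAt V y) : SmoothNear (vfToModel x₀ V) (toModel x₀ x) := by
  filter_upwards [(tendsto_ofModel hx).eventually (hV.and (eventually_mem_chartDom hx)),
    eventually_mem_target hx] with e h1 h2
  have := contDiffAt_vfToModel h1.2 h1.1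
  rwa [toModel_ofModel h2] at this

end SmoothMfd

namespace BiSubmersion

variable {M N W W' Z : SmoothMfd.{u}} {FM : SingularFoliation M} {FN : SingularFoliation N}

theorem EquivPoints.symm {B : BiSubmersion FM FN W} {B' : BiSubmersion FM FN W'} {w : W.Pt}
    {w' : W'.Pt} (h : B.EquivPoints B' w w') : B'.EquivPoints B w' w := by
  obtain ⟨U, U', hU, hU', V, δ, η, hR, v, hv, hv'⟩ := h
  exact ⟨U', U, hU', hU, V, η, δ, ⟨hR.submersion_right, hR.submersion_left, hR.range_right,
    hR.range_left, fun v => (hR.comm_p v).symm, fun v => (hR.comm_q v).symm⟩, v, hv', hv⟩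

/-- The vectors `u` and `u'` are the values of vector fields that project to the same vector fields
of `M` and `N`. -/
def AreRelated (B : BiSubmersion FM FN W) (B' : BiSubmersion FM FN W') (w : W.Pt) (w' : W'.Pt)
    (u : W.T w) (u' : W'.T w') : Prop :=
  ∃ (X : W.VField) (X' : W'.VField) (K : M.VField) (H : N.VField), X w = u ∧ X' w' = u' ∧
    (∀ᶠ y in 𝓝 (B.p w), SmoothVFAt K y) ∧ (∀ᶠ y in 𝓝 (B.q w), SmoothVFAt H y) ∧
    (∀ᶠ x in 𝓝 w, SmoothVFAt X x ∧ D B.p x (X x) = K (B.p x) ∧ D B.q x (X x) = H (B.q x)) ∧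
    (∀ᶠ x in 𝓝 w', SmoothVFAt X' x ∧ D B'.p x (X' x) = K (B'.p x) ∧ D B'.q x (X' x) = H (B'.q x))

section Related

variable {B : BiSubmersion FM FN W} {B' : BiSubmersion FM FN W'} {w : W.Pt} {w' : W'.Pt}

theorem AreRelated.symm {u : W.T w} {u' : W'.T w'} (hp : B.p w = B'.p w') (hq : B.q w = B'.q w')
    (h : AreRelated B B' w w' u u') : AreRelated B' B w' w u' u := by
  obtain ⟨X, X', K, H, hX, hX', hK, hH, h1, h2⟩ := h
  exact ⟨X', X, K, H, hX', hX, hp ▸ hK, hq ▸ hH, h2, h1⟩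

/-- Here the common projection to `M` is the zero field. -/
theorem exists_areRelated_of_D_p_eq_zero (hq : B.q w = B'.q w') {u : W.T w} (hu : D B.p w u = 0) :
    ∃ u', AreRelated B B' w w' u u' := by
  obtain ⟨X, X', H, hX, hH, h1, h2⟩ := B.exists_related_of_D_p_eq_zero B' hq hu
  exact ⟨X' w', X, X', fun _ => 0, H, hX, rfl,
    Filter.Eventually.of_forall fun y => smoothVFAt_zero y, hH, h1, h2⟩

theorem exists_areRelated_of_D_q_eq_zero (hp : B.p w = B'.p w') {u : W.T w} (hu : D B.q w u = 0) :
    ∃ u', AreRelated B B' w w' u u' := by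
  obtain ⟨X, X', H, hX, hH, h1, h2⟩ := B.swap.exists_related_of_D_p_eq_zero B'.swap hp hu
  exact ⟨X' w', X, X', H, fun _ => 0, hX, rfl, hH,
    Filter.Eventually.of_forall fun y => smoothVFAt_zero y,
    h1.mono fun x hx => ⟨hx.1, hx.2.2, hx.2.1⟩, h2.mono fun x hx => ⟨hx.1, hx.2.2, hx.2.1⟩⟩

theorem tangentAt_FW_le (B : BiSubmersion FM FN W) (w : W.Pt) : tangentAt B.FW w ≤
    (D B.p w : W.T w →ₗ[ℝ] M.T (B.p w)).ker ⊔ (D B.q w : W.T w →ₗ[ℝ] N.T (B.q w)).ker := by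
  refine Submodule.span_le.2 ?_
  rintro v ⟨U, V, hw, hV, rfl⟩
  obtain ⟨ξ, ζ, hξ, hζ, h⟩ := (B.pullback_eq_sum U V).1 hV
  rw [h w hw]
  exact Submodule.add_mem_sup (vertical_iff.1 hξ w hw).2 (vertical_iff.1 hζ w hw).2

/-- T F_W lies in ker Tp + ker Tq, and vectors of each kernel have related partners. This is what
lets flows fill the directions missing from a transverse map. -/
theorem tangentAt_FW_le_span_areRelated (hp : B.p w = B'.p w') (hq : B.q w = B'.q w') :
    tangentAt B.FW w ≤ Submodule.span ℝ {u | ∃ u', AreRelated B B' w w' u u'} :=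
  (tangentAt_FW_le B w).trans (sup_le
    (fun _ hu => Submodule.subset_span (exists_areRelated_of_D_p_eq_zero hq hu))
    (fun _ hu => Submodule.subset_span (exists_areRelated_of_D_q_eq_zero hp hu)))

/-- The two maps of a bi-submersion, in charts. -/
def projModel (B : BiSubmersion FM FN W) (m : M.Pt) (n : N.Pt) (w : W.Pt) :
    Model w → Model m × Model n := fun e => (mapToModel w m B.p e, mapToModel w n B.q e)

variable {m : M.Pt} {n : N.Pt}

theorem smoothNear_projModel (hp : B.p w ∈ chartDom m) (hq : B.q w ∈ chartDom n) :
    SmoothNear (B.projModel m n w) (toModel w w) :=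
  (smoothNear_mapToModel hp (Filter.Eventually.of_forall fun x => (B.submersion_p x).1)).prodMk
    (smoothNear_mapToModel hq (Filter.Eventually.of_forall fun x => (B.submersion_q x).1))

theorem projModel_toModel {x : W.Pt} (hx : x ∈ chartDom w) :
    B.projModel m n w (toModel w x) = (toModel m (B.p x), toModel n (B.q x)) :=
  Prod.ext (mapToModel_toModel hx) (mapToModel_toModel hx)

theorem eventually_fderiv_projModel (hp : B.p w ∈ chartDom m) (hq : B.q w ∈ chartDom n)
    {X : W.VField} {K : M.VField} {H : N.VField}
    (h : ∀ᶠ x in 𝓝 w, D B.p x (X x) = K (B.p x) ∧ D B.q x (X x) = H (B.q x)) :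
    ∀ᶠ e in 𝓝 (toModel w w), fderiv ℝ (B.projModel m n w) e (vfToModel w X e) =
      (vfToModel m K (B.projModel m n w e).1, vfToModel n H (B.projModel m n w e).2) := by
  have hw := mem_chartDom_self w
  have hpc := (IsSubmersion.continuous B.submersion_p).continuousAt (x := w)
  have hqc := (IsSubmersion.continuous B.submersion_q).continuousAt (x := w)
  filter_upwards [(tendsto_ofModel hw).eventually ((h.and (eventually_mem_chartDom hw)).and
    ((hpc.eventually (eventually_mem_chartDom hp)).and
      (hqc.eventually (eventually_mem_chartDom hq)))), eventually_mem_target hw]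
    with e ⟨⟨⟨h1, h2⟩, h3⟩, h4, h5⟩ h6
  generalize hx : ofModel w e = x' at *
  obtain rfl : e = toModel w x' := by rw [← hx, toModel_ofModel h6]
  rw [projModel_toModel h3]
  have a1 : DifferentiableAt ℝ (mapToModel w m B.p) (toModel w x') :=
    (contDiffAt_mapToModel h3 h4 (B.submersion_p x').1).differentiableAt (by simp)
  have a2 : DifferentiableAt ℝ (mapToModel w n B.q) (toModel w x') :=
    (contDiffAt_mapToModel h3 h5 (B.submersion_q x').1).differentiableAt (by simp)
  have a3 : fderiv ℝ (B.projModel m n w) (toModel w x') =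
      (fderiv ℝ (mapToModel w m B.p) (toModel w x')).prod
        (fderiv ℝ (mapToModel w n B.q) (toModel w x')) :=
    (a1.hasFDerivAt.prodMk a2.hasFDerivAt).fderiv
  rw [a3, vfToModel_toModel h3]
  refine Prod.ext ?_ ?_
  · change fderiv ℝ (mapToModel w m B.p) (toModel w x') _ = vfToModel m K (toModel m (B.p x'))
    rw [fderiv_mapToModel h3 h4 (B.submersion_p x').1, vfToModel_toModel h4, h1]
  · change fderiv ℝ (mapToModel w n B.q) (toModel w x') _ = vfToModel n H (toModel n (B.q x'))
    rw [fderiv_mapToModel h3 h5 (B.submersion_q x').1, vfToModel_toModel h5, h2]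

/-- Passage to charts: projecting to `M` and `N` separately becomes projecting to the product of the
two models, where the flow argument takes place. -/
theorem AreRelated.areRelatedVectors (hp : B.p w = B'.p w') (hq : B.q w = B'.q w') {u : W.T w}
    {u' : W'.T w'} (h : AreRelated B B' w w' u u') :
    AreRelatedVectors (B.projModel (B.p w) (B.q w) w) (B'.projModel (B.p w) (B.q w) w')
      (toModel w w) (toModel w' w') (dFun (toModel w) w u) (dFun (toModel w') w' u') := by
  obtain ⟨X, X', K, H, rfl, rfl, hK, hH, h1, h2⟩ := h
  have hw := mem_chartDom_self w
  have hw' := mem_chartDom_self w'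
  have hm := mem_chartDom_self (B.p w)
  have hn := mem_chartDom_self (B.q w)
  have hm' : B'.p w' ∈ chartDom (B.p w) := hp ▸ hm
  have hn' : B'.q w' ∈ chartDom (B.q w) := hq ▸ hn
  refine ⟨vfToModel w X, vfToModel w' X', fun e => (vfToModel (B.p w) K e.1, vfToModel (B.q w) H e.2),
    smoothNear_vfToModel hw (h1.mono fun x hx => hx.1),
    smoothNear_vfToModel hw' (h2.mono fun x hx => hx.1), ?_,
    eventually_fderiv_projModel hm hn (h1.mono fun x hx => hx.2),
    eventually_fderiv_projModel hm' hn' (h2.mono fun x hx => hx.2),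
    vfToModel_toModel hw X, vfToModel_toModel hw' X'⟩
  rw [projModel_toModel hw]
  exact (SmoothNear.comp (f := Prod.fst) (smoothNear_vfToModel hm hK) contDiff_fst.smoothNear).prodMk
    (SmoothNear.comp (f := Prod.snd) (smoothNear_vfToModel hn hH) contDiff_snd.smoothNear)

end Related

/-- Points that are attained by a pair of maps that are submersions at a point and commute with the
projections are equivalent. -/
theorem equivPoints_of_submersions (B : BiSubmersion FM FN W) (B' : BiSubmersion FM FN W')
    {δ : Z.Pt → W.Pt} {η : Z.Pt → W'.Pt} {z : Z.Pt} (hδ : ∀ᶠ y in 𝓝 z, SmoothMapAt δ y)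
    (hη : ∀ᶠ y in 𝓝 z, SmoothMapAt η y) (hδs : Function.Surjective (D δ z))
    (hηs : Function.Surjective (D η z)) (hp : ∀ᶠ y in 𝓝 z, B.p (δ y) = B'.p (η y))
    (hq : ∀ᶠ y in 𝓝 z, B.q (δ y) = B'.q (η y)) : B.EquivPoints B' (δ z) (η z) := by
  obtain ⟨A, hz, hA⟩ := exists_opens_of_eventually
    (((hδ.and hη).eventually_nhds.and
      ((eventually_surjective_D hδ hδs).and (eventually_surjective_D hη hηs))).and (hp.and hq))
  -- After shrinking to `A`, local sections show that the images are open, so the maps restricted to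
  -- `A` are submersions onto open sets; the open submanifold on `A` serves as the relation.
  have hopen : ∀ {Y : SmoothMfd.{u}} (f : Z.Pt → Y.Pt),
      (∀ y ∈ A, (∀ᶠ x in 𝓝 y, SmoothMapAt f x) ∧ Function.Surjective (D f y)) →
      IsOpen (f '' A) ∧ IsSubmersion (f ∘ incl A) ∧ Set.range (f ∘ incl A) = f '' A := by
    intro Y f hf
    refine ⟨?_, fun s => ⟨?_, ?_⟩, ?_⟩
    · rw [isOpen_iff_mem_nhds]
      rintro _ ⟨y, hy, rfl⟩
      obtain ⟨σ, hσ, hσ'⟩ := exists_section (hf y hy).1 (hf y hy).2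
      have h1 : ∀ᶠ x in 𝓝 (f y), σ x ∈ A := by
        refine hσ'.self_of_nhds.1.1.eventually ?_
        rw [hσ]
        exact Opens.eventually_mem hy
      filter_upwards [hσ', h1] with x h2 h3 using ⟨σ x, h3, h2.2⟩
    · exact SmoothMapAt.comp (hf _ (incl_mem A s)).1.self_of_nhds (smoothMapAt_incl A s)
    · intro v
      obtain ⟨a, rfl⟩ := (hf _ (incl_mem A s)).2 v
      obtain ⟨b, rfl⟩ := (bijective_D_incl A s).2 a
      exact ⟨b, D_comp (hf _ (incl_mem A s)).1.self_of_nhds (smoothMapAt_incl A s) b⟩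
    · ext x
      constructor
      · rintro ⟨s, rfl⟩
        exact ⟨_, incl_mem A s, rfl⟩
      · rintro ⟨y, hy, rfl⟩
        exact ⟨restrictMk y hy, rfl⟩
  obtain ⟨o1, s1, r1⟩ := hopen δ fun y hy => ⟨(hA y hy).1.1.mono fun _ h => h.1, (hA y hy).1.2.1⟩
  obtain ⟨o2, s2, r2⟩ := hopen η fun y hy => ⟨(hA y hy).1.1.mono fun _ h => h.2, (hA y hy).1.2.2⟩
  exact ⟨⟨δ '' A, o1⟩, ⟨η '' A, o2⟩, ⟨z, hz, rfl⟩, ⟨z, hz, rfl⟩, Z.restrict A, δ ∘ incl A, η ∘ incl A,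
    ⟨s1, s2, r1, r2, fun s => (hA _ (incl_mem A s)).2.1, fun s => (hA _ (incl_mem A s)).2.2⟩,
    restrictMk z hz, rfl, rfl⟩

/-- A map from a vector space to a manifold, given in a chart. -/
theorem eventually_smoothMapAt_ofModel_euclidean {d : ℕ} {w : W.Pt} {e₀ : EuclideanSpace ℝ (Fin d)}
    {h : EuclideanSpace ℝ (Fin d) → Model w} (hs : SmoothNear h e₀) (h0 : h e₀ = toModel w w) :
    (∀ᶠ z in 𝓝 (euclideanPoint.{u} e₀),
      SmoothMapAt (fun z => ofModel w (h (toModel (euclideanPoint e₀) z))) z) ∧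
    ∀ v, dFun (toModel w) (ofModel w (h (toModel (euclideanPoint e₀) (euclideanPoint e₀))))
      (D (fun z => ofModel w (h (toModel (euclideanPoint e₀) z))) (euclideanPoint.{u} e₀) v) =
        fderiv ℝ h e₀ (dFun (toModel (euclideanPoint e₀)) (euclideanPoint e₀) v) := by
  have hd := mem_chartDom_self (euclideanPoint.{u} e₀)
  have he := toModel_euclideanPoint.{u} e₀ e₀
  refine ⟨eventually_smoothMapAt_ofModel (x₀ := euclideanPoint.{u} e₀) (he.symm ▸ hs)
    (he.symm ▸ h0), fun v => ?_⟩
  have hs' : ContDiffAt ℝ ∞ h (toModel (euclideanPoint.{u} e₀) (euclideanPoint e₀)) :=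
    he.symm ▸ hs.contDiffAt
  have h1 : SmoothFunAt (fun z => h (toModel (euclideanPoint.{u} e₀) z)) (euclideanPoint e₀) :=
    SmoothFunAt.comp_contDiffAt (φ := h) hs' (smoothFunAt_toModel hd)
  rw [dFun_toModel_D_ofModel h1, dFun_comp_contDiffAt (φ := h) (hs'.differentiableAt (by simp))
    (smoothFunAt_toModel hd)]
  · exact DFunLike.congr_fun (congrArg (fderiv ℝ h) he) _
  rw [he, h0]
  exact toModel_mem_target (mem_chartDom_self w)

/-- Pairs of maps with equal projections, transverse to the foliations, relate equivalent points. -/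
theorem equivPoints_of_maps (B : BiSubmersion FM FN W) (B' : BiSubmersion FM FN W')
    {ι : Z.Pt → W.Pt} {ι' : Z.Pt → W'.Pt} {s₀ : Z.Pt} (hι : ∀ᶠ s in 𝓝 s₀, SmoothMapAt ι s)
    (hι' : ∀ᶠ s in 𝓝 s₀, SmoothMapAt ι' s) (hp : ∀ᶠ s in 𝓝 s₀, B.p (ι s) = B'.p (ι' s))
    (hq : ∀ᶠ s in 𝓝 s₀, B.q (ι s) = B'.q (ι' s))
    (ht : (D ι s₀ : Z.T s₀ →ₗ[ℝ] W.T (ι s₀)).range ⊔ tangentAt B.FW (ι s₀) = ⊤)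
    (ht' : (D ι' s₀ : Z.T s₀ →ₗ[ℝ] W'.T (ι' s₀)).range ⊔ tangentAt B'.FW (ι' s₀) = ⊤) :
    B.EquivPoints B' (ι s₀) (ι' s₀) := by
  set m := B.p (ι s₀) with hm
  set n := B.q (ι s₀) with hn
  have hp0 : B.p (ι s₀) = B'.p (ι' s₀) := hp.self_of_nhds
  have hq0 : B.q (ι s₀) = B'.q (ι' s₀) := hq.self_of_nhds
  have hmd : B.p (ι s₀) ∈ chartDom m := mem_chartDom_self _
  have hnd : B.q (ι s₀) ∈ chartDom n := mem_chartDom_self _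
  have hmd' : B'.p (ι' s₀) ∈ chartDom m := hp0 ▸ hmd
  have hnd' : B'.q (ι' s₀) ∈ chartDom n := hq0 ▸ hnd
  have hs := mem_chartDom_self s₀
  have hw := mem_chartDom_self (ι s₀)
  have hw' := mem_chartDom_self (ι' s₀)
  have hπ := smoothNear_projModel (B := B) hmd hnd
  have hπ' := smoothNear_projModel (B := B') hmd' hnd'
  -- The pair (ι, ι') read in charts is the initial relation; it attains the ranges of the two
  -- differentials.
  have hgerm : HasRelationGerm (B.projModel m n (ι s₀)) (B'.projModel m n (ι' s₀))
      (toModel (ι s₀) (ι s₀)) (toModel (ι' s₀) (ι' s₀))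
      (fderiv ℝ (mapToModel s₀ (ι s₀) ι) (toModel s₀ s₀) : Model s₀ →ₗ[ℝ] Model (ι s₀)).range
      (fderiv ℝ (mapToModel s₀ (ι' s₀) ι') (toModel s₀ s₀) : Model s₀ →ₗ[ℝ] Model (ι' s₀)).range := by
    refine ⟨Model s₀, inferInstance, inferInstance, inferInstance, _, _, toModel s₀ s₀,
      smoothNear_mapToModel hw hι, smoothNear_mapToModel hw' hι', mapToModel_toModel hs,
      mapToModel_toModel hs, ?_, le_rfl, le_rfl⟩
    filter_upwards [(tendsto_ofModel hs).eventually ((hp.and hq).and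
      ((hι.self_of_nhds.1.eventually (eventually_mem_chartDom hw)).and
        (hι'.self_of_nhds.1.eventually (eventually_mem_chartDom hw'))))] with e ⟨⟨h1, h2⟩, h3, h4⟩
    rw [mapToModel, mapToModel, projModel_toModel h3, projModel_toModel h4, h1, h2]
  -- Transversality in charts: what the differential of the given map misses lies in the span of the
  -- related vectors. Stated for an abstract pair so that it serves both sides.
  have hspan : ∀ {W₁ W₂ : SmoothMfd.{u}} {B₁ : BiSubmersion FM FN W₁} {B₂ : BiSubmersion FM FN W₂}
      {j : Z.Pt → W₁.Pt} {w₂ : W₂.Pt} (P : Model (j s₀) → Prop), B₁.p (j s₀) = B₂.p w₂ →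
      B₁.q (j s₀) = B₂.q w₂ → SmoothMapAt j s₀ →
      (D j s₀ : Z.T s₀ →ₗ[ℝ] W₁.T (j s₀)).range ⊔ tangentAt B₁.FW (j s₀) = ⊤ →
      (∀ u u', AreRelated B₁ B₂ (j s₀) w₂ u u' → P (dFun (toModel (j s₀)) (j s₀) u)) →
      (fderiv ℝ (mapToModel s₀ (j s₀) j) (toModel s₀ s₀) : Model s₀ →ₗ[ℝ] Model (j s₀)).range ⊔
        Submodule.span ℝ {v | P v} = ⊤ := by
    intro W₁ W₂ B₁ B₂ j w₂ P hp1 hq1 hj ht1 hP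
    have hj0 := mem_chartDom_self (j s₀)
    rw [eq_top_iff]
    rintro a -
    obtain ⟨v, rfl⟩ := (dFun_toModel_bijective hj0).2 a
    obtain ⟨_, ⟨b, rfl⟩, t, ht, rfl⟩ := Submodule.mem_sup.1 (ht1.symm ▸ Submodule.mem_top : v ∈ _)
    rw [map_add]
    refine Submodule.add_mem_sup ⟨dFun (toModel s₀) s₀ b, fderiv_mapToModel hs hj0 hj b⟩ ?_
    have h1 := tangentAt_FW_le_span_areRelated hp1 hq1 ht
    have h2 : Submodule.span ℝ {u | ∃ u', AreRelated B₁ B₂ (j s₀) w₂ u u'} ≤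
        (Submodule.span ℝ {v | P v}).comap
          (dFun (toModel (j s₀)) (j s₀) : W₁.T (j s₀) →ₗ[ℝ] Model (j s₀)) := by
      refine Submodule.span_le.2 ?_
      rintro u ⟨u', hu⟩
      exact Submodule.subset_span (hP u u' hu)
    exact h2 h1
  obtain ⟨V, _, _, _, δ, η, v₀, hδ, hη, hδ0, hη0, hcomm, hδs, hηs⟩ := hgerm.extend hπ hπ'
    (hspan _ hp0 hq0 hι.self_of_nhds ht fun u u' hu => ⟨_, hu.areRelatedVectors hp0 hq0⟩)
    (hspan _ hp0.symm hq0.symm hι'.self_of_nhds ht' fun u u' hu =>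
      ⟨_, (hu.symm hp0.symm hq0.symm).areRelatedVectors hp0 hq0⟩)
  -- The extended relation is parametrized by an abstract vector space; it is moved to a piece of
  -- `euclideanSpaces`, which lives in the right universe, to become a relation of manifolds.
  set T : V ≃L[ℝ] EuclideanSpace ℝ (Fin (Module.finrank ℝ V)) := toEuclidean
  have hT0 : T.symm (T v₀) = v₀ := T.symm_apply_apply v₀
  have hcomp : ∀ {W₁ : SmoothMfd.{u}} {w₁ : W₁.Pt} {δ : V → Model w₁}, SmoothNear δ v₀ →
      δ v₀ = toModel w₁ w₁ → ⊤ ≤ (fderiv ℝ δ v₀ : V →ₗ[ℝ] Model w₁).range →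
      SmoothNear (fun e => δ (T.symm e)) (T v₀) ∧ δ (T.symm (T v₀)) = toModel w₁ w₁ ∧
      Function.Surjective (fderiv ℝ (fun e => δ (T.symm e)) (T v₀)) := by
    intro W₁ w₁ δ hδ hδ0 hδs
    refine ⟨SmoothNear.comp_of_eq hδ T.symm.contDiff.smoothNear hT0, by rw [hT0, hδ0], fun v => ?_⟩
    obtain ⟨a, ha⟩ := hδs (Submodule.mem_top : v ∈ ⊤)
    have h1 : HasFDerivAt δ (fderiv ℝ δ v₀) (T.symm (T v₀)) := by
      rw [hT0]; exact hδ.differentiableAt.hasFDerivAt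
    have h2 := h1.comp (T v₀) T.symm.hasFDerivAt
    refine ⟨T a, ?_⟩
    have h3 : fderiv ℝ (fun e => δ (T.symm e)) (T v₀) = _ := h2.fderiv
    rw [h3]
    simpa using ha
  have hz := mem_chartDom_self (euclideanPoint.{u} (T v₀))
  have hz0 := toModel_euclideanPoint.{u} (T v₀) (T v₀)
  have hsub : ∀ {W₁ : SmoothMfd.{u}} {w₁ : W₁.Pt} {δ : V → Model w₁}, SmoothNear δ v₀ →
      δ v₀ = toModel w₁ w₁ → ⊤ ≤ (fderiv ℝ δ v₀ : V →ₗ[ℝ] Model w₁).range →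
      ∃ δ₁ : euclideanSpaces.{u}.Pt → W₁.Pt,
        (∀ z, δ₁ z = ofModel w₁ (δ (T.symm (toModel (euclideanPoint (T v₀)) z)))) ∧
        δ₁ (euclideanPoint (T v₀)) = w₁ ∧
        (∀ᶠ z in 𝓝 (euclideanPoint (T v₀)), SmoothMapAt δ₁ z) ∧
        Function.Surjective (D δ₁ (euclideanPoint (T v₀))) := by
    intro W₁ w₁ δ hδ hδ0 hδs
    obtain ⟨a1, a2, a3⟩ := hcomp hδ hδ0 hδs
    obtain ⟨b1, b2⟩ := eventually_smoothMapAt_ofModel_euclidean.{u} a1 a2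
    have h0 : ofModel w₁ (δ (T.symm (toModel (euclideanPoint.{u} (T v₀)) (euclideanPoint (T v₀))))) =
        w₁ := by
      rw [hz0, a2, ofModel_toModel (mem_chartDom_self w₁)]
    refine ⟨_, fun z => rfl, h0, b1, fun v => ?_⟩
    have hd : ofModel w₁ (δ (T.symm (toModel (euclideanPoint.{u} (T v₀)) (euclideanPoint (T v₀))))) ∈
        chartDom w₁ := h0.symm ▸ mem_chartDom_self w₁
    obtain ⟨a, ha⟩ := a3 (dFun (toModel w₁) _ v)
    obtain ⟨b, rfl⟩ := (dFun_toModel_bijective hz).2 a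
    exact ⟨b, dFun_toModel_injective hd ((b2 b).trans ha)⟩
  obtain ⟨δ₁, d1, d2, d3, d4⟩ := hsub hδ hδ0 hδs
  obtain ⟨η₁, e1, e2, e3, e4⟩ := hsub hη hη0 hηs
  have hev : ∀ᶠ z in 𝓝 (euclideanPoint.{u} (T v₀)), B.p (δ₁ z) = B'.p (η₁ z) ∧
      B.q (δ₁ z) = B'.q (η₁ z) := by
    have c1 : Filter.Tendsto (fun z => T.symm (toModel (euclideanPoint.{u} (T v₀)) z))
        (𝓝 (euclideanPoint (T v₀))) (𝓝 v₀) := by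
      have h1 := tendsto_toModel hz
      rw [hz0] at h1
      have h2 := (T.symm.continuous.tendsto (T v₀)).comp h1
      rwa [hT0] at h2
    have hc : ∀ {Y W₁ : SmoothMfd.{u}} {f : W₁.Pt → Y.Pt} {g : euclideanSpaces.{u}.Pt → W₁.Pt}
        {w₁ : W₁.Pt} {y : Y.Pt}, g (euclideanPoint (T v₀)) = w₁ → Continuous f →
        ContinuousAt g (euclideanPoint (T v₀)) → f w₁ ∈ chartDom y →
        ∀ᶠ z in 𝓝 (euclideanPoint.{u} (T v₀)), f (g z) ∈ chartDom y := by
      rintro Y W₁ f g _ y rfl hf hg hy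
      exact (hf.continuousAt.comp hg).eventually (eventually_mem_chartDom hy)
    have ht1 : ∀ᶠ v in 𝓝 v₀,
        δ v ∈ (chartAt (EuclideanSpace ℝ (Fin (ι s₀).1)) (ι s₀).2).target := by
      refine hδ.continuousAt.eventually ?_
      rw [hδ0]
      exact eventually_mem_target hw
    have ht2 : ∀ᶠ v in 𝓝 v₀,
        η v ∈ (chartAt (EuclideanSpace ℝ (Fin (ι' s₀).1)) (ι' s₀).2).target := by
      refine hη.continuousAt.eventually ?_
      rw [hη0]
      exact eventually_mem_target hw'
    have hpc := IsSubmersion.continuous B.submersion_p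
    have hqc := IsSubmersion.continuous B.submersion_q
    have hpc' := IsSubmersion.continuous B'.submersion_p
    have hqc' := IsSubmersion.continuous B'.submersion_q
    filter_upwards [c1.eventually (hcomm.and (ht1.and ht2)),
      hc d2 hpc d3.self_of_nhds.1 hmd, hc d2 hqc d3.self_of_nhds.1 hnd,
      hc e2 hpc' e3.self_of_nhds.1 hmd', hc e2 hqc' e3.self_of_nhds.1 hnd']
      with z ⟨f1, f2, f3⟩ f4 f5 f6 f7
    simp only [projModel, mapToModel, ← d1, ← e1, Prod.mk.injEq] at f1
    exact ⟨toModel_injOn f4 f6 f1.1, toModel_injOn f5 f7 f1.2⟩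
  have hfin := equivPoints_of_submersions B B' d3 e3 d4 e4 (hev.mono fun _ h => h.1)
    (hev.mono fun _ h => h.2)
  rwa [d2, e2] at hfin

end BiSubmersion

/-! ### Transversals -/

section LinearAlgebra

variable {E F : Type*} [AddCommGroup E] [Module ℝ E] [AddCommGroup F] [Module ℝ F] {f : E →ₗ[ℝ] F}
  {R : Submodule ℝ E} {T : Submodule ℝ F}

/-- The preimage of `T` contains the kernel of `f`, so transversality can be tested upstairs or
downstairs. -/
theorem sup_comap_eq_top_iff (hf : Function.Surjective f) :
    R ⊔ T.comap f = ⊤ ↔ R.map f ⊔ T = ⊤ := by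
  constructor
  · intro h
    rw [eq_top_iff, ← LinearMap.range_eq_top.2 hf, LinearMap.range_eq_map, ← h, Submodule.map_sup]
    exact sup_le_sup_left (Submodule.map_comap_le _ _) _
  · intro h
    rw [eq_top_iff]
    rintro v -
    obtain ⟨_, ⟨r, hr, rfl⟩, t, ht, htv⟩ := Submodule.mem_sup.1 (h.symm ▸ Submodule.mem_top : f v ∈ _)
    refine Submodule.mem_sup.2 ⟨r, hr, v - r, ?_, by abel⟩
    rw [Submodule.mem_comap, map_sub, ← htv, add_sub_cancel_left]
    exact ht

theorem isCompl_map_of_isCompl_comap (hf : Function.Surjective f) (h : IsCompl R (T.comap f)) :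
    IsCompl (R.map f) T := by
  refine ⟨?_, codisjoint_iff.2 ((sup_comap_eq_top_iff hf).1 h.sup_eq_top)⟩
  rw [Submodule.disjoint_def]
  rintro _ ⟨r, hr, rfl⟩ ht
  rw [Submodule.disjoint_def.1 h.disjoint r hr ht, map_zero]

theorem isCompl_comap_of_isCompl_map (hf : Function.Surjective f) (hR : ∀ r ∈ R, f r = 0 → r = 0)
    (h : IsCompl (R.map f) T) : IsCompl R (T.comap f) := by
  refine ⟨?_, codisjoint_iff.2 ((sup_comap_eq_top_iff hf).2 h.sup_eq_top)⟩
  rw [Submodule.disjoint_def]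
  exact fun r hr ht => hR r hr (Submodule.disjoint_def.1 h.disjoint _ ⟨r, hr, rfl⟩ ht)

theorem injective_and_range_eq_of_comp_eq {V P : Type*} [AddCommGroup V] [Module ℝ V]
    [AddCommGroup P] [Module ℝ P] {A : V →ₗ[ℝ] E} {d : E →ₗ[ℝ] P} (hd : Function.Injective d)
    (e : V ≃ₗ[ℝ] R.map d) (h : ∀ v, d (A v) = e v) : Function.Injective A ∧ A.range = R := by
  refine ⟨fun v v' hv => e.injective (Subtype.ext ?_), le_antisymm ?_ fun c hc => ?_⟩
  · rw [← h, ← h, hv]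
  · rintro _ ⟨v, rfl⟩
    obtain ⟨c, hc, hcv⟩ := (e v).2
    exact hd (hcv.trans (h v).symm) ▸ hc
  · refine ⟨e.symm ⟨d c, c, hc, rfl⟩, hd ?_⟩
    rw [h, e.apply_symm_apply]

end LinearAlgebra

/-- Continuity of `g` is only required at points of the image of `f`, as for the local left inverse
of an immersion. -/
theorem isEmbedding_of_continuousAt {A B C : Type*} [TopologicalSpace A] [TopologicalSpace B]
    [TopologicalSpace C] {f : A → B} {g : B → C} (hf : Continuous f) (hg : ∀ a, ContinuousAt g (f a))
    (h : Topology.IsEmbedding (g ∘ f)) : Topology.IsEmbedding f := by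
  refine ⟨Topology.isInducing_iff_nhds.2 fun a => le_antisymm hf.continuousAt.tendsto.le_comap ?_,
    h.injective.of_comp⟩
  rw [h.isInducing.nhds_eq_comap a, ← Filter.comap_comap]
  exact Filter.comap_mono (hg a).tendsto.le_comap

namespace SmoothMfd

variable {X Y Z : SmoothMfd.{u}}

theorem range_D_comp {f : X.Pt → Y.Pt} {g : Y.Pt → Z.Pt} {x : X.Pt} (hg : SmoothMapAt g (f x))
    (hf : SmoothMapAt f x) : (D (g ∘ f) x : X.T x →ₗ[ℝ] Z.T ((g ∘ f) x)).range =
      (D f x : X.T x →ₗ[ℝ] Y.T (f x)).range.map (D g (f x) : Y.T (f x) →ₗ[ℝ] Z.T (g (f x))) := by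
  ext v
  constructor
  · rintro ⟨a, rfl⟩
    exact ⟨_, ⟨a, rfl⟩, (D_comp hg hf a).symm⟩
  · rintro ⟨_, ⟨a, rfl⟩, rfl⟩
    exact ⟨a, D_comp hg hf a⟩

theorem injective_D_of_leftInverse {f : X.Pt → Y.Pt} {r : Y.Pt → X.Pt} {x : X.Pt}
    (hf : SmoothMapAt f x) (hr : SmoothMapAt r (f x)) (h : ∀ᶠ z in 𝓝 x, r (f z) = z) :
    Function.Injective (D f x) := by
  have hx := mem_chartDom_self x
  have hm : SmoothFunAt (toModel x) (r (f x)) := by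
    rw [h.self_of_nhds]
    exact smoothFunAt_toModel hx
  have key : ∀ v, dFun (toModel x) x v = dFun (fun y => toModel x (r y)) (f x) (D f x v) := by
    intro v
    rw [← dFun_comp (g := fun y => toModel x (r y)) (hm.comp hr) hf]
    exact DFunLike.congr_fun (dFun_congr (h.mono fun z hz => by rw [hz])) v
  intro v v' hv
  exact (dFun_toModel_bijective hx).1 (by rw [key, key, hv])

/-- Transversality to a foliation is an open condition. -/
theorem eventually_range_D_sup_tangentAt {f : X.Pt → Y.Pt} {F : SingularFoliation Y} {x : X.Pt}
    (hf : ∀ᶠ z in 𝓝 x, SmoothMapAt f z)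
    (h : (D f x : X.T x →ₗ[ℝ] Y.T (f x)).range ⊔ tangentAt F.Mem (f x) = ⊤) :
    ∀ᶠ z in 𝓝 x, (D f z : X.T z →ₗ[ℝ] Y.T (f z)).range ⊔ tangentAt F.Mem (f z) = ⊤ := by
  have hx := mem_chartDom_self x
  have hy := mem_chartDom_self (f x)
  set b : Fin (f x).1 → Model (f x) := fun k => EuclideanSpace.single k 1 with hb
  -- Each basis vector is written at `x` as an image vector plus the value of a local section.
  -- Continued to nearby points, these sums define a family of endomorphisms `L` that is the
  -- identity at `x`, hence onto nearby.
  have h1 : ∀ k, ∃ (a : X.T x) (O : Opens Y.Pt) (G : Y.VField), f x ∈ O ∧ F.Mem O G ∧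
      dFun (toModel (f x)) (f x) (D f x a + G (f x)) = b k := by
    intro k
    obtain ⟨v, hv⟩ := (dFun_toModel_bijective hy).2 (b k)
    obtain ⟨_, ⟨a, rfl⟩, t, ht, htv⟩ := Submodule.mem_sup.1 (h.symm ▸ Submodule.mem_top : v ∈ _)
    obtain ⟨O, G, hO, hG, rfl⟩ := F.mem_tangentAt_iff.1 ht
    exact ⟨a, O, G, hO, hG, hv ▸ congrArg _ htv⟩
  choose a O G hO hG hab using h1
  set φ := mapToModel x (f x) f
  have hφ : SmoothNear φ (toModel x x) := smoothNear_mapToModel hy hf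
  set B : Model x → Fin (f x).1 → Model (f x) := fun e k =>
    fderiv ℝ φ e (dFun (toModel x) x (a k)) + vfToModel (f x) (G k) (φ e) with hB
  set L : Model x → Model (f x) →L[ℝ] Model (f x) := fun e =>
    ∑ k, ContinuousLinearMap.smulRightL ℝ _ _ (EuclideanSpace.proj (𝕜 := ℝ) k) (B e k) with hL
  have hLa : ∀ e v, L e v = ∑ k, v k • B e k := by
    intro e v
    simp [hL]
  have hφx : φ (toModel x x) = toModel (f x) (f x) := mapToModel_toModel hx
  have hBc : ∀ k, ContinuousAt (fun e => B e k) (toModel x x) := by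
    intro k
    refine ContinuousAt.add (hφ.fderiv.continuousAt.clm_apply continuousAt_const) ?_
    refine ContinuousAt.comp (g := vfToModel (f x) (G k)) ?_ hφ.continuousAt
    rw [hφx]
    exact (contDiffAt_vfToModel hy (F.smoothVFAt (hG k) (hO k))).continuousAt
  have hLc : ContinuousAt L (toModel x x) := by
    refine tendsto_finsetSum _ fun k _ => ?_
    exact (ContinuousLinearMap.continuous _).continuousAt.comp (hBc k)
  have hL0 : L (toModel x x) =
      ((ContinuousLinearEquiv.refl ℝ (Model (f x)) : Model (f x) ≃L[ℝ] Model (f x)) :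
        Model (f x) →L[ℝ] Model (f x)) := by
    refine ContinuousLinearMap.ext fun v => ?_
    have h2 : ∀ k, B (toModel x x) k = b k := by
      intro k
      simp only [hB]
      rw [fderiv_mapToModel hx hy hf.self_of_nhds, hφx, vfToModel_toModel hy, ← map_add, hab]
    rw [hLa]
    simp only [h2]
    ext j
    simp [hb, Pi.single_apply]
  have hev := hLc (hL0 ▸ (ContinuousLinearEquiv.refl ℝ (Model (f x))).nhds)
  filter_upwards [(tendsto_toModel hx).eventually hev, hf, eventually_mem_chartDom hx,
    hf.self_of_nhds.1.eventually (eventually_mem_chartDom hy),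
    Filter.eventually_all.2 fun k => hf.self_of_nhds.1.eventually (Opens.eventually_mem (hO k))]
    with z ⟨e, he⟩ h2 h3 h4 h5
  rw [eq_top_iff]
  rintro v -
  set c := e.symm (dFun (toModel (f x)) (f z) v)
  have h6 : L (toModel x z) c = dFun (toModel (f x)) (f z) v := by
    rw [← he]
    exact e.apply_symm_apply _
  choose a' ha' using fun k => (dFun_toModel_bijective h3).2 (dFun (toModel x) x (a k))
  have h7 : v = ∑ k, c k • (D f z (a' k) + G k (f z)) := by
    refine dFun_toModel_injective h4 ?_
    rw [← h6, hLa]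
    simp only [map_sum, map_smul, map_add]
    refine Finset.sum_congr rfl fun k _ => ?_
    rw [← fderiv_mapToModel h3 h4 h2, ha' k]
    simp only [hB]
    rw [show φ (toModel x z) = toModel (f x) (f z) from mapToModel_toModel h3, vfToModel_toModel h4]
  rw [h7]
  exact Submodule.sum_mem _ fun k _ => Submodule.smul_mem _ _ (Submodule.add_mem_sup ⟨a' k, rfl⟩
    (Submodule.subset_span ⟨O k, G k, h5 k, hG k, rfl⟩))

end SmoothMfd

/-! ### Bi-transversals, local morphisms and equivalent points -/

namespace BiSubmersion

variable {M N W W' S X Y : SmoothMfd.{u}} {FM : SingularFoliation M} {FN : SingularFoliation N}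

/-- There are immersed submanifolds with a given linear parametrization to first order. -/
theorem exists_immersion_dFun_eq {d : ℕ} {w : Y.Pt} (L : EuclideanSpace ℝ (Fin d) →L[ℝ] Model w) :
    ∃ (Z : SmoothMfd.{u}) (j : Z.Pt → Y.Pt) (z : Z.Pt) (e : Z.T z ≃ₗ[ℝ] EuclideanSpace ℝ (Fin d)),
      (∀ᶠ y in 𝓝 z, SmoothMapAt j y) ∧ j z = w ∧
      ∀ v, dFun (toModel w) (j z) (D j z v) = L (e v) := by
  have h1 : ContDiff ℝ ∞ (fun e => toModel w w + L e) := contDiff_const.add L.contDiff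
  have h0 : toModel w w + L 0 = toModel w w := by rw [map_zero, add_zero]
  obtain ⟨a1, a2⟩ := eventually_smoothMapAt_ofModel_euclidean.{u} (h1.smoothNear (x := 0)) h0
  have hfd : fderiv ℝ (fun e => toModel w w + L e) 0 = L := (L.hasFDerivAt.const_add _).fderiv
  rw [hfd] at a2
  have hb := dFun_toModel_bijective
    (mem_chartDom_self (euclideanPoint.{u} (0 : EuclideanSpace ℝ (Fin d))))
  refine ⟨_, _, _, LinearEquiv.ofBijective (ContinuousLinearMap.toLinearMap _) hb, a1, ?_, a2⟩
  rw [toModel_euclideanPoint.{u}, h0, ofModel_toModel (mem_chartDom_self w)]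

/-- There are immersed submanifolds with a given tangent space at a point. -/
theorem exists_immersion_range_eq {w : Y.Pt} (R : Submodule ℝ (Y.T w)) :
    ∃ (Z : SmoothMfd.{u}) (j : Z.Pt → Y.Pt) (z : Z.Pt) (_ : ∀ᶠ y in 𝓝 z, SmoothMapAt j y)
      (h : j z = w), Function.Injective (D j z) ∧
      (D j z : Z.T z →ₗ[ℝ] Y.T (j z)).range = h ▸ R := by
  set C := R.map (dFun (toModel w) w : Y.T w →ₗ[ℝ] Model w)
  set T : C ≃L[ℝ] EuclideanSpace ℝ (Fin (Module.finrank ℝ C)) := toEuclidean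
  obtain ⟨Z, j, z, e, hj, hjz, he⟩ := exists_immersion_dFun_eq (w := w) (C.subtypeL.comp
    (T.symm : EuclideanSpace ℝ (Fin (Module.finrank ℝ C)) →L[ℝ] C))
  refine ⟨Z, j, z, hj, hjz, ?_⟩
  subst hjz
  exact injective_and_range_eq_of_comp_eq (A := (D j z : Z.T z →ₗ[ℝ] Y.T (j z)))
    (fun _ _ => dFun_toModel_injective (mem_chartDom_self _)) (e.trans T.symm.toLinearEquiv) he

/-- An immersion that is transverse to a foliation at a point is a transverse embedding near that
point. -/
theorem exists_isTransverseEmbeddingOn {f : X.Pt → Y.Pt} {F : SingularFoliation Y} {x : X.Pt}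
    (hf : ∀ᶠ z in 𝓝 x, SmoothMapAt f z) (hi : Function.Injective (D f x))
    (h : IsCompl (D f x : X.T x →ₗ[ℝ] Y.T (f x)).range (tangentAt F.Mem (f x))) :
    ∃ A, IsTransverseEmbeddingOn f F x A := by
  -- The local left inverse yields both the topological embedding and injectivity of the
  -- differential at all points of `A`.
  obtain ⟨r, hr, hrf⟩ := exists_leftInverse hf hi
  obtain ⟨A, hx, hA⟩ := exists_opens_of_eventually
    ((hf.and (hf.self_of_nhds.1.eventually hr)).and (hrf.eventually_nhds.and
      (eventually_range_D_sup_tangentAt hf h.sup_eq_top)))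
  refine ⟨A, hx, ?_, fun s hs => ⟨(hA s hs).1.1, injective_D_of_leftInverse (hA s hs).1.1
    (hA s hs).1.2 (hA s hs).2.1⟩, fun s hs => (hA s hs).2.2, h⟩
  refine isEmbedding_of_continuousAt (g := r) ?_ (fun s => (hA s s.2).1.2.1) ?_
  · exact continuous_iff_continuousAt.2 fun s =>
      ContinuousAt.comp (g := f) (hA s s.2).1.1.1 continuous_subtype_val.continuousAt
  · convert Topology.IsEmbedding.subtypeVal (p := (· ∈ A)) using 1
    funext s
    exact (hA s s.2).2.1.self_of_nhds

theorem IsTransverseEmbeddingOn.restrict {f : X.Pt → Y.Pt} {F : SingularFoliation Y} {x : X.Pt}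
    {A A' : Opens X.Pt} (h : IsTransverseEmbeddingOn f F x A') (hA : A ≤ A') (hx : x ∈ A) :
    IsTransverseEmbeddingOn (f ∘ incl A) F (restrictMk x hx) ⊤ := by
  have hs : ∀ s, SmoothMapAt f (incl A s) := fun s => (h.immersion _ (hA (incl_mem A s))).1
  have hrange : ∀ s, (D (f ∘ incl A) s : (X.restrict A).T s →ₗ[ℝ] Y.T ((f ∘ incl A) s)).range =
      (D f (incl A s) : X.T (incl A s) →ₗ[ℝ] Y.T (f (incl A s))).range := by
    intro s
    rw [range_D_comp (hs s) (smoothMapAt_incl A s), LinearMap.range_eq_top.2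
      (bijective_D_incl A s).2, ← LinearMap.range_eq_map]
  refine ⟨trivial, ?_, fun s _ => ⟨(hs s).comp (smoothMapAt_incl A s), fun v v' hv => ?_⟩,
    fun s _ => ?_, ?_⟩
  · have h1 : Topology.IsEmbedding fun s : (⊤ : Opens (X.restrict A).Pt) =>
        (⟨incl A s, hA (incl_mem A s)⟩ : A') :=
      ((isOpenEmbedding_incl A).isEmbedding.comp Topology.IsEmbedding.subtypeVal).codRestrict A' _
    exact h.embedding.comp h1
  · have h1 := D_comp (hs s) (smoothMapAt_incl A s) v
    have h2 := D_comp (hs s) (smoothMapAt_incl A s) v'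
    exact (bijective_D_incl A s).1 ((h.immersion _ (hA (incl_mem A s))).2
      (h1.symm.trans (hv.trans h2)))
  · rw [hrange]
    exact h.clean _ (hA (incl_mem A s))
  · rw [hrange]
    exact h.transverse

/-- A submanifold that `p` embeds transversely to `FM` is a bi-transversal. -/
def BiTransversal.ofTransverse (B : BiSubmersion FM FN W) {w : W.Pt} (ι : S.Pt → W.Pt)
    (hι : ∀ s, SmoothMapAt ι s) (s₀ : S.Pt) (hw : ι s₀ = w)
    (h : IsTransverseEmbeddingOn (B.p ∘ ι) FM s₀ ⊤) : B.BiTransversal w where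
  S := S
  ι := ι
  base := s₀
  ι_base := hw
  embedding := by
    have h1 : Topology.IsEmbedding fun s : S.Pt => (⟨s, trivial⟩ : (⊤ : Opens S.Pt)) :=
      Topology.IsEmbedding.id.codRestrict ((⊤ : Opens S.Pt) : Set S.Pt) _
    refine ⟨Topology.IsEmbedding.of_comp (continuous_iff_continuousAt.2 fun s => (hι s).1)
      (IsSubmersion.continuous B.submersion_p) (h.embedding.comp h1), fun s => ⟨hι s, ?_⟩⟩
    intro v v' hv
    refine (h.immersion s trivial).2 ?_
    have e1 := D_comp (B.submersion_p (ι s)).1 (hι s) v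
    have e2 := D_comp (B.submersion_p (ι s)).1 (hι s) v'
    exact e1.trans ((congrArg _ hv).trans e2.symm)
  clean s := by
    have h1 := h.clean s trivial
    rw [FW, IsSubmersion.tangentAt_pullback B.submersion_p,
      sup_comap_eq_top_iff (B.submersion_p (ι s)).2, ← range_D_comp (B.submersion_p (ι s)).1 (hι s)]
    exact h1
  transverse := by
    have h1 := h.transverse
    rw [FW, IsSubmersion.tangentAt_pullback B.submersion_p]
    refine isCompl_comap_of_isCompl_map (B.submersion_p (ι s₀)).2 ?_ ?_
    · rintro _ ⟨v, rfl⟩ hv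
      have e1 : D (B.p ∘ ι) s₀ v = 0 := (D_comp (B.submersion_p (ι s₀)).1 (hι s₀) v).trans hv
      have e2 : v = 0 := (h.immersion s₀ trivial).2 (e1.trans (map_zero _).symm)
      rw [e2, map_zero]
    · rw [← range_D_comp (B.submersion_p (ι s₀)).1 (hι s₀)]
      exact h1

/-- If σ is a local section of δ through `v`, then η ∘ σ commutes with the projections because δ ∘ σ
is the identity. -/
theorem exists_localMorphism_of_equivPoints {B : BiSubmersion FM FN W} {B' : BiSubmersion FM FN W'}
    {w : W.Pt} {w' : W'.Pt} (h : B.EquivPoints B' w w') :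
    ∃ (U : Opens W.Pt) (φ : W.Pt → W'.Pt), w ∈ U ∧ B.IsLocalMorphism B' U φ ∧ φ w = w' := by
  obtain ⟨_, _, _, _, V, δ, η, hR, v, rfl, rfl⟩ := h
  obtain ⟨σ, hσ, hσ'⟩ := exists_section (x := v)
    (Filter.Eventually.of_forall fun z => (hR.submersion_left z).1) (hR.submersion_left v).2
  obtain ⟨U, hU, hUσ⟩ := exists_opens_of_eventually hσ'
  refine ⟨U, η ∘ σ, hU, ⟨fun x hx => ?_, fun x hx => ?_, fun x hx => ?_⟩, congrArg η hσ⟩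
  · exact SmoothMapAt.comp (hR.submersion_right _).1 (hUσ x hx).1
  · rw [Function.comp_apply, ← hR.comm_p, (hUσ x hx).2]
  · rw [Function.comp_apply, ← hR.comm_q, (hUσ x hx).2]

theorem tangentAt_FW (B : BiSubmersion FM FN W) (w : W.Pt) : tangentAt B.FW w =
    (tangentAt FN.Mem (B.q w)).comap (D B.q w : W.T w →ₗ[ℝ] N.T (B.q w)) := by
  rw [← IsSubmersion.tangentAt_pullback B.submersion_q]
  have : B.FW = pullback B.q FN := funext₂ fun U V => propext (B.pullback_eq U V)
  rw [this]

/-- There are submanifolds complementary to the foliation at a given point. -/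
theorem exists_complementary_immersion (B : BiSubmersion FM FN W) (w : W.Pt) :
    ∃ (Z : SmoothMfd.{u}) (j : Z.Pt → W.Pt) (z : Z.Pt), (∀ᶠ y in 𝓝 z, SmoothMapAt j y) ∧ j z = w ∧
      Function.Injective (D j z) ∧
      IsCompl (D j z : Z.T z →ₗ[ℝ] W.T (j z)).range (tangentAt B.FW (j z)) := by
  obtain ⟨R, hR⟩ := Submodule.exists_isCompl (tangentAt B.FW w)
  obtain ⟨Z, j, z, hj, hjz, hi, hr⟩ := exists_immersion_range_eq R
  refine ⟨Z, j, z, hj, hjz, hi, ?_⟩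
  subst hjz
  exact (hr.trans rfl : _ = R) ▸ hR.symm

/-- A small submanifold through `w` complementary to F_W and its image under φ have equal
projections to `M` and `N`, hence the same induced graph. Transversality of the image follows from
that of its projection to `M`. -/
theorem exists_sameGerm_of_localMorphism {B : BiSubmersion FM FN W} {B' : BiSubmersion FM FN W'}
    {w : W.Pt} {w' : W'.Pt} {U : Opens W.Pt} {φ : W.Pt → W'.Pt} (hw : w ∈ U)
    (hφ : B.IsLocalMorphism B' U φ) (hφw : φ w = w') :
    ∃ (S₁ : B.BiTransversal w) (S₂ : B'.BiTransversal w'), S₁.SameGerm S₂ := by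
  obtain ⟨Z, j, z, hj, hjz, hinj, hcompl⟩ := B.exists_complementary_immersion w
  -- Used for p and for q: since T F_W is the preimage of the tangent space of the foliation below,
  -- a complement to it meets the kernel of the differential only in 0 and maps onto a complement.
  have hcomp : ∀ {Y : SmoothMfd.{u}} {f : W.Pt → Y.Pt} {F : SingularFoliation Y}, IsSubmersion f →
      tangentAt B.FW (j z) = (tangentAt F.Mem (f (j z))).comap
        (D f (j z) : W.T (j z) →ₗ[ℝ] Y.T (f (j z))) →
      ∃ A, IsTransverseEmbeddingOn (f ∘ j) F z A := by
    intro Y f F hf hF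
    have hjs := hj.self_of_nhds
    rw [hF] at hcompl
    refine exists_isTransverseEmbeddingOn (hj.mono fun y hy => (hf _).1.comp hy) ?_ ?_
    · rw [injective_iff_map_eq_zero]
      intro v hv
      have h1 : D f (j z) (D j z v) = 0 := (D_comp (hf _).1 hjs v).symm.trans hv
      have h2 : D j z v = 0 := by
        refine Submodule.disjoint_def.1 hcompl.disjoint _ ⟨v, rfl⟩ ?_
        rw [Submodule.mem_comap]
        exact (h1.symm ▸ Submodule.zero_mem _ : D f (j z) (D j z v) ∈ tangentAt F.Mem (f (j z)))
      exact hinj (h2.trans (map_zero _).symm)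
    · have h1 := isCompl_map_of_isCompl_comap (hf (j z)).2 hcompl
      rw [← range_D_comp (hf _).1 hjs] at h1
      exact h1
  obtain ⟨A₁, h₁⟩ := hcomp (F := FM) B.submersion_p
    (IsSubmersion.tangentAt_pullback B.submersion_p FM _)
  obtain ⟨A₂, h₂⟩ := hcomp (F := FN) B.submersion_q (B.tangentAt_FW _)
  obtain ⟨A, hz, hA⟩ := exists_opens_of_eventually
    ((hj.and (hj.self_of_nhds.1.eventually (Opens.eventually_mem (hjz.symm ▸ hw : j z ∈ U)))).and
      ((Opens.eventually_mem h₁.base_mem).and (Opens.eventually_mem h₂.base_mem)))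
  have t₁ := h₁.restrict (A := A) (fun y hy => (hA y hy).2.1) hz
  have t₂ := h₂.restrict (A := A) (fun y hy => (hA y hy).2.2) hz
  set ι : (Z.restrict A).Pt → W.Pt := j ∘ incl A
  have hι : ∀ s, SmoothMapAt ι s := fun s =>
    SmoothMapAt.comp (hA _ (incl_mem A s)).1.1 (smoothMapAt_incl A s)
  have hιU : ∀ s, ι s ∈ U := fun s => (hA _ (incl_mem A s)).1.2
  have hι' : ∀ s, SmoothMapAt (φ ∘ ι) s := fun s => (hφ.smooth _ (hιU s)).comp (hι s)
  have e₁ : B'.p ∘ φ ∘ ι = B.p ∘ ι := funext fun s => hφ.comm_p _ (hιU s)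
  have e₂ : B'.q ∘ φ ∘ ι = B.q ∘ ι := funext fun s => hφ.comm_q _ (hιU s)
  have t₁' : IsTransverseEmbeddingOn (B'.p ∘ φ ∘ ι) FM (restrictMk z hz) ⊤ := e₁ ▸ t₁
  have t₂' : IsTransverseEmbeddingOn (B'.q ∘ φ ∘ ι) FN (restrictMk z hz) ⊤ := e₂ ▸ t₂
  refine ⟨BiTransversal.ofTransverse B ι hι (restrictMk z hz) hjz t₁,
    BiTransversal.ofTransverse B' (φ ∘ ι) hι' (restrictMk z hz) ((congrArg φ hjz).trans hφw) t₁',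
    ⊤, ⊤, ⟨t₁, t₂⟩, ⟨t₁', t₂'⟩, ?_, ?_⟩
  · rw [← hφw, hφ.comm_p w hw]
  · exact congrArg (· '' _) (funext fun s => Prod.ext (congrFun e₁ s).symm (congrFun e₂ s).symm)

/-- Equality of the graphs matches the points of the two transversals. Followed by the inclusion
into W', the matching is a second map on the first transversal with the same projections, and
`equivPoints_of_maps` applies. -/
theorem equivPoints_of_sameGerm {B : BiSubmersion FM FN W} {B' : BiSubmersion FM FN W'}
    {w : W.Pt} {w' : W'.Pt} {S₁ : B.BiTransversal w} {S₂ : B'.BiTransversal w'}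
    (h : S₁.SameGerm S₂) : B.EquivPoints B' w w' := by
  revert h
  obtain ⟨S, ι, s₀, rfl, hemb, hclean, -⟩ := S₁
  obtain ⟨S', ι', s₀', rfl, hemb', -, -⟩ := S₂
  rintro ⟨A, A', ⟨g₁, -⟩, ⟨g₂, -⟩, hpw, hgraph⟩
  dsimp only at A A' g₁ g₂ hpw hgraph
  have hg : ∀ s ∈ A, ∃ s' ∈ A', B'.p (ι' s') = B.p (ι s) ∧ B'.q (ι' s') = B.q (ι s) := by
    intro s hs
    obtain ⟨s', hs', h⟩ : (B.p (ι s), B.q (ι s)) ∈ (fun s => (B'.p (ι' s), B'.q (ι' s))) '' A' :=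
      hgraph.le ⟨s, hs, rfl⟩
    exact ⟨s', hs', congrArg Prod.fst h, congrArg Prod.snd h⟩
  have : Nonempty S'.Pt := ⟨s₀'⟩
  choose! κ hκA hκp hκq using hg
  have hinj : ∀ s ∈ A', ∀ t ∈ A', B'.p (ι' s) = B'.p (ι' t) → s = t := fun s hs t ht hst =>
    congrArg Subtype.val (g₂.embedding.injective (a₁ := ⟨s, hs⟩) (a₂ := ⟨t, ht⟩) hst)
  have hκ0 : κ s₀ = s₀' := hinj _ (hκA _ g₁.base_mem) _ g₂.base_mem
    ((hκp _ g₁.base_mem).trans hpw)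
  have hA := Opens.eventually_mem g₁.base_mem
  have hpι : ∀ s, SmoothMapAt (B.p ∘ ι) s := fun s => (B.submersion_p _).1.comp (hemb.2 s).1
  have hpι' : ∀ s, SmoothMapAt (B'.p ∘ ι') s := fun s => (B'.submersion_p _).1.comp (hemb'.2 s).1
  -- The matching κ is chosen pointwise. It is continuous at `s₀` because p' ∘ ι' is an embedding on
  -- `A'` and p' ∘ ι' ∘ κ = p ∘ ι; near `s₀` it then agrees with r ∘ p ∘ ι, which is smooth.
  have hκc : Filter.Tendsto κ (𝓝 s₀) (𝓝 s₀') := by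
    have h1 : Filter.Tendsto (fun s => B.p (ι s)) (𝓝 s₀) (𝓝 (B'.p (ι' s₀'))) := by
      rw [← hpw]
      exact (hpι s₀).1.tendsto
    intro O hO
    rw [Filter.mem_map]
    have h2 : Subtype.val ⁻¹' O ∈ 𝓝 (⟨s₀', g₂.base_mem⟩ : A') :=
      continuous_subtype_val.continuousAt hO
    rw [g₂.embedding.isInducing.nhds_eq_comap] at h2
    obtain ⟨Q, hQ, hQO⟩ := h2
    filter_upwards [hA, h1.eventually hQ] with s h3 h4
    refine hQO (a := ⟨κ s, hκA s h3⟩) ?_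
    change B'.p (ι' (κ s)) ∈ Q
    rw [hκp s h3]
    exact h4
  obtain ⟨r, hr, hrf⟩ := exists_leftInverse (f := B'.p ∘ ι') (x := s₀')
    (Filter.Eventually.of_forall hpι') (g₂.immersion _ g₂.base_mem).2
  set η : S.Pt → W'.Pt := fun s => ι' (r (B.p (ι s)))
  have hηκ : ∀ᶠ s in 𝓝 s₀, η s = ι' (κ s) := by
    filter_upwards [hA, hκc.eventually hrf] with s h1 h2
    simp only [Function.comp_apply] at h2
    simp only [η]
    rw [← hκp s h1, h2]
  have hη0 : η s₀ = ι' s₀' := by rw [hηκ.self_of_nhds, hκ0]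
  have hηs : ∀ᶠ s in 𝓝 s₀, SmoothMapAt η s := by
    have h1 : ∀ᶠ y in 𝓝 (B.p (ι s₀)), SmoothMapAt r y := by
      rw [hpw]
      exact hr
    filter_upwards [(hpι s₀).1.eventually h1] with s h2
    exact (hemb'.2 _).1.comp (SmoothMapAt.comp (g := r) h2 (hpι s))
  have hp : ∀ᶠ s in 𝓝 s₀, B.p (ι s) = B'.p (η s) := by
    filter_upwards [hA, hηκ] with s h1 h2
    rw [h2, hκp s h1]
  have hq : ∀ᶠ s in 𝓝 s₀, B.q (ι s) = B'.q (η s) := by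
    filter_upwards [hA, hηκ] with s h1 h2
    rw [h2, hκq s h1]
  -- p' ∘ η and p ∘ ι have the same germ, and p ∘ ι is transverse to F_M; transversality lifts along
  -- the submersion p'.
  have ht' : (D η s₀ : S.T s₀ →ₗ[ℝ] W'.T (η s₀)).range ⊔ tangentAt B'.FW (η s₀) = ⊤ := by
    have h1 := D_induction (f := B.p ∘ ι) (g := B'.p ∘ η) hp
      (fun y L => (L : S.T s₀ →ₗ[ℝ] M.T y).range ⊔ tangentAt FM.Mem y = ⊤) (g₁.clean _ g₁.base_mem)
    rw [range_D_comp (B'.submersion_p _).1 hηs.self_of_nhds] at h1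
    rw [FW, IsSubmersion.tangentAt_pullback B'.submersion_p]
    exact (sup_comap_eq_top_iff (B'.submersion_p _).2).2 h1
  have := equivPoints_of_maps B B' (Filter.Eventually.of_forall fun s => (hemb.2 s).1) hηs hp hq
    (hclean s₀) ht'
  rwa [hη0] at this

end BiSubmersion

end

theorem mainTheorem8 (M N W W' : SmoothMfd.{u})
    (FM : SingularFoliation M) (FN : SingularFoliation N)
    (B : BiSubmersion FM FN W) (B' : BiSubmersion FM FN W') (w : W.Pt) (w' : W'.Pt) :
    List.TFAE [
      B.EquivPoints B' w w',
      ∃ (U : Opens W.Pt) (φ : W.Pt → W'.Pt), w ∈ U ∧ B.IsLocalMorphism B' U φ ∧ φ w = w',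
      ∃ (U' : Opens W'.Pt) (φ' : W'.Pt → W.Pt), w' ∈ U' ∧ B'.IsLocalMorphism B U' φ' ∧ φ' w' = w,
      ∃ (S₁ : B.BiTransversal w) (S₂ : B'.BiTransversal w'), S₁.SameGerm S₂] ∧
    (∀ (S : B.BiTransversal w) (A : Opens S.S.Pt), S.GoodOn A → S.InducesFoliationIso A) := by
  refine ⟨?_, fun S A _ => S.inducesFoliationIso A⟩
  tfae_have 1 → 2 := BiSubmersion.exists_localMorphism_of_equivPoints
  tfae_have 2 → 4 := fun ⟨_, _, hw, hφ, hφw⟩ =>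
    BiSubmersion.exists_sameGerm_of_localMorphism hw hφ hφw
  tfae_have 4 → 1 := fun ⟨_, _, h⟩ => BiSubmersion.equivPoints_of_sameGerm h
  tfae_have 1 → 3 := fun h => BiSubmersion.exists_localMorphism_of_equivPoints h.symm
  -- Through the germ condition with the roles of W and W' exchanged, followed by symmetry of the
  -- equivalence.
  tfae_have 3 → 1 := fun ⟨_, _, hw, hφ, hφw⟩ =>
    have ⟨_, _, h⟩ := BiSubmersion.exists_sameGerm_of_localMorphism hw hφ hφw
    (BiSubmersion.equivPoints_of_sameGerm h).symm
  tfae_finish
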